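/- Let $\omega_1,\omega_2\in\mathbb{C}$ with $\Re(\omega_1),\Re(\omega_2)>0$ and put $\omega=\frac{\omega_1+\omega_2}{2}$. Let $G(z)=G(z;\omega_1,\omega_2)$ be Ruijsenaars' hyperbolic gamma function, i.e. the meromorphic extension to $z\in\mathbb{C}$ of $$G(z)=\exp\left(i\int_0^\infty\left(\frac{\sin(2zt)}{2\sinh(\omega_1t)\sinh(\omega_2t)}-\frac{z}{\omega_1\omega_2t}\right)\frac{dt}{t}\right),\qquad |\Im(z)|<\Re(\omega),$$ which satisfies $G(z+i\omega_1)=-2i\sinh\bigl(\pi(z+i\omega)/\omega_2\bigr)G(z)$. Write $G(a\pm z)=G(a+z)G(a-z)$. Let $\mathcal{G}_{2i\omega}=\{u\in\mathbb{C}^8:\sum_{j=1}^8u_j=4i\omega\}$, and for $u\in\mathcal{G}_{2i\omega}$ with $\Im(u_j-i\omega)<0$ for all $j=1,\dots,8$ (so that the real line separates the upward from the downward pole sequences of the integrands and may be taken as integration contour) let $$S_h(u)=\int_{\mathbb{R}}\frac{G(i\omega\pm2z)}{\prod_{j=1}^8G(u_j\pm z)}\,dz,\qquad B_h(u)=2\int_{\mathbb{R}}\frac{\prod_{j=3}^6G(z-u_j)}{\prod_{j=1,2,7,8}G(z+u_j)}\,dz$$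 be the hyperbolic hypergeometric function and the hyperbolic Barnes integral. For $(u_1,\dots,u_6)\in\mathbb{C}^6$ with $\Im(u_j-i\omega)<0$ for all $j$ and $$\Im\Bigl(\frac{1}{\omega_1\omega_2}\sum_{j=1}^6u_j\Bigr)>\Re\Bigl(\frac{2\omega}{\omega_1\omega_2}\Bigr)\qquad(*)$$ let $E_h(u_1,\dots,u_6)=\int_{\mathbb{R}}\frac{G(i\omega\pm2z)}{\prod_{j=1}^6G(u_j\pm z)}\,dz$ be the hyperbolic Euler integral. With $\epsilon_1,\dots,\epsilon_8$ the standard basis of $\mathbb{R}^8$, put $\beta_{1278}=\frac12(\epsilon_1+\epsilon_2+\epsilon_7+\epsilon_8-\epsilon_3-\epsilon_4-\epsilon_5-\epsilon_6)$ and $\alpha_{78}^-=\epsilon_7-\epsilon_8$. Let $u\in\mathcal{G}_{2i\omega}$ satisfy $\Im(u_j-i\omega)<0$ for $j=1,\dots,8$. (a) The integrals $S_h(u-r\beta_{1278})$ ($r\in\mathbb{R}$) and $B_h(u)$ converge absolutely, and $$\lim_{r\to\infty}S_h(u-r\beta_{1278})\exp\left(\frac{2\pi r\omega}{\omega_1\omega_2}\right)\exp\left(\frac{\pi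 i}{2\omega_1\omega_2}\Bigl(\sum_{j=1,2,7,8}u_j^2-\sum_{j=3}^6u_j^2\Bigr)\right)=B_h(u).$$ (b) If in addition $\Im\bigl((u_7+u_8)/\omega_1\omega_2\bigr)\ge0$ and $(*)$ holds, then the integrals $S_h(u-r\alpha_{78}^-)$ ($r\in\mathbb{R}$) and $E_h(u_1,\dots,u_6)$ converge absolutely, and $$\lim_{r\to\infty}S_h(u-r\alpha_{78}^-)\exp\left(-\frac{\pi i}{\omega_1\omega_2}(u_7+u_8)(2r-u_7+u_8)\right)=E_h(u_1,\dots,u_6).$$ -/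

import Mathlib

open MeasureTheory Filter Topology

noncomputable section

namespace HypHyp

/-- `ω = (ω₁ + ω₂) / 2`. -/
def om (ω₁ ω₂ : ℂ) : ℂ := (ω₁ + ω₂) / 2

/-- Integral representation of the hyperbolic gamma function, for `|Im z| < Re ω`. -/
def hypGammaStrip (ω₁ ω₂ z : ℂ) : ℂ :=
  Complex.exp (Complex.I * ∫ t in Set.Ioi (0 : ℝ),
    (Complex.sin (2 * z * t) / (2 * Complex.sinh (ω₁ * t) * Complex.sinh (ω₂ * t))
      - z / (ω₁ * ω₂ * t)) / t)

/-- The factor in the difference equation `G(z + iω₁) = -2i sinh(π(z + iω)/ω₂) G(z)`. -/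
def shiftFactor (ω₁ ω₂ z : ℂ) : ℂ :=
  -2 * Complex.I * Complex.sinh (Real.pi * ((z + Complex.I * om ω₁ ω₂) / ω₂))

/-- Ruijsenaars' hyperbolic gamma function `G(z; ω₁, ω₂)` for `Re ω₁, Re ω₂ > 0`.
In the strip `|Im z| < Re ω` it is the integral representation.  Outside the strip it is continued
by the difference equation `G(z + iω₁) = -2i sinh(π(z + iω)/ω₂) G(z)`: with `n` the integer nearest
to `Im z / Re ω₁`, the point `w = z - i n ω₁` satisfies `|Im w| ≤ Re ω₁ / 2 < Re ω`, and
`G(z)` is obtained from `G(w)` by `n` steps upwards (if `n > 0`) or `-n` steps downwards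
(if `n < 0`); at most one of the two products below is nonempty.  Away from the poles this is the
meromorphic extension of the integral representation; at the poles, where a factor of the
denominator vanishes, the value is `0`, so that `1 / G` has there its correct value `0`. -/
def hypGamma (ω₁ ω₂ z : ℂ) : ℂ :=
  if |z.im| < (om ω₁ ω₂).re then hypGammaStrip ω₁ ω₂ z
  else
    let n : ℤ := round (z.im / ω₁.re)
    let w : ℂ := z - n * (Complex.I * ω₁)
    hypGammaStrip ω₁ ω₂ w
      * (∏ k ∈ Finset.range n.toNat, shiftFactor ω₁ ω₂ (w + k * (Complex.I * ω₁)))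
      / (∏ k ∈ Finset.range (-n).toNat, shiftFactor ω₁ ω₂ (w - (k + 1) * (Complex.I * ω₁)))

/-- The parameter hyperplane `𝒢_c = {u ∈ ℂ⁸ : u₁ + ⋯ + u₈ = 2c}`.
The coordinates `u₁, …, u₈` are `u 0, …, u 7`. -/
def paramSpace (c : ℂ) : Set (Fin 8 → ℂ) := {u | ∑ j, u j = 2 * c}

/-- The root `β₁₂₇₈ = (ε₁ + ε₂ + ε₇ + ε₈ - ε₃ - ε₄ - ε₅ - ε₆) / 2` of `E₇`. -/
def beta1278 : Fin 8 → ℂ := ![1/2, 1/2, -1/2, -1/2, -1/2, -1/2, 1/2, 1/2]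

/-- The root `α₇₈⁻ = ε₇ - ε₈` of `E₇`. -/
def alpha78 : Fin 8 → ℂ := ![0, 0, 0, 0, 0, 0, 1, -1]

/-- Integrand `G(iω ± 2z) / ∏_{j=1}^8 G(u_j ± z)` of the hyperbolic hypergeometric function. -/
def Ih (ω₁ ω₂ : ℂ) (u : Fin 8 → ℂ) (z : ℂ) : ℂ :=
  hypGamma ω₁ ω₂ (Complex.I * om ω₁ ω₂ + 2 * z) * hypGamma ω₁ ω₂ (Complex.I * om ω₁ ω₂ - 2 * z)
    / ∏ j, (hypGamma ω₁ ω₂ (u j + z) * hypGamma ω₁ ω₂ (u j - z))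

/-- The hyperbolic hypergeometric function `S_h(u)` for `u ∈ 𝒢_{2iω}` with `Im(u_j - iω) < 0` for
all `j`.  The upward poles of the integrand are among `iω - u_j + i m ω₁ + i n ω₂` (`m, n ≥ 0`),
the downward ones among their negatives; for such `u` they are separated by the real line, which
is therefore the contour. -/
def Sh (ω₁ ω₂ : ℂ) (u : Fin 8 → ℂ) : ℂ := ∫ z : ℝ, Ih ω₁ ω₂ u z

/-- Integrand `∏_{j=3}^6 G(z - u_j) / ∏_{j=1,2,7,8} G(z + u_j)` of the hyperbolic Barnes
integral. -/
def barnesIntegrand (ω₁ ω₂ : ℂ) (u : Fin 8 → ℂ) (z : ℂ) : ℂ :=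
  (∏ j ∈ {2, 3, 4, 5}, hypGamma ω₁ ω₂ (z - u j)) / ∏ j ∈ {0, 1, 6, 7}, hypGamma ω₁ ω₂ (z + u j)

/-- The hyperbolic Barnes integral `B_h(u)` for `u ∈ 𝒢_{2iω}` with `Im(u_j - iω) < 0` for all `j`,
so that the real line separates the upward from the downward poles. -/
def Bh (ω₁ ω₂ : ℂ) (u : Fin 8 → ℂ) : ℂ := 2 * ∫ z : ℝ, barnesIntegrand ω₁ ω₂ u z

/-- Integrand `G(iω ± 2z) / ∏_{j=1}^6 G(u_j ± z)` of the hyperbolic Euler integral. -/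
def eulerIntegrand (ω₁ ω₂ : ℂ) (u : Fin 6 → ℂ) (z : ℂ) : ℂ :=
  hypGamma ω₁ ω₂ (Complex.I * om ω₁ ω₂ + 2 * z) * hypGamma ω₁ ω₂ (Complex.I * om ω₁ ω₂ - 2 * z)
    / ∏ j, (hypGamma ω₁ ω₂ (u j + z) * hypGamma ω₁ ω₂ (u j - z))

/-- The hyperbolic Euler integral `E_h(u₁, …, u₆)` for parameters with `Im(u_j - iω) < 0` for all
`j`, so that the real line separates the upward from the downward poles, and
`Im((u₁ + ⋯ + u₆)/(ω₁ω₂)) > Re(2ω/(ω₁ω₂))`. -/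
def Eh (ω₁ ω₂ : ℂ) (u : Fin 6 → ℂ) : ℂ := ∫ z : ℝ, eulerIntegrand ω₁ ω₂ u z

end HypHyp

end

/-!
The proof rests on the behaviour of `x ↦ G (x + a)` on a fixed horizontal line.  With
`κ = π i / (2 ω₁ ω₂)` there is one constant `C ≠ 0` such that `G (x + a) ~ C exp (-κ (x + a) ^ 2)`
as `x → ∞` and `G (x + a) ~ C⁻¹ exp (κ (x + a) ^ 2)` as `x → -∞`, for every `a` above the poles
(`gaussianLine_hypGamma`); below the zeros the same holds for `1 / G` with the inverse functions
(`gaussianLine_inv_hypGamma`).  Inside the strip of the integral representation, subtracting the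
singular terms `1 / t ^ 3`, `1 / t ^ 2` and `sin t / t ^ 2` from the integrand leaves Fourier
integrals of integrable functions (`stripIntegral_eq`); these vanish at infinity by the
Riemann–Lebesgue lemma, and the subtracted terms integrate to an explicit quadratic polynomial.
Outside the strip, each factor `shiftFactor` of the continuation has the matching exponential
asymptotics.  Continuity on the line turns the asymptotics into global bounds
(`GaussianLine.exists_bound`), and absolute convergence of all integrals follows by adding
exponents.

Both limits are then dominated convergence.  For the Barnes integral, `S_h` is written as twice the
integral over `(0, ∞)` and `z` is replaced by `z + r / 2`; the normalized integrand becomes the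
Barnes integrand times a factor that is bounded for `2 z + r ≥ 0` and tends to `1` (`barnesRatio`).
For the Euler integral the corresponding factor `eulerRatio` involves only the two moving
parameters, and it is bounded because `Im ((u₇ + u₈) / (ω₁ ω₂)) ≥ 0` and `|z - r| + |z + r| ≥ 2 r`.

The Barnes integrand contains `G (z - u_j)` where `S_h` gives `1 / G (u_j - z)`, so the reflection
equation `G (-z) = 1 / G (z)` is needed (`inv_hypGamma`).  In the strip it is the oddness of the
integral.  Outside, the continuation by the nearest integer is compatible with `z ↦ -z` except
when `Im z / Re ω₁` is half an odd integer, and there it amounts to the difference equation on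
`Im z = -Re ω₁ / 2`.  This is the evaluation of
`∫ (1 / (a t) - cos (2 x t) / sinh (a t)) dt / t` as `log (2 cosh (π x / a))`: the derivatives agree
by the sine transform of `1 / sinh`, a consequence of the partial fractions of the cotangent, and
the constant is found from the asymptotics at infinity (`exp_logCoshIntegral`).
-/

open MeasureTheory Filter Topology Asymptotics

noncomputable section

namespace HypHyp

variable {ω₁ ω₂ : ℂ}

/-! ### Laplace transforms and elementary oscillatory integrals -/

lemma integrableOn_exp_neg_mul {c : ℂ} (hc : 0 < c.re) :
    IntegrableOn (fun t : ℝ => Complex.exp (-c * t)) (Set.Ioi 0) :=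
  integrableOn_exp_mul_complex_Ioi (by simpa using hc) 0

lemma integral_exp_neg_mul {c : ℂ} (hc : 0 < c.re) :
    ∫ t in Set.Ioi (0 : ℝ), Complex.exp (-c * t) = 1 / c := by
  rw [integral_exp_mul_complex_Ioi (by simpa using hc) 0]
  simp [neg_div_neg_eq]

lemma re_sub_add_mul_I_pos {c : ℂ} (hc : 0 < c.re) (b : ℝ) :
    0 < (c - b * Complex.I).re ∧ 0 < (c + b * Complex.I).re := by
  simpa using hc

lemma add_mul_I_ne_zero {c : ℂ} (hc : 0 < c.re) (b : ℝ) : c + b * Complex.I ≠ 0 := by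
  intro h
  have := (re_sub_add_mul_I_pos hc b).2
  rw [h] at this
  simp at this

lemma sub_mul_I_ne_zero {c : ℂ} (hc : 0 < c.re) (b : ℝ) : c - b * Complex.I ≠ 0 := by
  intro h
  have := (re_sub_add_mul_I_pos hc b).1
  rw [h] at this
  simp at this

lemma sq_add_sq_eq_mul (c : ℂ) (b : ℝ) :
    c ^ 2 + (b : ℂ) ^ 2 = (c - b * Complex.I) * (c + b * Complex.I) := by
  linear_combination (b : ℂ) ^ 2 * Complex.I_sq

lemma sq_add_sq_ne_zero {c : ℂ} (hc : 0 < c.re) (b : ℝ) : c ^ 2 + (b : ℂ) ^ 2 ≠ 0 := by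
  rw [sq_add_sq_eq_mul]
  exact mul_ne_zero (sub_mul_I_ne_zero hc b) (add_mul_I_ne_zero hc b)

lemma sin_mul_exp_eq (c : ℂ) (b t : ℝ) :
    Complex.sin (b * t) * Complex.exp (-c * t) =
      Complex.I / 2 * (Complex.exp (-(c + b * Complex.I) * t)
        - Complex.exp (-(c - b * Complex.I) * t)) := by
  have h1 : Complex.exp (-(c + b * Complex.I) * t)
      = Complex.exp (-(b * t) * Complex.I) * Complex.exp (-c * t) := by
    rw [← Complex.exp_add]; ring_nf
  have h2 : Complex.exp (-(c - b * Complex.I) * t)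
      = Complex.exp ((b * t) * Complex.I) * Complex.exp (-c * t) := by
    rw [← Complex.exp_add]; ring_nf
  rw [h1, h2, Complex.sin]
  ring

lemma cos_mul_exp_eq (c : ℂ) (b t : ℝ) :
    Complex.cos (b * t) * Complex.exp (-c * t) =
      1 / 2 * (Complex.exp (-(c + b * Complex.I) * t)
        + Complex.exp (-(c - b * Complex.I) * t)) := by
  have h1 : Complex.exp (-(c + b * Complex.I) * t)
      = Complex.exp (-(b * t) * Complex.I) * Complex.exp (-c * t) := by
    rw [← Complex.exp_add]; ring_nf
  have h2 : Complex.exp (-(c - b * Complex.I) * t)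
      = Complex.exp ((b * t) * Complex.I) * Complex.exp (-c * t) := by
    rw [← Complex.exp_add]; ring_nf
  rw [h1, h2, Complex.cos]
  ring

lemma integrableOn_sin_mul_exp {c : ℂ} (hc : 0 < c.re) (b : ℝ) :
    IntegrableOn (fun t : ℝ => Complex.sin (b * t) * Complex.exp (-c * t)) (Set.Ioi 0) := by
  simp_rw [sin_mul_exp_eq]
  exact ((integrableOn_exp_neg_mul (re_sub_add_mul_I_pos hc b).2).sub
    (integrableOn_exp_neg_mul (re_sub_add_mul_I_pos hc b).1)).const_mul _

lemma integral_sin_mul_exp {c : ℂ} (hc : 0 < c.re) (b : ℝ) :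
    ∫ t in Set.Ioi (0 : ℝ), Complex.sin (b * t) * Complex.exp (-c * t)
      = b / (c ^ 2 + (b : ℂ) ^ 2) := by
  simp_rw [sin_mul_exp_eq]
  rw [integral_const_mul, integral_sub (integrableOn_exp_neg_mul (re_sub_add_mul_I_pos hc b).2)
    (integrableOn_exp_neg_mul (re_sub_add_mul_I_pos hc b).1),
    integral_exp_neg_mul (re_sub_add_mul_I_pos hc b).2,
    integral_exp_neg_mul (re_sub_add_mul_I_pos hc b).1, sq_add_sq_eq_mul]
  have h1 := add_mul_I_ne_zero hc b
  have h2 := sub_mul_I_ne_zero hc b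
  rw [div_sub_div _ _ h1 h2, ← mul_div_assoc, mul_comm (c - _)]
  congr 1
  linear_combination (-(b : ℂ)) * Complex.I_sq

lemma integrableOn_cos_mul_exp {c : ℂ} (hc : 0 < c.re) (b : ℝ) :
    IntegrableOn (fun t : ℝ => Complex.cos (b * t) * Complex.exp (-c * t)) (Set.Ioi 0) := by
  simp_rw [cos_mul_exp_eq]
  exact ((integrableOn_exp_neg_mul (re_sub_add_mul_I_pos hc b).2).add
    (integrableOn_exp_neg_mul (re_sub_add_mul_I_pos hc b).1)).const_mul _

lemma integral_cos_mul_exp {c : ℂ} (hc : 0 < c.re) (b : ℝ) :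
    ∫ t in Set.Ioi (0 : ℝ), Complex.cos (b * t) * Complex.exp (-c * t)
      = c / (c ^ 2 + (b : ℂ) ^ 2) := by
  simp_rw [cos_mul_exp_eq]
  rw [integral_const_mul, integral_add (integrableOn_exp_neg_mul (re_sub_add_mul_I_pos hc b).2)
    (integrableOn_exp_neg_mul (re_sub_add_mul_I_pos hc b).1),
    integral_exp_neg_mul (re_sub_add_mul_I_pos hc b).2,
    integral_exp_neg_mul (re_sub_add_mul_I_pos hc b).1, sq_add_sq_eq_mul]
  have h1 := add_mul_I_ne_zero hc b
  have h2 := sub_mul_I_ne_zero hc b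
  field_simp
  ring

lemma integral_one_sub_cos_mul_exp {s : ℝ} (hs : 0 < s) :
    IntegrableOn (fun t : ℝ => (1 - Real.cos t) * Real.exp (-s * t)) (Set.Ioi 0) ∧
    ∫ t in Set.Ioi (0 : ℝ), (1 - Real.cos t) * Real.exp (-s * t) = 1 / s - s / (s ^ 2 + 1) := by
  have hs' : 0 < (s : ℂ).re := by simpa using hs
  have e : ∀ t : ℝ, (((1 - Real.cos t) * Real.exp (-s * t) : ℝ) : ℂ)
      = Complex.exp (-(s : ℂ) * t)
        - Complex.cos ((1 : ℝ) * t) * Complex.exp (-(s : ℂ) * t) := by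
    intro t; push_cast; ring_nf
  have hi := (integrableOn_exp_neg_mul hs').sub (integrableOn_cos_mul_exp hs' 1)
  constructor
  · have := hi.re
    refine this.congr (Eventually.of_forall fun t => ?_)
    simp only [Pi.sub_apply]
    rw [← e]; exact RCLike.ofReal_re (K := ℂ) _
  · apply Complex.ofReal_injective
    rw [← integral_complex_ofReal]
    simp_rw [e]
    rw [integral_sub (integrableOn_exp_neg_mul hs') (integrableOn_cos_mul_exp hs' 1),
      integral_exp_neg_mul hs', integral_cos_mul_exp hs']
    push_cast; ring_nf

lemma integral_mul_exp_neg_mul {s : ℝ} (hs : 0 < s) (n : ℕ) :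
    IntegrableOn (fun t : ℝ => t ^ n * Real.exp (-s * t)) (Set.Ioi 0) ∧
    ∫ t in Set.Ioi (0 : ℝ), t ^ n * Real.exp (-s * t) = n.factorial / s ^ (n + 1) := by
  constructor
  · have := integrableOn_rpow_mul_exp_neg_mul_rpow (p := 1) (s := n) (b := s)
      (by have : (0 : ℝ) ≤ n := n.cast_nonneg
          linarith) one_pos hs
    simpa using this
  · have := Real.integral_rpow_mul_exp_neg_mul_Ioi (a := n + 1) (r := s) (by positivity) hs
    have h2 : (1 / s) ^ ((n : ℝ) + 1) = 1 / s ^ (n + 1) := by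
      rw [← Nat.cast_add_one, Real.rpow_natCast, one_div, inv_pow, one_div]
    rw [Real.Gamma_nat_eq_factorial, h2] at this
    simp only [add_sub_cancel_right, Real.rpow_natCast] at this
    simp only [neg_mul]
    rw [this]; ring

lemma integral_sub_sin_mul_exp {s : ℝ} (hs : 0 < s) :
    IntegrableOn (fun t : ℝ => (t - Real.sin t) * Real.exp (-s * t)) (Set.Ioi 0) ∧
    ∫ t in Set.Ioi (0 : ℝ), (t - Real.sin t) * Real.exp (-s * t)
      = 1 / s ^ 2 - 1 / (s ^ 2 + 1) := by
  have hs' : 0 < (s : ℂ).re := by simpa using hs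
  have e : ∀ t : ℝ, ((Real.sin t * Real.exp (-s * t) : ℝ) : ℂ)
      = Complex.sin ((1 : ℝ) * t) * Complex.exp (-(s : ℂ) * t) := by
    intro t; push_cast; ring_nf
  have hi1 : IntegrableOn (fun t : ℝ => Real.sin t * Real.exp (-s * t)) (Set.Ioi 0) := by
    refine (integrableOn_sin_mul_exp hs' 1).re.congr (Eventually.of_forall fun t => ?_)
    simp only []
    rw [← e]; exact RCLike.ofReal_re (K := ℂ) _
  have hi2 : ∫ t in Set.Ioi (0 : ℝ), Real.sin t * Real.exp (-s * t) = 1 / (s ^ 2 + 1) := by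
    apply Complex.ofReal_injective
    rw [← integral_complex_ofReal]
    simp_rw [e]
    rw [integral_sin_mul_exp hs']
    push_cast; ring_nf
  obtain ⟨h1, h2⟩ := integral_mul_exp_neg_mul hs 1
  simp only [pow_one] at h1 h2
  simp_rw [sub_mul]
  refine ⟨h1.sub hi1, ?_⟩
  rw [integral_sub h1 hi1, h2, hi2]
  norm_num

/-- Since `n! / t ^ (n + 1) = ∫ s ^ n e ^ {-s t} ds`, Tonelli's theorem turns an integral against
`n! / t ^ (n + 1)` into an integral of the Laplace transform. -/
lemma integral_div_pow_of_laplace {f : ℝ → ℝ} (hf : Continuous f) (h0 : ∀ t, 0 < t → 0 ≤ f t)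
    (n : ℕ)
    (hint : ∀ s, 0 < s → IntegrableOn (fun t : ℝ => f t * Real.exp (-s * t)) (Set.Ioi 0))
    (hval : ∀ s, 0 < s → s ^ n * ∫ t in Set.Ioi (0 : ℝ), f t * Real.exp (-s * t)
      = (1 + s ^ 2)⁻¹) :
    IntegrableOn (fun t : ℝ => f t * (n.factorial / t ^ (n + 1))) (Set.Ioi 0) ∧
    ∫ t in Set.Ioi (0 : ℝ), f t * (n.factorial / t ^ (n + 1)) = Real.pi / 2 := by
  set F : ℝ → ℝ → ℝ := fun s t => s ^ n * (f t * Real.exp (-s * t)) with hF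
  have hFc : Continuous (Function.uncurry F) := by
    simp only [hF, Function.uncurry_def]; fun_prop
  have hFi : Integrable (Function.uncurry F)
      ((volume.restrict (Set.Ioi 0)).prod (volume.restrict (Set.Ioi 0))) := by
    rw [integrable_prod_iff hFc.aestronglyMeasurable]
    constructor
    · filter_upwards [ae_restrict_mem measurableSet_Ioi] with s hs
      exact Integrable.const_mul (hint s hs) (s ^ n)
    · refine (integrable_inv_one_add_sq.integrableOn (s := Set.Ioi 0)).congr ?_
      filter_upwards [ae_restrict_mem measurableSet_Ioi] with s hs
      rw [← hval s hs, ← integral_const_mul]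
      refine setIntegral_congr_fun measurableSet_Ioi fun t ht => ?_
      simp only [Function.uncurry, hF]
      rw [Real.norm_of_nonneg]
      have := h0 t ht
      have hs' : (0 : ℝ) < s := hs
      positivity
  have hswap := integral_integral_swap hFi
  have hin : ∀ t ∈ Set.Ioi (0 : ℝ), ∫ s in Set.Ioi (0 : ℝ), F s t
      = f t * (n.factorial / t ^ (n + 1)) := by
    intro t ht
    rw [← (integral_mul_exp_neg_mul ht n).2, ← integral_const_mul]
    congr 1; ext s; simp only [hF]; ring_nf
  constructor
  · exact (hFi.integral_prod_right).congr
      ((ae_restrict_mem measurableSet_Ioi).mono fun t ht => hin t ht)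
  · rw [← setIntegral_congr_fun measurableSet_Ioi hin, ← hswap]
    have : ∀ s ∈ Set.Ioi (0 : ℝ), ∫ t in Set.Ioi (0 : ℝ), F s t = (1 + s ^ 2)⁻¹ := by
      intro s hs
      rw [← hval s hs, ← integral_const_mul]
    rw [setIntegral_congr_fun measurableSet_Ioi this, integral_Ioi_inv_one_add_sq]
    simp

lemma integral_one_sub_cos_div_sq :
    IntegrableOn (fun t : ℝ => (1 - Real.cos t) / t ^ 2) (Set.Ioi 0) ∧
    ∫ t in Set.Ioi (0 : ℝ), (1 - Real.cos t) / t ^ 2 = Real.pi / 2 := by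
  have := integral_div_pow_of_laplace (f := fun t => 1 - Real.cos t) (by fun_prop)
    (fun t _ => by linarith [Real.cos_le_one t]) 1
    (fun s hs => (integral_one_sub_cos_mul_exp hs).1)
    (fun s hs => by
      rw [(integral_one_sub_cos_mul_exp hs).2]
      have : s ^ 2 + 1 ≠ 0 := by positivity
      have : 1 + s ^ 2 ≠ 0 := by positivity
      field_simp; ring)
  simpa [div_eq_mul_inv] using this

lemma integral_sub_sin_div_cube :
    IntegrableOn (fun t : ℝ => (t - Real.sin t) / t ^ 3) (Set.Ioi 0) ∧
    ∫ t in Set.Ioi (0 : ℝ), (t - Real.sin t) / t ^ 3 = Real.pi / 4 := by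
  obtain ⟨h1, h2⟩ := integral_div_pow_of_laplace (f := fun t => t - Real.sin t) (by fun_prop)
    (fun t ht => by linarith [Real.sin_le ht.le]) 2
    (fun s hs => (integral_sub_sin_mul_exp hs).1)
    (fun s hs => by
      rw [(integral_sub_sin_mul_exp hs).2]
      have : s ^ 2 + 1 ≠ 0 := by positivity
      have : 1 + s ^ 2 ≠ 0 := by positivity
      field_simp; ring)
  have e : ∀ t : ℝ, (t - Real.sin t) * (((2 : ℕ).factorial : ℝ) / t ^ (2 + 1))
      = 2 * ((t - Real.sin t) / t ^ 3) := by
    intro t; norm_num [Nat.factorial]; ring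
  simp_rw [e] at h1 h2
  rw [integral_const_mul] at h2
  refine ⟨?_, by linarith⟩
  refine (h1.const_mul (1 / 2)).congr (Eventually.of_forall fun t => ?_)
  simp only []; ring

lemma integral_one_sub_cos_mul_div_sq (b : ℝ) :
    IntegrableOn (fun t : ℝ => (1 - Real.cos (b * t)) / t ^ 2) (Set.Ioi 0) ∧
    ∫ t in Set.Ioi (0 : ℝ), (1 - Real.cos (b * t)) / t ^ 2 = Real.pi / 2 * |b| := by
  rcases eq_or_ne b 0 with rfl | hb
  · simp
  have hb' : 0 < |b| := abs_pos.2 hb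
  obtain ⟨h1, h2⟩ := integral_one_sub_cos_div_sq
  have e : ∀ t : ℝ, (1 - Real.cos (b * t)) / t ^ 2
      = |b| ^ 2 * ((1 - Real.cos (|b| * t)) / (|b| * t) ^ 2) := by
    intro t
    have : Real.cos (|b| * t) = Real.cos (b * t) := by
      rcases abs_choice b with h | h <;> rw [h]
      rw [neg_mul, Real.cos_neg]
    rw [this, mul_pow]
    field_simp
  simp_rw [e]
  constructor
  · refine Integrable.const_mul ?_ _
    exact (integrableOn_Ioi_comp_mul_left_iff (fun t => (1 - Real.cos t) / t ^ 2) 0 hb').2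
      (by simpa using h1)
  · rw [integral_const_mul,
      integral_comp_mul_left_Ioi (fun t => (1 - Real.cos t) / t ^ 2) 0 hb', mul_zero, h2]
    simp only [smul_eq_mul]
    field_simp

lemma integral_mul_sub_sin_mul_div_cube (b : ℝ) :
    IntegrableOn (fun t : ℝ => (b * t - Real.sin (b * t)) / t ^ 3) (Set.Ioi 0) ∧
    ∫ t in Set.Ioi (0 : ℝ), (b * t - Real.sin (b * t)) / t ^ 3 = Real.pi / 4 * (b * |b|) := by
  rcases eq_or_ne b 0 with rfl | hb
  · simp
  have hb' : 0 < |b| := abs_pos.2 hb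
  obtain ⟨h1, h2⟩ := integral_sub_sin_div_cube
  have e : ∀ t : ℝ, (b * t - Real.sin (b * t)) / t ^ 3
      = (b * |b| ^ 2) * ((|b| * t - Real.sin (|b| * t)) / (|b| * t) ^ 3) := by
    intro t
    have : |b| * (b * t - Real.sin (b * t)) = b * (|b| * t - Real.sin (|b| * t)) := by
      rcases abs_choice b with h | h <;> rw [h]
      rw [neg_mul b t, Real.sin_neg]; ring
    rw [show b * |b| ^ 2 * ((|b| * t - Real.sin (|b| * t)) / (|b| * t) ^ 3)
      = |b| ^ 2 * (b * (|b| * t - Real.sin (|b| * t))) / (|b| * t) ^ 3 by ring, ← this, mul_pow]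
    field_simp
  simp_rw [e]
  constructor
  · refine Integrable.const_mul ?_ _
    exact (integrableOn_Ioi_comp_mul_left_iff (fun t => (t - Real.sin t) / t ^ 3) 0 hb').2
      (by simpa using h1)
  · rw [integral_const_mul,
      integral_comp_mul_left_Ioi (fun t => (t - Real.sin t) / t ^ 3) 0 hb', mul_zero, h2]
    simp only [smul_eq_mul]
    field_simp

/-- `sin (b t) sin t / t ^ 2` is a difference of two functions `(1 - cos (c t)) / t ^ 2`. -/
lemma integral_sin_mul_sin_div_sq (b : ℝ) :
    IntegrableOn (fun t : ℝ => Real.sin (b * t) * (Real.sin t / t ^ 2)) (Set.Ioi 0) ∧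
    ∫ t in Set.Ioi (0 : ℝ), Real.sin (b * t) * (Real.sin t / t ^ 2)
      = Real.pi / 4 * (|b + 1| - |b - 1|) := by
  have e : ∀ t : ℝ, Real.sin (b * t) * (Real.sin t / t ^ 2)
      = 1 / 2 * ((1 - Real.cos ((b + 1) * t)) / t ^ 2 - (1 - Real.cos ((b - 1) * t)) / t ^ 2) := by
    intro t
    rw [add_mul, sub_mul, one_mul, Real.cos_add, Real.cos_sub]
    ring
  simp_rw [e]
  refine ⟨((integral_one_sub_cos_mul_div_sq _).1.sub
    (integral_one_sub_cos_mul_div_sq _).1).const_mul _, ?_⟩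
  rw [integral_const_mul, integral_sub (integral_one_sub_cos_mul_div_sq _).1
    (integral_one_sub_cos_mul_div_sq _).1, (integral_one_sub_cos_mul_div_sq _).2,
    (integral_one_sub_cos_mul_div_sq _).2]
  ring

/-! ### Expansion and decay of `1 / (sinh (ω₁ t) sinh (ω₂ t))` -/

lemma le_norm_sinh (w : ℂ) : (Real.exp w.re - Real.exp (-w.re)) / 2 ≤ ‖Complex.sinh w‖ := by
  rw [Complex.sinh, norm_div, Complex.norm_ofNat]
  gcongr
  have := norm_sub_norm_le (Complex.exp w) (Complex.exp (-w))
  simpa [Complex.norm_exp] using this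

lemma sinh_ne_zero_of_re_pos {w : ℂ} (hw : 0 < w.re) : Complex.sinh w ≠ 0 := by
  intro h
  have h1 := le_norm_sinh w
  have h2 : Real.exp (-w.re) < Real.exp w.re := Real.exp_lt_exp.2 (by linarith)
  rw [h, norm_zero] at h1
  linarith

lemma sinh_mul_ne_zero {a : ℂ} (ha : 0 < a.re) {t : ℝ} (ht : 0 < t) :
    Complex.sinh (a * t) ≠ 0 :=
  sinh_ne_zero_of_re_pos (by simpa using mul_pos ha ht)

lemma isBigO_inv_sinh {a : ℂ} (ha : 0 < a.re) :
    (fun t : ℝ => (Complex.sinh (a * t))⁻¹) =O[atTop] fun t => Real.exp (-a.re * t) := by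
  refine IsBigO.of_bound 4 ?_
  filter_upwards [eventually_ge_atTop (1 / a.re)] with t ht
  have h1 : 1 ≤ a.re * t := by
    rw [div_le_iff₀ ha] at ht; linarith
  have h2 := le_norm_sinh (a * t)
  have h3 : (a * t).re = a.re * t := by simp
  rw [h3] at h2
  have h4 : Real.exp (-(a.re * t)) ≤ 1 := Real.exp_le_one_iff.2 (by linarith)
  have h5 : 2 ≤ Real.exp (a.re * t) := by
    linarith [Real.add_one_le_exp (a.re * t)]
  have h6 : Real.exp (a.re * t) / 4 ≤ ‖Complex.sinh (a * t)‖ := by linarith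
  rw [norm_inv, neg_mul, Real.exp_neg, norm_inv, Real.norm_of_nonneg (Real.exp_pos _).le]
  calc ‖Complex.sinh (a * t)‖⁻¹ ≤ (Real.exp (a.re * t) / 4)⁻¹ :=
        inv_anti₀ (by positivity) h6
    _ = 4 * (Real.exp (a.re * t))⁻¹ := by rw [inv_div]; rfl

lemma isBigO_sinh_taylor :
    (fun w : ℂ => Complex.sinh w - (w + w ^ 3 / 6)) =O[𝓝 0] fun w => w ^ 4 := by
  have h1 := Complex.exp_sub_sum_range_isBigO_pow 4
  have h2 : (fun w : ℂ => Complex.exp (-w) - ∑ i ∈ Finset.range 4, (-w) ^ i / (i.factorial : ℂ))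
      =O[𝓝 0] fun w => w ^ 4 := by
    have := h1.comp_tendsto (show Tendsto (fun w : ℂ => -w) (𝓝 0) (𝓝 0) by
      simpa using (continuous_neg (G := ℂ)).tendsto 0)
    simpa [Function.comp_def, Even.neg_pow (show Even 4 by decide)] using this
  refine ((h1.sub h2).const_mul_left (1 / 2)).congr_left fun w => ?_
  simp only [Finset.sum_range_succ, Finset.sum_range_zero, Nat.factorial, Complex.sinh]
  push_cast
  ring

lemma isBigO_cosh_taylor :
    (fun w : ℂ => Complex.cosh w - (1 + w ^ 2 / 2)) =O[𝓝 0] fun w => w ^ 4 := by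
  have h1 := Complex.exp_sub_sum_range_isBigO_pow 4
  have h2 : (fun w : ℂ => Complex.exp (-w) - ∑ i ∈ Finset.range 4, (-w) ^ i / (i.factorial : ℂ))
      =O[𝓝 0] fun w => w ^ 4 := by
    have := h1.comp_tendsto (show Tendsto (fun w : ℂ => -w) (𝓝 0) (𝓝 0) by
      simpa using (continuous_neg (G := ℂ)).tendsto 0)
    simpa [Function.comp_def, Even.neg_pow (show Even 4 by decide)] using this
  refine ((h1.add h2).const_mul_left (1 / 2)).congr_left fun w => ?_
  simp only [Finset.sum_range_succ, Finset.sum_range_zero, Nat.factorial, Complex.cosh]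
  push_cast
  ring

lemma tendsto_div_sinh : Tendsto (fun w : ℂ => w / Complex.sinh w) (𝓝[≠] 0) (𝓝 1) := by
  have h := (hasDerivAt_iff_tendsto_slope_zero.1 (Complex.hasDerivAt_sinh 0))
  simp only [zero_add, Complex.sinh_zero, sub_zero, Complex.cosh_zero, smul_eq_mul] at h
  have := h.inv₀ one_ne_zero
  simpa [mul_inv, div_eq_mul_inv, mul_comm] using this

lemma isBigO_div_sinh_taylor :
    (fun w : ℂ => w / Complex.sinh w - (1 - w ^ 2 / 6)) =O[𝓝[≠] 0] fun w => w ^ 3 := by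
  have hb : (fun w : ℂ => w / Complex.sinh w) =O[𝓝[≠] 0] fun _ => (1 : ℂ) :=
    tendsto_div_sinh.isBigO_one ℂ
  have hN : (fun w : ℂ => w - (1 - w ^ 2 / 6) * Complex.sinh w) =O[𝓝[≠] 0] fun w => w ^ 4 := by
    have h1 : (fun w : ℂ => -(1 - w ^ 2 / 6)) =O[𝓝[≠] 0] fun _ => (1 : ℂ) := by
      refine Tendsto.isBigO_one ℂ (c := -(1 - 0 ^ 2 / 6)) ?_
      exact (Continuous.tendsto (by fun_prop) (0 : ℂ)).mono_left nhdsWithin_le_nhds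
    have h2 := h1.mul (isBigO_sinh_taylor.mono nhdsWithin_le_nhds)
    have h3 : (fun w : ℂ => w ^ 5 / 36) =O[𝓝[≠] 0] fun w => w ^ 4 := by
      have h4 : (fun w : ℂ => w / 36) =O[𝓝[≠] 0] fun _ => (1 : ℂ) := by
        refine Tendsto.isBigO_one ℂ (c := 0 / 36) ?_
        exact (Continuous.tendsto (by fun_prop) (0 : ℂ)).mono_left nhdsWithin_le_nhds
      refine ((isBigO_refl (fun w : ℂ => w ^ 4) (𝓝[≠] 0)).mul h4).congr ?_ ?_ <;> intro w <;> ring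
    refine ((h2.congr_right fun w => one_mul _).add h3).congr_left fun w => ?_
    ring
  have h5 : (fun w : ℂ => w⁻¹) =O[𝓝[≠] 0] fun w : ℂ => w⁻¹ := isBigO_refl _ _
  refine ((hb.mul (hN.mul h5))).congr' ?_ ?_
  · have hs : ∀ᶠ w : ℂ in 𝓝[≠] 0, Complex.sinh w ≠ 0 :=
      (Complex.hasDerivAt_sinh 0).eventually_ne (by simp)
    filter_upwards [hs, self_mem_nhdsWithin] with w hw hw0
    have hw0 : w ≠ 0 := hw0
    field_simp
  · filter_upwards [self_mem_nhdsWithin] with w hw0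
    have hw0 : w ≠ 0 := hw0
    field_simp

/-- Products respect congruence modulo `O(g)` when the factors are bounded. -/
lemma isBigO_mul_sub_mul {l : Filter ℝ} {f f₀ h h₀ : ℝ → ℂ} {g : ℝ → ℝ}
    (hf : (fun t => f t - f₀ t) =O[l] g) (hh : (fun t => h t - h₀ t) =O[l] g)
    (hf₀ : f₀ =O[l] fun _ => (1 : ℝ)) (hh₁ : h =O[l] fun _ => (1 : ℝ)) :
    (fun t => f t * h t - f₀ t * h₀ t) =O[l] g := by
  refine (((hf.mul hh₁).congr_right fun t => mul_one _).add
    ((hf₀.mul hh).congr_right fun t => one_mul _)).congr_left fun t => ?_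
  ring

lemma isBigO_one_of_continuous {f : ℝ → ℂ} (hf : Continuous f) :
    f =O[𝓝[>] 0] fun _ => (1 : ℝ) :=
  Tendsto.isBigO_one ℝ ((hf.tendsto 0).mono_left nhdsWithin_le_nhds)

lemma tendsto_const_mul_ofReal (a : ℂ) :
    Tendsto (fun t : ℝ => a * (t : ℂ)) (𝓝[>] 0) (𝓝 0) := by
  have : Continuous fun t : ℝ => a * (t : ℂ) := by fun_prop
  simpa using (this.tendsto 0).mono_left nhdsWithin_le_nhds

lemma tendsto_const_mul_ofReal_ne {a : ℂ} (ha : a ≠ 0) :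
    Tendsto (fun t : ℝ => a * (t : ℂ)) (𝓝[>] 0) (𝓝[≠] 0) := by
  refine tendsto_nhdsWithin_iff.2 ⟨tendsto_const_mul_ofReal a, ?_⟩
  filter_upwards [self_mem_nhdsWithin] with t ht
  have : (t : ℂ) ≠ 0 := by exact_mod_cast (ne_of_gt ht)
  exact mul_ne_zero ha this

lemma isBigO_const_mul_pow (a : ℂ) (l : Filter ℝ) (n : ℕ) :
    (fun t : ℝ => (a * (t : ℂ)) ^ n) =O[l] fun t => t ^ n := by
  refine IsBigO.of_bound (‖a‖ ^ n) (Eventually.of_forall fun t => ?_)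
  simp [mul_pow]

lemma isBigO_pow_of_le {m n : ℕ} (h : m ≤ n) :
    (fun t : ℝ => t ^ n) =O[𝓝[>] 0] fun t : ℝ => t ^ m := by
  obtain ⟨k, rfl⟩ := Nat.exists_eq_add_of_le h
  have h1 : (fun t : ℝ => t ^ k) =O[𝓝[>] 0] fun _ => (1 : ℝ) := by
    have : Continuous fun t : ℝ => t ^ k := by fun_prop
    exact Tendsto.isBigO_one ℝ ((this.tendsto 0).mono_left nhdsWithin_le_nhds)
  refine ((isBigO_refl (fun t : ℝ => t ^ m) _).mul h1).congr ?_ ?_ <;> intro t <;> ring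

lemma isBigO_mul_div_sinh {a : ℂ} (ha : 0 < a.re) :
    (fun t : ℝ => a * t / Complex.sinh (a * t) - (1 - (a * t) ^ 2 / 6)) =O[𝓝[>] 0]
      fun t => t ^ 3 := by
  have ha0 : a ≠ 0 := by rintro rfl; simp at ha
  exact (isBigO_div_sinh_taylor.comp_tendsto (tendsto_const_mul_ofReal_ne ha0)).trans
    (isBigO_const_mul_pow a _ 3)

/-- The kernel `1 / (sinh (ω₁ t) sinh (ω₂ t))`. -/
def sinhKernel (ω₁ ω₂ : ℂ) (t : ℝ) : ℂ := 1 / (Complex.sinh (ω₁ * t) * Complex.sinh (ω₂ * t))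

/-- The coefficient of `t ^ 2` in the expansion of `ω₁ ω₂ t ^ 2 / (sinh (ω₁ t) sinh (ω₂ t))`. -/
def kernelCoeff (ω₁ ω₂ : ℂ) : ℂ := -(ω₁ ^ 2 + ω₂ ^ 2) / 6

/-- There is no term linear in `t` because `w / sinh w` is even. -/
lemma sinhKernel_expansion (h₁ : 0 < ω₁.re) (h₂ : 0 < ω₂.re) :
    (fun t : ℝ => (t : ℂ) ^ 2 * sinhKernel ω₁ ω₂ t
      - 1 / (ω₁ * ω₂) * (1 + kernelCoeff ω₁ ω₂ * t ^ 2)) =O[𝓝[>] 0] fun t => t ^ 3 := by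
  have h10 : ω₁ ≠ 0 := by rintro rfl; simp at h₁
  have h20 : ω₂ ≠ 0 := by rintro rfl; simp at h₂
  have hb : (fun t : ℝ => ω₂ * t / Complex.sinh (ω₂ * t)) =O[𝓝[>] 0] fun _ => (1 : ℝ) :=
    (tendsto_div_sinh.comp (tendsto_const_mul_ofReal_ne h20)).isBigO_one ℝ
  have h := isBigO_mul_sub_mul (isBigO_mul_div_sinh h₁) (isBigO_mul_div_sinh h₂)
    (isBigO_one_of_continuous (by fun_prop)) hb
  have h4 : (fun t : ℝ => (ω₁ ^ 2 * ω₂ ^ 2 / 36) * ((1 : ℂ) * t) ^ 4) =O[𝓝[>] 0]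
      fun t => t ^ 3 :=
    ((isBigO_const_mul_pow 1 _ 4).trans (isBigO_pow_of_le (by norm_num))).const_mul_left _
  refine ((h.add h4).const_mul_left (1 / (ω₁ * ω₂))).congr_left fun t => ?_
  simp only [sinhKernel, kernelCoeff]
  field_simp
  ring

lemma continuousOn_sinhKernel (h₁ : 0 < ω₁.re) (h₂ : 0 < ω₂.re) :
    ContinuousOn (sinhKernel ω₁ ω₂) (Set.Ioi 0) := by
  refine ContinuousOn.div (by fun_prop) (by fun_prop) fun t ht => ?_
  exact mul_ne_zero (sinh_mul_ne_zero h₁ ht) (sinh_mul_ne_zero h₂ ht)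

lemma isBigO_sinhKernel_atTop (h₁ : 0 < ω₁.re) (h₂ : 0 < ω₂.re) :
    sinhKernel ω₁ ω₂ =O[atTop] fun t => Real.exp (-(ω₁.re + ω₂.re) * t) := by
  refine ((isBigO_inv_sinh h₁).mul (isBigO_inv_sinh h₂)).congr (fun t => ?_) fun t => ?_
  · simp [sinhKernel, mul_comm]
  · rw [← Real.exp_add]; ring_nf

lemma isBigO_exp_abs_mul {f : ℝ → ℂ} {y : ℝ} (hf : ∀ t, 0 ≤ t → ‖f t‖ ≤ Real.exp (|y| * t)) :
    f =O[atTop] fun t => Real.exp (|y| * t) := by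
  refine IsBigO.of_bound 1 ?_
  filter_upwards [eventually_ge_atTop 0] with t ht
  rw [one_mul, Real.norm_of_nonneg (Real.exp_pos _).le]
  exact hf t ht

lemma norm_cosh_ofReal_le (y t : ℝ) (ht : 0 ≤ t) :
    ‖Complex.cosh (y * t)‖ ≤ Real.exp (|y| * t) := by
  rw [Complex.cosh, norm_div, Complex.norm_ofNat]
  have h1 := norm_add_le (Complex.exp (y * t)) (Complex.exp (-(y * t)))
  have h2 : ‖Complex.exp (y * t)‖ ≤ Real.exp (|y| * t) := by
    rw [Complex.norm_exp]
    have := mul_le_mul_of_nonneg_right (le_abs_self y) ht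
    simpa using this
  have h3 : ‖Complex.exp (-(y * t))‖ ≤ Real.exp (|y| * t) := by
    rw [Complex.norm_exp]
    have := mul_le_mul_of_nonneg_right (neg_le_abs y) ht
    simpa using this
  linarith

lemma norm_sinh_ofReal_le (y t : ℝ) (ht : 0 ≤ t) :
    ‖Complex.sinh (y * t)‖ ≤ Real.exp (|y| * t) := by
  rw [Complex.sinh, norm_div, Complex.norm_ofNat]
  have h1 := norm_sub_le (Complex.exp (y * t)) (Complex.exp (-(y * t)))
  have h2 : ‖Complex.exp (y * t)‖ ≤ Real.exp (|y| * t) := by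
    rw [Complex.norm_exp]
    have := mul_le_mul_of_nonneg_right (le_abs_self y) ht
    simpa using this
  have h3 : ‖Complex.exp (-(y * t))‖ ≤ Real.exp (|y| * t) := by
    rw [Complex.norm_exp]
    have := mul_le_mul_of_nonneg_right (neg_le_abs y) ht
    simpa using this
  linarith

/-- A function on `(0, ∞)` that is continuous, bounded near `0` and `O(t ^ -2)` at infinity is
integrable. -/
lemma integrableOn_Ioi_of_isBigO {f : ℝ → ℂ} (hf : ContinuousOn f (Set.Ioi 0))
    (h0 : f =O[𝓝[>] 0] fun _ => (1 : ℝ)) (hinf : f =O[atTop] fun t => t ^ (-2 : ℝ)) :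
    IntegrableOn f (Set.Ioi 0) := by
  have hm : AEStronglyMeasurable f (volume.restrict (Set.Ioi 0)) :=
    hf.aestronglyMeasurable measurableSet_Ioi
  refine integrableOn_Ioi_iff_integrableAtFilter_atTop_nhdsWithin.2 ⟨?_, ?_, ?_⟩
  · exact hinf.integrableAtFilter ⟨Set.Ioi 0, Ioi_mem_atTop 0, hm⟩
      (integrableAtFilter_rpow_atTop_iff.2 (by norm_num))
  · refine h0.integrableAtFilter ⟨Set.Ioi 0, self_mem_nhdsWithin, hm⟩ ?_
    refine ⟨Set.Ioo 0 1, Ioo_mem_nhdsGT one_pos, ?_⟩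
    exact integrableOn_const (by simp)
  · exact hf.locallyIntegrableOn measurableSet_Ioi

lemma isBigO_one_of_mul_pow {f : ℝ → ℂ} {n : ℕ} {a : ℂ} (ha : a ≠ 0)
    (h : (fun t : ℝ => (t : ℂ) ^ n * (a * f t)) =O[𝓝[>] 0] fun t => t ^ n) :
    f =O[𝓝[>] 0] fun _ => (1 : ℝ) := by
  have h2 : (fun t : ℝ => (t : ℂ) ^ n * (a * f t)) =O[𝓝[>] 0] fun t : ℝ => (t : ℂ) ^ n := by
    refine h.trans (IsBigO.of_bound 1 (Eventually.of_forall fun t => by simp))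
  have h3 := h2.mul (isBigO_refl (fun t : ℝ => a⁻¹ * ((t : ℂ) ^ n)⁻¹) (𝓝[>] 0))
  have h4 : f =O[𝓝[>] 0] fun _ => a⁻¹ := by
    refine h3.congr' ?_ ?_
    · filter_upwards [self_mem_nhdsWithin] with t ht
      have : (t : ℂ) ≠ 0 := by exact_mod_cast (ne_of_gt ht)
      field_simp
    · filter_upwards [self_mem_nhdsWithin] with t ht
      have : (t : ℂ) ≠ 0 := by exact_mod_cast (ne_of_gt ht)
      field_simp
  exact h4.trans (isBigO_const_const _ one_ne_zero _)

lemma isBigO_ofReal_div_pow {f : ℝ → ℂ} {C : ℝ} (hf : ∀ t, ‖f t‖ ≤ C) {n : ℕ} (hn : 2 ≤ n) :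
    (fun t : ℝ => f t / (t : ℂ) ^ n) =O[atTop] fun t => t ^ (-2 : ℝ) := by
  refine IsBigO.of_bound C ?_
  filter_upwards [eventually_ge_atTop 1] with t ht
  have h1 : (t : ℝ) ^ (-2 : ℝ) = (t ^ 2)⁻¹ := by
    rw [Real.rpow_neg (by linarith)]; norm_num
  have ht0 : 0 < t := by linarith
  rw [h1, norm_div, norm_pow, Complex.norm_real, Real.norm_of_nonneg ht0.le,
    Real.norm_of_nonneg (by positivity), div_eq_mul_inv]
  have h2 : (t ^ n)⁻¹ ≤ (t ^ 2)⁻¹ := inv_anti₀ (by positivity) (pow_le_pow_right₀ ht hn)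
  have h3 := (norm_nonneg _).trans (hf t)
  exact mul_le_mul (hf t) h2 (by positivity) h3

/-- The bound on `y` makes the exponential decay of the kernel win against the growth of `f`. -/
lemma isBigO_mul_sinhKernel_div (h₁ : 0 < ω₁.re) (h₂ : 0 < ω₂.re) {y : ℝ}
    (hy : |y| < ω₁.re + ω₂.re) {f : ℝ → ℂ} (hf : ∀ t, 0 ≤ t → ‖f t‖ ≤ Real.exp (|y| * t)) :
    (fun t : ℝ => f t * sinhKernel ω₁ ω₂ t / (2 * t)) =O[atTop] fun t => t ^ (-2 : ℝ) := by
  have h1 := (isBigO_exp_abs_mul hf).mul (isBigO_sinhKernel_atTop h₁ h₂)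
  have h2 : (fun t : ℝ => (1 : ℂ) / (2 * t)) =O[atTop] fun _ => (1 : ℝ) := by
    refine IsBigO.of_bound 1 ?_
    filter_upwards [eventually_ge_atTop 1] with t ht
    have : (0 : ℝ) < t := by linarith
    rw [norm_div, norm_mul, Complex.norm_real, Real.norm_of_nonneg this.le]
    simp only [norm_one, Complex.norm_ofNat, mul_one]
    rw [div_le_one (by positivity)]
    linarith
  have h3 := h1.mul h2
  have h4 : (fun t : ℝ => f t * sinhKernel ω₁ ω₂ t / (2 * t)) =O[atTop]
      fun t => Real.exp (-(ω₁.re + ω₂.re - |y|) * t) := by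
    refine h3.congr (fun t => by ring) fun t => ?_
    rw [mul_one, ← Real.exp_add]; ring_nf
  exact h4.trans (isLittleO_exp_neg_mul_rpow_atTop (by linarith) _).isBigO

/-! ### The strip integral as explicit terms plus Fourier integrals -/

/-- What remains of the factor of `sin (2 x t)` in the integrand of `hypGammaStrip` at `x + i y`
after subtracting multiples of `1 / t ^ 3` and `sin t / t ^ 2` that cancel its singularity
at `0`. -/
def sinRemainder (ω₁ ω₂ : ℂ) (y t : ℝ) : ℂ :=
  Complex.cosh ((2 * y : ℝ) * t) * sinhKernel ω₁ ω₂ t / (2 * t) - 1 / (ω₁ * ω₂) / 2 / t ^ 3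
    - 1 / (ω₁ * ω₂) * (2 * y ^ 2 + kernelCoeff ω₁ ω₂) / 2 * (Complex.sin t / t ^ 2)

/-- What remains of the factor of `i cos (2 x t)` in the integrand of `hypGammaStrip` at `x + i y`
after subtracting the multiple of `1 / t ^ 2` that cancels its singularity at `0`. -/
def cosRemainder (ω₁ ω₂ : ℂ) (y t : ℝ) : ℂ :=
  Complex.sinh ((2 * y : ℝ) * t) * sinhKernel ω₁ ω₂ t / (2 * t) - y / (ω₁ * ω₂) / t ^ 2

lemma isBigO_cosh_mul (b : ℝ) :
    (fun t : ℝ => Complex.cosh (b * t) - (1 + (b * t) ^ 2 / 2)) =O[𝓝[>] 0] fun t => t ^ 3 :=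
  ((isBigO_cosh_taylor.comp_tendsto (tendsto_const_mul_ofReal b)).trans
    (isBigO_const_mul_pow _ _ 4)).trans (isBigO_pow_of_le (by norm_num))

lemma isBigO_sinh_mul (b : ℂ) :
    (fun t : ℝ => Complex.sinh (b * t) - b * t) =O[𝓝[>] 0] fun t => t ^ 3 := by
  have h := ((isBigO_sinh_taylor.comp_tendsto (tendsto_const_mul_ofReal b)).trans
    (isBigO_const_mul_pow _ _ 4)).trans (isBigO_pow_of_le (show 3 ≤ 4 by norm_num))
  refine (h.add ((isBigO_const_mul_pow b _ 3).const_mul_left (1 / 6))).congr_left fun t => ?_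
  simp only [Function.comp]
  ring

lemma isBigO_mul_sin :
    (fun t : ℝ => (t : ℂ) * Complex.sin t - t ^ 2) =O[𝓝[>] 0] fun t => t ^ 3 := by
  have h := (isBigO_sinh_mul Complex.I).mul
    (isBigO_one_of_continuous (f := fun t : ℝ => -Complex.I * t) (by fun_prop))
  refine h.congr (fun t => ?_) fun t => mul_one _
  rw [mul_comm Complex.I (t : ℂ), Complex.sinh_mul_I]
  linear_combination (t ^ 2 - t * Complex.sin t) * Complex.I_sq

lemma isBigO_sq_mul_sinhKernel (h₁ : 0 < ω₁.re) (h₂ : 0 < ω₂.re) :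
    (fun t : ℝ => (t : ℂ) ^ 2 * sinhKernel ω₁ ω₂ t) =O[𝓝[>] 0] fun _ => (1 : ℝ) := by
  have h1 := (sinhKernel_expansion h₁ h₂).trans (isBigO_pow_of_le (Nat.zero_le 3))
  simp only [pow_zero] at h1
  have h2 : (fun t : ℝ => 1 / (ω₁ * ω₂) * (1 + kernelCoeff ω₁ ω₂ * (t : ℂ) ^ 2)) =O[𝓝[>] 0]
      fun _ => (1 : ℝ) := isBigO_one_of_continuous (by fun_prop)
  exact (h1.add h2).congr_left fun t => by ring

lemma integrableOn_sinRemainder (h₁ : 0 < ω₁.re) (h₂ : 0 < ω₂.re) {y : ℝ}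
    (hy : |2 * y| < ω₁.re + ω₂.re) : IntegrableOn (sinRemainder ω₁ ω₂ y) (Set.Ioi 0) := by
  have hne : ∀ t ∈ Set.Ioi (0 : ℝ), (t : ℂ) ≠ 0 := fun t ht => by exact_mod_cast (ne_of_gt ht)
  refine integrableOn_Ioi_of_isBigO ?_ ?_ ?_
  · refine ((ContinuousOn.div ?_ (by fun_prop) fun t ht => ?_).sub
      (ContinuousOn.div (by fun_prop) (by fun_prop) fun t ht => ?_)).sub
      (ContinuousOn.mul (by fun_prop) (ContinuousOn.div (by fun_prop) (by fun_prop) fun t ht => ?_))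
    · exact ContinuousOn.mul (by fun_prop) (continuousOn_sinhKernel h₁ h₂)
    · exact mul_ne_zero two_ne_zero (hne t ht)
    · exact pow_ne_zero _ (hne t ht)
    · exact pow_ne_zero _ (hne t ht)
  · refine isBigO_one_of_mul_pow (n := 3) (a := 2) two_ne_zero ?_
    -- Multiplied by `2 t ^ 3`, the remainder is the error of a product of two expansions (`hA`),
    -- that of `t sin t` (`hB`), and the product of the quadratic terms (`hC`).
    have hA := isBigO_mul_sub_mul (isBigO_cosh_mul (2 * y)) (sinhKernel_expansion h₁ h₂)
      (isBigO_one_of_continuous (by fun_prop)) (isBigO_sq_mul_sinhKernel h₁ h₂)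
    have hB := isBigO_mul_sin.const_mul_left
      (1 / (ω₁ * ω₂) * (2 * y ^ 2 + kernelCoeff ω₁ ω₂))
    have hC : (fun t : ℝ => (2 * y ^ 2 * kernelCoeff ω₁ ω₂ / (ω₁ * ω₂)) * ((1 : ℂ) * t) ^ 4)
        =O[𝓝[>] 0] fun t => t ^ 3 :=
      ((isBigO_const_mul_pow 1 _ 4).trans (isBigO_pow_of_le (by norm_num))).const_mul_left _
    refine ((hA.sub hB).add hC).congr' ?_ EventuallyEq.rfl
    filter_upwards [self_mem_nhdsWithin] with t ht
    have := hne t ht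
    have h10 : ω₁ ≠ 0 := by rintro rfl; simp at h₁
    have h20 : ω₂ ≠ 0 := by rintro rfl; simp at h₂
    simp only [sinRemainder]
    push_cast
    field_simp
    ring
  · refine ((isBigO_mul_sinhKernel_div h₁ h₂ hy
      (f := fun t : ℝ => Complex.cosh ((2 * y : ℝ) * t)) (norm_cosh_ofReal_le _)).sub ?_).sub ?_
    · exact isBigO_ofReal_div_pow (fun _ => le_rfl) (by norm_num)
    · refine IsBigO.const_mul_left (isBigO_ofReal_div_pow (C := 1) (fun t => ?_) le_rfl) _
      rw [← Complex.ofReal_sin, Complex.norm_real]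
      exact Real.abs_sin_le_one t

lemma integrableOn_cosRemainder (h₁ : 0 < ω₁.re) (h₂ : 0 < ω₂.re) {y : ℝ}
    (hy : |2 * y| < ω₁.re + ω₂.re) : IntegrableOn (cosRemainder ω₁ ω₂ y) (Set.Ioi 0) := by
  have hne : ∀ t ∈ Set.Ioi (0 : ℝ), (t : ℂ) ≠ 0 := fun t ht => by exact_mod_cast (ne_of_gt ht)
  refine integrableOn_Ioi_of_isBigO ?_ ?_ ?_
  · refine (ContinuousOn.div ?_ (by fun_prop) fun t ht => ?_).sub
      (ContinuousOn.div (by fun_prop) (by fun_prop) fun t ht => ?_)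
    · exact ContinuousOn.mul (by fun_prop) (continuousOn_sinhKernel h₁ h₂)
    · exact mul_ne_zero two_ne_zero (hne t ht)
    · exact pow_ne_zero _ (hne t ht)
  · refine isBigO_one_of_mul_pow (n := 3) (a := 2) two_ne_zero ?_
    have hA := isBigO_mul_sub_mul (isBigO_sinh_mul ((2 * y : ℝ) : ℂ)) (sinhKernel_expansion h₁ h₂)
      (isBigO_one_of_continuous (by fun_prop)) (isBigO_sq_mul_sinhKernel h₁ h₂)
    have hC : (fun t : ℝ => (2 * y * kernelCoeff ω₁ ω₂ / (ω₁ * ω₂)) * ((1 : ℂ) * t) ^ 3)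
        =O[𝓝[>] 0] fun t => t ^ 3 := (isBigO_const_mul_pow 1 _ 3).const_mul_left _
    refine (hA.add hC).congr' ?_ EventuallyEq.rfl
    filter_upwards [self_mem_nhdsWithin] with t ht
    have := hne t ht
    have h10 : ω₁ ≠ 0 := by rintro rfl; simp at h₁
    have h20 : ω₂ ≠ 0 := by rintro rfl; simp at h₂
    simp only [cosRemainder]
    push_cast
    field_simp
    ring
  · refine (isBigO_mul_sinhKernel_div h₁ h₂ hy
      (f := fun t : ℝ => Complex.sinh ((2 * y : ℝ) * t)) (norm_sinh_ofReal_le _)).sub ?_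
    exact isBigO_ofReal_div_pow (fun _ => le_rfl) le_rfl

/-- The integral in the exponent of `hypGammaStrip`. -/
def stripIntegral (ω₁ ω₂ z : ℂ) : ℂ :=
  ∫ t in Set.Ioi (0 : ℝ),
    (Complex.sin (2 * z * t) / (2 * Complex.sinh (ω₁ * t) * Complex.sinh (ω₂ * t))
      - z / (ω₁ * ω₂ * t)) / t

lemma hypGammaStrip_eq (ω₁ ω₂ z : ℂ) :
    hypGammaStrip ω₁ ω₂ z = Complex.exp (Complex.I * stripIntegral ω₁ ω₂ z) := rfl

lemma stripIntegral_neg (ω₁ ω₂ z : ℂ) : stripIntegral ω₁ ω₂ (-z) = -stripIntegral ω₁ ω₂ z := by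
  rw [stripIntegral, stripIntegral, ← integral_neg]
  congr 1; ext t
  rw [mul_neg, neg_mul, Complex.sin_neg]
  ring

lemma hypGammaStrip_neg (ω₁ ω₂ z : ℂ) :
    hypGammaStrip ω₁ ω₂ (-z) = (hypGammaStrip ω₁ ω₂ z)⁻¹ := by
  rw [hypGammaStrip_eq, hypGammaStrip_eq, stripIntegral_neg, mul_neg, Complex.exp_neg]

lemma hypGammaStrip_ne_zero (ω₁ ω₂ z : ℂ) : hypGammaStrip ω₁ ω₂ z ≠ 0 := Complex.exp_ne_zero _

/-- The Fourier integrals in the exponent of `hypGammaStrip`, which tend to `0` by the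
Riemann–Lebesgue lemma. -/
def fourierPart (ω₁ ω₂ : ℂ) (y x : ℝ) : ℂ :=
  (∫ t in Set.Ioi (0 : ℝ), (Real.sin (2 * x * t) : ℂ) * sinRemainder ω₁ ω₂ y t)
    + Complex.I * ∫ t in Set.Ioi (0 : ℝ), (Real.cos (2 * x * t) : ℂ) * cosRemainder ω₁ ω₂ y t

lemma integrableOn_bounded_mul {f : ℝ → ℝ} (hf : Continuous f) (hb : ∀ t, |f t| ≤ 1) {g : ℝ → ℂ}
    (hg : IntegrableOn g (Set.Ioi 0)) : IntegrableOn (fun t => (f t : ℂ) * g t) (Set.Ioi 0) := by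
  refine Integrable.bdd_mul (c := 1) hg ?_ ?_
  · exact (Complex.continuous_ofReal.comp hf).aestronglyMeasurable
  · exact Eventually.of_forall fun t => by simpa using hb t

lemma stripIntegrand_eq (ω₁ ω₂ : ℂ) (x y : ℝ) {t : ℝ} (ht : 0 < t) :
    (Complex.sin (2 * (x + y * Complex.I) * t)
        / (2 * Complex.sinh (ω₁ * t) * Complex.sinh (ω₂ * t))
      - (x + y * Complex.I) / (ω₁ * ω₂ * t)) / t
    = -(1 / (ω₁ * ω₂)) / 2 * (((2 * x * t - Real.sin (2 * x * t)) / t ^ 3 : ℝ) : ℂ)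
      + -(Complex.I * y / (ω₁ * ω₂)) * (((1 - Real.cos (2 * x * t)) / t ^ 2 : ℝ) : ℂ)
      + 1 / (ω₁ * ω₂) * (2 * y ^ 2 + kernelCoeff ω₁ ω₂) / 2
        * ((Real.sin (2 * x * t) * (Real.sin t / t ^ 2) : ℝ) : ℂ)
      + (Real.sin (2 * x * t) : ℂ) * sinRemainder ω₁ ω₂ y t
      + Complex.I * ((Real.cos (2 * x * t) : ℂ) * cosRemainder ω₁ ω₂ y t) := by
  have hs : Complex.sin (2 * (x + y * Complex.I) * t)
      = Complex.sin (2 * x * t) * Complex.cosh (2 * y * t)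
        + Complex.cos (2 * x * t) * Complex.sinh (2 * y * t) * Complex.I := by
    rw [show 2 * ((x : ℂ) + y * Complex.I) * t = 2 * x * t + (2 * y * t) * Complex.I by ring,
      Complex.sin_add, Complex.cos_mul_I, Complex.sin_mul_I]
    ring
  have ht0 : (t : ℂ) ≠ 0 := by exact_mod_cast ht.ne'
  have hk : (1 : ℂ) / (2 * Complex.sinh (ω₁ * t) * Complex.sinh (ω₂ * t))
      = sinhKernel ω₁ ω₂ t / 2 := by
    simp only [sinhKernel]
    rw [mul_assoc, div_div, mul_comm (2 : ℂ)]
  rw [hs, div_eq_mul_one_div (_ + _) (2 * _ * _), hk]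
  simp only [sinRemainder, cosRemainder]
  push_cast
  simp only [div_eq_mul_inv, mul_inv]
  field_simp
  ring

lemma integral_add_five {μ : Measure ℝ} {f₁ f₂ f₃ f₄ f₅ : ℝ → ℂ} (h₁ : Integrable f₁ μ)
    (h₂ : Integrable f₂ μ) (h₃ : Integrable f₃ μ) (h₄ : Integrable f₄ μ) (h₅ : Integrable f₅ μ) :
    ∫ t, (f₁ t + f₂ t + f₃ t + f₄ t + f₅ t) ∂μ
      = (∫ t, f₁ t ∂μ) + (∫ t, f₂ t ∂μ) + (∫ t, f₃ t ∂μ) + (∫ t, f₄ t ∂μ) + ∫ t, f₅ t ∂μ := by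
  have h12 : Integrable (fun t => f₁ t + f₂ t) μ := h₁.add h₂
  have h13 : Integrable (fun t => f₁ t + f₂ t + f₃ t) μ := h12.add h₃
  have h14 : Integrable (fun t => f₁ t + f₂ t + f₃ t + f₄ t) μ := h13.add h₄
  rw [integral_add h14 h₅, integral_add h13 h₄, integral_add h12 h₃, integral_add h₁ h₂]

/-- For `x ≥ 1 / 2` the explicit part is `-π (z ^ 2 + (ω₁ ^ 2 + ω₂ ^ 2) / 12) / (2 ω₁ ω₂)` with
`z = x + i y`. -/
lemma stripIntegral_eq (h₁ : 0 < ω₁.re) (h₂ : 0 < ω₂.re) {y : ℝ}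
    (hy : |2 * y| < ω₁.re + ω₂.re) (x : ℝ) :
    stripIntegral ω₁ ω₂ (x + y * Complex.I)
      = 1 / (ω₁ * ω₂) * (-(Real.pi / 2) * (x * |x| : ℝ) - Complex.I * Real.pi * y * (|x| : ℝ)
        + (2 * y ^ 2 + kernelCoeff ω₁ ω₂) * Real.pi / 8 * (|2 * x + 1| - |2 * x - 1| : ℝ))
        + fourierPart ω₁ ω₂ y x := by
  obtain ⟨a1, a2⟩ := integral_mul_sub_sin_mul_div_cube (2 * x)
  obtain ⟨b1, b2⟩ := integral_one_sub_cos_mul_div_sq (2 * x)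
  obtain ⟨c1, c2⟩ := integral_sin_mul_sin_div_sq (2 * x)
  have a1' := Integrable.const_mul (Integrable.ofReal (𝕜 := ℂ) a1) (-(1 / (ω₁ * ω₂)) / 2)
  have b1' := Integrable.const_mul (Integrable.ofReal (𝕜 := ℂ) b1)
    (-(Complex.I * y / (ω₁ * ω₂)))
  have c1' := Integrable.const_mul (Integrable.ofReal (𝕜 := ℂ) c1)
    (1 / (ω₁ * ω₂) * (2 * y ^ 2 + kernelCoeff ω₁ ω₂) / 2)
  have d1 := integrableOn_bounded_mul (f := fun t => Real.sin (2 * x * t)) (by fun_prop)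
    (fun t => Real.abs_sin_le_one _) (integrableOn_sinRemainder h₁ h₂ hy)
  have e1 := integrableOn_bounded_mul (f := fun t => Real.cos (2 * x * t)) (by fun_prop)
    (fun t => Real.abs_cos_le_one _) (integrableOn_cosRemainder h₁ h₂ hy)
  have e1' := Integrable.const_mul e1 Complex.I
  rw [stripIntegral, setIntegral_congr_fun measurableSet_Ioi
    (fun t ht => stripIntegrand_eq ω₁ ω₂ x y ht)]
  refine (integral_add_five a1' b1' c1' d1 e1').trans ?_
  simp only [integral_const_mul, RCLike.ofReal_eq_complex_ofReal]
  simp only [integral_complex_ofReal]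
  rw [a2, b2, c2, fourierPart, abs_mul, abs_two]
  push_cast
  ring

lemma continuous_fourierPart (h₁ : 0 < ω₁.re) (h₂ : 0 < ω₂.re) {y : ℝ}
    (hy : |2 * y| < ω₁.re + ω₂.re) : Continuous (fourierPart ω₁ ω₂ y) := by
  have hs := integrableOn_sinRemainder h₁ h₂ hy
  have hc := integrableOn_cosRemainder h₁ h₂ hy
  refine Continuous.add ?_ (Continuous.mul continuous_const ?_)
  · refine continuous_of_dominated (bound := fun t => ‖sinRemainder ω₁ ω₂ y t‖)
      (fun x => (integrableOn_bounded_mul (f := fun t => Real.sin (2 * x * t)) (by fun_prop)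
        (fun t => Real.abs_sin_le_one _) hs).aestronglyMeasurable)
      (fun x => Eventually.of_forall fun t => ?_) hs.norm
      (Eventually.of_forall fun t => by fun_prop)
    rw [norm_mul, Complex.norm_real]
    exact mul_le_of_le_one_left (norm_nonneg _) (Real.abs_sin_le_one _)
  · refine continuous_of_dominated (bound := fun t => ‖cosRemainder ω₁ ω₂ y t‖)
      (fun x => (integrableOn_bounded_mul (f := fun t => Real.cos (2 * x * t)) (by fun_prop)
        (fun t => Real.abs_cos_le_one _) hc).aestronglyMeasurable)
      (fun x => Eventually.of_forall fun t => ?_) hc.norm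
      (Eventually.of_forall fun t => by fun_prop)
    rw [norm_mul, Complex.norm_real]
    exact mul_le_of_le_one_left (norm_nonneg _) (Real.abs_cos_le_one _)

/-- The Riemann–Lebesgue lemma on the half-line, in complex exponential form. -/
lemma tendsto_integral_exp_Ioi {f : ℝ → ℂ} (σ : ℝ) (hσ : σ ≠ 0) :
    Tendsto (fun x : ℝ => ∫ t in Set.Ioi (0 : ℝ), Complex.exp (σ * x * t * Complex.I) * f t)
      atTop (𝓝 0) := by
  have h := Real.tendsto_integral_exp_smul_cocompact ((Set.Ioi (0 : ℝ)).indicator f)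
  have hc : Tendsto (fun x : ℝ => -σ / (2 * Real.pi) * x) atTop (cocompact ℝ) := by
    have h0 : -σ / (2 * Real.pi) ≠ 0 := div_ne_zero (neg_ne_zero.2 hσ) (by positivity)
    rw [cocompact_eq_atBot_atTop]
    rcases h0.lt_or_gt with h | h
    · exact (tendsto_id.const_mul_atTop_of_neg h).mono_right le_sup_left
    · exact (tendsto_id.const_mul_atTop h).mono_right le_sup_right
  refine (h.comp hc).congr fun x => ?_
  rw [Function.comp, ← integral_indicator measurableSet_Ioi]
  congr 1; ext t
  by_cases ht : t ∈ Set.Ioi (0 : ℝ)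
  · rw [Set.indicator_of_mem ht, Set.indicator_of_mem ht, Circle.smul_def, Real.fourierChar_apply,
      smul_eq_mul]
    congr 3
    push_cast
    have : (Real.pi : ℂ) ≠ 0 := by exact_mod_cast Real.pi_ne_zero
    field_simp
  · rw [Set.indicator_of_notMem ht, Set.indicator_of_notMem ht, smul_zero]

lemma tendsto_fourierPart (h₁ : 0 < ω₁.re) (h₂ : 0 < ω₂.re) {y : ℝ}
    (hy : |2 * y| < ω₁.re + ω₂.re) : Tendsto (fourierPart ω₁ ω₂ y) atTop (𝓝 0) := by
  have hi : ∀ {g : ℝ → ℂ}, IntegrableOn g (Set.Ioi 0) → ∀ σ x : ℝ,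
      IntegrableOn (fun t : ℝ => Complex.exp (σ * x * t * Complex.I) * g t) (Set.Ioi 0) := by
    intro g hg σ x
    refine Integrable.bdd_mul (c := 1) hg (Continuous.aestronglyMeasurable (by fun_prop)) ?_
    refine Eventually.of_forall fun t => ?_
    rw [← Complex.ofReal_mul, ← Complex.ofReal_mul, Complex.norm_exp_ofReal_mul_I]
  have hs := integrableOn_sinRemainder h₁ h₂ hy
  have hc := integrableOn_cosRemainder h₁ h₂ hy
  have t1 := fun (f : ℝ → ℂ) => tendsto_integral_exp_Ioi (f := f) 2 two_ne_zero
  have t2 := fun (f : ℝ → ℂ) => tendsto_integral_exp_Ioi (f := f) (-2) (by norm_num)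
  have hS := ((t2 (sinRemainder ω₁ ω₂ y)).sub (t1 (sinRemainder ω₁ ω₂ y))).const_mul
    (Complex.I / 2)
  have hC := ((t1 (cosRemainder ω₁ ω₂ y)).add (t2 (cosRemainder ω₁ ω₂ y))).const_mul
    (Complex.I / 2)
  have h := hS.add hC
  simp only [sub_zero, add_zero, mul_zero] at h
  refine h.congr fun x => ?_
  rw [← integral_sub (hi hs _ _) (hi hs _ _), ← integral_add (hi hc _ _) (hi hc _ _), fourierPart,
    ← integral_const_mul, ← integral_const_mul, ← integral_const_mul]
  congr 2 <;> ext t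
  · push_cast
    rw [Complex.sin]; ring_nf
  · push_cast
    rw [Complex.cos]; ring_nf

/-! ### Gaussian asymptotics on horizontal lines -/

/-- `f` is continuous on the real line and asymptotic to `C exp (-κ (x + a) ^ 2)` at `+∞` and to
`C⁻¹ exp (κ (x + a) ^ 2)` at `-∞`; this is the behaviour of `x ↦ G (x + a)`. -/
structure GaussianLine (κ C a : ℂ) (f : ℝ → ℂ) : Prop where
  continuous : Continuous f
  tendsto_top : Tendsto (fun x : ℝ => f x * Complex.exp (κ * (x + a) ^ 2)) atTop (𝓝 C)
  tendsto_bot : Tendsto (fun x : ℝ => f x * Complex.exp (-κ * (x + a) ^ 2)) atBot (𝓝 C⁻¹)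

/-- The rate `π i / (2 ω₁ ω₂)` of the Gaussian asymptotics of the hyperbolic gamma function. -/
def gaussRate (ω₁ ω₂ : ℂ) : ℂ := Real.pi * Complex.I / (2 * (ω₁ * ω₂))

/-- The constant `exp (-π i (ω₁ ^ 2 + ω₂ ^ 2) / (24 ω₁ ω₂))` in the asymptotics of the hyperbolic
gamma function. -/
def gaussConst (ω₁ ω₂ : ℂ) : ℂ :=
  Complex.exp (Complex.I * Real.pi * kernelCoeff ω₁ ω₂ / (4 * (ω₁ * ω₂)))

lemma gaussConst_ne_zero (ω₁ ω₂ : ℂ) : gaussConst ω₁ ω₂ ≠ 0 := Complex.exp_ne_zero _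

lemma GaussianLine.inv {κ C a : ℂ} {f : ℝ → ℂ} (h : GaussianLine κ C a f) (hC : C ≠ 0)
    (hf : ∀ x, f x ≠ 0) : GaussianLine (-κ) C⁻¹ a (fun x => (f x)⁻¹) where
  continuous := h.continuous.inv₀ hf
  tendsto_top := by
    refine (h.tendsto_top.inv₀ hC).congr fun x => ?_
    rw [mul_inv, ← Complex.exp_neg, neg_mul]
  tendsto_bot := by
    refine (h.tendsto_bot.inv₀ (inv_ne_zero hC)).congr fun x => ?_
    rw [mul_inv, ← Complex.exp_neg]
    simp only [neg_mul]

lemma continuous_stripIntegral (h₁ : 0 < ω₁.re) (h₂ : 0 < ω₂.re) {y : ℝ}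
    (hy : |2 * y| < ω₁.re + ω₂.re) :
    Continuous fun x : ℝ => stripIntegral ω₁ ω₂ (x + y * Complex.I) := by
  simp_rw [stripIntegral_eq h₁ h₂ hy]
  have := continuous_fourierPart h₁ h₂ hy
  fun_prop

lemma tendsto_hypGammaStrip_atTop (h₁ : 0 < ω₁.re) (h₂ : 0 < ω₂.re) {y : ℝ}
    (hy : |2 * y| < ω₁.re + ω₂.re) :
    Tendsto (fun x : ℝ => hypGammaStrip ω₁ ω₂ (x + y * Complex.I)
      * Complex.exp (gaussRate ω₁ ω₂ * (x + y * Complex.I) ^ 2)) atTop (𝓝 (gaussConst ω₁ ω₂)) := by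
  have h10 : ω₁ ≠ 0 := by rintro rfl; simp at h₁
  have h20 : ω₂ ≠ 0 := by rintro rfl; simp at h₂
  have h := ((tendsto_fourierPart h₁ h₂ hy).const_mul Complex.I).const_add
    (Complex.I * Real.pi * kernelCoeff ω₁ ω₂ / (4 * (ω₁ * ω₂)))
  rw [mul_zero, add_zero] at h
  refine h.cexp.congr' ?_
  filter_upwards [eventually_ge_atTop 1] with x hx
  rw [hypGammaStrip_eq, ← Complex.exp_add, stripIntegral_eq h₁ h₂ hy, abs_of_nonneg (by linarith),
    abs_of_nonneg (by linarith), abs_of_nonneg (by linarith)]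
  congr 1
  simp only [gaussRate]
  push_cast
  field_simp
  linear_combination (-32 * Real.pi * (y : ℂ) ^ 2) * Complex.I_sq

lemma gaussianLine_hypGammaStrip (h₁ : 0 < ω₁.re) (h₂ : 0 < ω₂.re) {a : ℂ}
    (ha : |2 * a.im| < ω₁.re + ω₂.re) :
    GaussianLine (gaussRate ω₁ ω₂) (gaussConst ω₁ ω₂) a
      (fun x => hypGammaStrip ω₁ ω₂ (x + a)) where
  continuous := by
    have h := ((continuous_stripIntegral h₁ h₂ ha).comp
      (by fun_prop : Continuous fun x : ℝ => x + a.re))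
    simp_rw [hypGammaStrip_eq]
    refine Complex.continuous_exp.comp (continuous_const.mul (h.congr fun x => ?_))
    simp only [Function.comp]
    congr 1
    push_cast
    rw [add_assoc, Complex.re_add_im]
  tendsto_top := by
    refine ((tendsto_hypGammaStrip_atTop h₁ h₂ ha).comp
      (tendsto_atTop_add_const_right atTop a.re tendsto_id)).congr fun x => ?_
    simp only [Function.comp, id]
    push_cast
    rw [add_assoc (x : ℂ), Complex.re_add_im]
  tendsto_bot := by
    have ha' : |2 * (-a).im| < ω₁.re + ω₂.re := by simpa using ha
    have ht : Tendsto (fun x : ℝ => -x + (-a).re) atBot atTop :=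
      tendsto_atTop_add_const_right atBot _ tendsto_neg_atBot_atTop
    refine (((tendsto_hypGammaStrip_atTop h₁ h₂ ha').comp ht).inv₀
      (gaussConst_ne_zero _ _)).congr fun x => ?_
    have e : ((-x + (-a).re : ℝ) : ℂ) + ((-a).im : ℂ) * Complex.I = -(x + a) := by
      push_cast
      rw [add_assoc, Complex.re_add_im]; ring
    simp only [Function.comp]
    rw [e, hypGammaStrip_neg, mul_inv, inv_inv, ← Complex.exp_neg, neg_sq, neg_mul]

/-- The exponent `π (z + i ω) / ω₂` in `shiftFactor`. -/
def shiftArg (ω₁ ω₂ z : ℂ) : ℂ := Real.pi * ((z + Complex.I * om ω₁ ω₂) / ω₂)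

lemma gaussRate_shift (h₁ : ω₁ ≠ 0) (h₂ : ω₂ ≠ 0) (w : ℂ) :
    gaussRate ω₁ ω₂ * ((w + Complex.I * ω₁) ^ 2 - w ^ 2)
      = -shiftArg ω₁ ω₂ w + Real.pi / 2 * Complex.I := by
  simp only [gaussRate, shiftArg, om]
  field_simp
  linear_combination (2 * w * ω₁ + Complex.I * ω₁ ^ 2) * Complex.I_sq

lemma shiftFactor_mul_exp (h₁ : ω₁ ≠ 0) (h₂ : ω₂ ≠ 0) (w : ℂ) :
    shiftFactor ω₁ ω₂ w
        * Complex.exp (gaussRate ω₁ ω₂ * ((w + Complex.I * ω₁) ^ 2 - w ^ 2))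
      = 1 - Complex.exp (-2 * shiftArg ω₁ ω₂ w) := by
  rw [gaussRate_shift h₁ h₂, Complex.exp_add, Complex.exp_pi_div_two_mul_I, shiftFactor,
    ← shiftArg, Complex.sinh, show -2 * shiftArg ω₁ ω₂ w = -shiftArg ω₁ ω₂ w + -shiftArg ω₁ ω₂ w
      by ring, Complex.exp_add, Complex.exp_neg]
  have := Complex.exp_ne_zero (shiftArg ω₁ ω₂ w)
  field_simp
  linear_combination (1 - Complex.exp (shiftArg ω₁ ω₂ w) ^ 2) * Complex.I_sq

lemma shiftFactor_mul_exp_neg (h₁ : ω₁ ≠ 0) (h₂ : ω₂ ≠ 0) (w : ℂ) :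
    shiftFactor ω₁ ω₂ w
        * Complex.exp (-gaussRate ω₁ ω₂ * ((w + Complex.I * ω₁) ^ 2 - w ^ 2))
      = 1 - Complex.exp (2 * shiftArg ω₁ ω₂ w) := by
  rw [neg_mul, gaussRate_shift h₁ h₂, neg_add, neg_neg, Complex.exp_add,
    Complex.exp_neg (_ / _ * _),
    Complex.exp_pi_div_two_mul_I, shiftFactor,
    ← shiftArg, Complex.sinh, show 2 * shiftArg ω₁ ω₂ w = shiftArg ω₁ ω₂ w + shiftArg ω₁ ω₂ w
      by ring, Complex.exp_add, Complex.exp_neg, Complex.inv_I]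
  have := Complex.exp_ne_zero (shiftArg ω₁ ω₂ w)
  field_simp
  linear_combination (Complex.exp (shiftArg ω₁ ω₂ w) ^ 2 - 1) * Complex.I_sq

lemma inv_re_pos {a : ℂ} (ha : 0 < a.re) : 0 < (a⁻¹).re := by
  rw [Complex.inv_re]
  exact div_pos ha (Complex.normSq_pos.2 (by rintro rfl; simp at ha))

lemma shiftArg_re (b : ℂ) (x : ℝ) :
    (shiftArg ω₁ ω₂ (x + b)).re = Real.pi * (ω₂⁻¹).re * x + (shiftArg ω₁ ω₂ b).re := by
  have : shiftArg ω₁ ω₂ (x + b) = ((Real.pi * x : ℝ) : ℂ) * ω₂⁻¹ + shiftArg ω₁ ω₂ b := by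
    simp only [shiftArg]; push_cast; ring
  rw [this, Complex.add_re, Complex.re_ofReal_mul]
  ring

lemma tendsto_exp_zero {l : Filter ℝ} {f : ℝ → ℂ} (h : Tendsto (fun x => (f x).re) l atBot) :
    Tendsto (fun x => Complex.exp (f x)) l (𝓝 0) :=
  Complex.tendsto_exp_nhds_zero_iff.2 h

lemma tendsto_shiftFactor_atTop (h₁ : 0 < ω₁.re) (h₂ : 0 < ω₂.re) (b : ℂ) :
    Tendsto (fun x : ℝ => shiftFactor ω₁ ω₂ (x + b)
      * Complex.exp (gaussRate ω₁ ω₂ * ((x + b + Complex.I * ω₁) ^ 2 - (x + b) ^ 2)))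
      atTop (𝓝 1) := by
  have h10 : ω₁ ≠ 0 := by rintro rfl; simp at h₁
  have h20 : ω₂ ≠ 0 := by rintro rfl; simp at h₂
  have hp : 0 < Real.pi * (ω₂⁻¹).re := mul_pos Real.pi_pos (inv_re_pos h₂)
  simp_rw [shiftFactor_mul_exp h10 h20]
  have : Tendsto (fun x : ℝ => Complex.exp (-2 * shiftArg ω₁ ω₂ (x + b))) atTop (𝓝 0) := by
    refine tendsto_exp_zero ?_
    have h : Tendsto (fun x : ℝ => (-2 * (Real.pi * (ω₂⁻¹).re)) * x + -2 * (shiftArg ω₁ ω₂ b).re)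
        atTop atBot := tendsto_atBot_add_const_right _ _
          (tendsto_id.const_mul_atTop_of_neg (by linarith))
    refine h.congr fun x => ?_
    rw [show (-2 : ℂ) = ((-2 : ℝ) : ℂ) by norm_num, Complex.re_ofReal_mul, shiftArg_re]
    ring
  simpa using this.const_sub 1

lemma tendsto_shiftFactor_atBot (h₁ : 0 < ω₁.re) (h₂ : 0 < ω₂.re) (b : ℂ) :
    Tendsto (fun x : ℝ => shiftFactor ω₁ ω₂ (x + b)
      * Complex.exp (-gaussRate ω₁ ω₂ * ((x + b + Complex.I * ω₁) ^ 2 - (x + b) ^ 2)))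
      atBot (𝓝 1) := by
  have h10 : ω₁ ≠ 0 := by rintro rfl; simp at h₁
  have h20 : ω₂ ≠ 0 := by rintro rfl; simp at h₂
  have hp : 0 < Real.pi * (ω₂⁻¹).re := mul_pos Real.pi_pos (inv_re_pos h₂)
  simp_rw [shiftFactor_mul_exp_neg h10 h20]
  have : Tendsto (fun x : ℝ => Complex.exp (2 * shiftArg ω₁ ω₂ (x + b))) atBot (𝓝 0) := by
    refine tendsto_exp_zero ?_
    have h : Tendsto (fun x : ℝ => (2 * (Real.pi * (ω₂⁻¹).re)) * x + 2 * (shiftArg ω₁ ω₂ b).re)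
        atBot atBot := tendsto_atBot_add_const_right _ _
          (tendsto_id.const_mul_atBot (by linarith))
    refine h.congr fun x => ?_
    rw [show (2 : ℂ) = ((2 : ℝ) : ℂ) by norm_num, Complex.re_ofReal_mul, shiftArg_re]
    ring
  simpa using this.const_sub 1

lemma continuous_shiftFactor : Continuous (shiftFactor ω₁ ω₂) := by
  unfold shiftFactor
  fun_prop

lemma GaussianLine.mul_shiftFactor (h₁ : 0 < ω₁.re) (h₂ : 0 < ω₂.re) {C a b : ℂ} {f : ℝ → ℂ}
    (h : GaussianLine (gaussRate ω₁ ω₂) C a f) (hb : b = a + Complex.I * ω₁) :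
    GaussianLine (gaussRate ω₁ ω₂) C b (fun x => f x * shiftFactor ω₁ ω₂ (x + a)) where
  continuous := h.continuous.mul (continuous_shiftFactor.comp (by fun_prop))
  tendsto_top := by
    have := h.tendsto_top.mul (tendsto_shiftFactor_atTop h₁ h₂ a)
    rw [mul_one] at this
    refine this.congr fun x => ?_
    rw [mul_mul_mul_comm, ← Complex.exp_add, hb]
    ring_nf
  tendsto_bot := by
    have := h.tendsto_bot.mul (tendsto_shiftFactor_atBot h₁ h₂ a)
    rw [mul_one] at this
    refine this.congr fun x => ?_
    rw [mul_mul_mul_comm, ← Complex.exp_add, hb]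
    ring_nf

lemma GaussianLine.neg_mul_shiftFactor (h₁ : 0 < ω₁.re) (h₂ : 0 < ω₂.re) {C a b : ℂ} {f : ℝ → ℂ}
    (h : GaussianLine (-gaussRate ω₁ ω₂) C a f) (hb : a = b + Complex.I * ω₁) :
    GaussianLine (-gaussRate ω₁ ω₂) C b (fun x => f x * shiftFactor ω₁ ω₂ (x + b)) where
  continuous := h.continuous.mul (continuous_shiftFactor.comp (by fun_prop))
  tendsto_top := by
    have := h.tendsto_top.mul (tendsto_shiftFactor_atTop h₁ h₂ b)
    rw [mul_one] at this
    refine this.congr fun x => ?_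
    rw [mul_mul_mul_comm, ← Complex.exp_add, hb]
    ring_nf
  tendsto_bot := by
    have := h.tendsto_bot.mul (tendsto_shiftFactor_atBot h₁ h₂ b)
    rw [mul_one] at this
    refine this.congr fun x => ?_
    rw [mul_mul_mul_comm, ← Complex.exp_add, hb]
    ring_nf

lemma gaussianLine_strip_mul_prod (h₁ : 0 < ω₁.re) (h₂ : 0 < ω₂.re) {b : ℂ}
    (hb : |2 * b.im| < ω₁.re + ω₂.re) (N : ℕ) :
    GaussianLine (gaussRate ω₁ ω₂) (gaussConst ω₁ ω₂) (b + N * (Complex.I * ω₁))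
      (fun x => hypGammaStrip ω₁ ω₂ (x + b)
        * ∏ k ∈ Finset.range N, shiftFactor ω₁ ω₂ (x + b + k * (Complex.I * ω₁))) := by
  induction N with
  | zero => simpa using gaussianLine_hypGammaStrip h₁ h₂ hb
  | succ N ih =>
    have := ih.mul_shiftFactor h₁ h₂ (b := b + (N + 1 : ℕ) * (Complex.I * ω₁))
      (by push_cast; ring)
    simp_rw [Finset.prod_range_succ]
    convert this using 2 with x
    rw [← mul_assoc, add_assoc (x : ℂ) b]

lemma gaussianLine_inv_strip_mul_prod (h₁ : 0 < ω₁.re) (h₂ : 0 < ω₂.re) {b : ℂ}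
    (hb : |2 * b.im| < ω₁.re + ω₂.re) (N : ℕ) :
    GaussianLine (-gaussRate ω₁ ω₂) (gaussConst ω₁ ω₂)⁻¹ (b - N * (Complex.I * ω₁))
      (fun x => (hypGammaStrip ω₁ ω₂ (x + b))⁻¹
        * ∏ k ∈ Finset.range N, shiftFactor ω₁ ω₂ (x + b - (k + 1) * (Complex.I * ω₁))) := by
  induction N with
  | zero =>
    simpa using (gaussianLine_hypGammaStrip h₁ h₂ hb).inv (gaussConst_ne_zero _ _)
      fun x => hypGammaStrip_ne_zero _ _ _
  | succ N ih =>
    have := ih.neg_mul_shiftFactor h₁ h₂ (b := b - (N + 1 : ℕ) * (Complex.I * ω₁))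
      (by push_cast; ring)
    simp_rw [Finset.prod_range_succ]
    convert this using 2 with x
    rw [← mul_assoc]
    push_cast
    rw [add_sub_assoc]

/-! ### The hyperbolic gamma function on horizontal lines -/

lemma om_re : (om ω₁ ω₂).re = (ω₁.re + ω₂.re) / 2 := by
  rw [om, show ((2 : ℂ)) = ((2 : ℝ) : ℂ) by norm_num, Complex.div_ofReal_re, Complex.add_re]

lemma hypGamma_eq_strip {z : ℂ} (hz : |z.im| < (om ω₁ ω₂).re) :
    hypGamma ω₁ ω₂ z = hypGammaStrip ω₁ ω₂ z := by
  rw [hypGamma, if_pos hz]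

lemma hypGamma_eq_mul_prod {z : ℂ} (hz : ¬ |z.im| < (om ω₁ ω₂).re) {N : ℕ}
    (hN : round (z.im / ω₁.re) = N) :
    hypGamma ω₁ ω₂ z = hypGammaStrip ω₁ ω₂ (z - N * (Complex.I * ω₁))
      * ∏ k ∈ Finset.range N,
        shiftFactor ω₁ ω₂ (z - N * (Complex.I * ω₁) + k * (Complex.I * ω₁)) := by
  rw [hypGamma, if_neg hz]
  simp [hN]

lemma hypGamma_eq_div_prod {z : ℂ} (hz : ¬ |z.im| < (om ω₁ ω₂).re) {N : ℕ}
    (hN : round (z.im / ω₁.re) = -N) :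
    hypGamma ω₁ ω₂ z = hypGammaStrip ω₁ ω₂ (z + N * (Complex.I * ω₁))
      / ∏ k ∈ Finset.range N,
        shiftFactor ω₁ ω₂ (z + N * (Complex.I * ω₁) - (k + 1) * (Complex.I * ω₁)) := by
  rw [hypGamma, if_neg hz]
  simp [hN]

lemma exists_round_eq_natCast {s : ℝ} (hs : 0 ≤ s) : ∃ N : ℕ, round s = N := by
  refine Int.eq_ofNat_of_zero_le ?_
  rw [round_eq]
  exact Int.floor_nonneg.2 (by linarith)

lemma exists_round_eq_neg_natCast {s : ℝ} (hs : s ≤ 0) : ∃ N : ℕ, round s = -N := by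
  have : round s ≤ 0 := by
    rw [round_eq, ← Int.lt_add_one_iff, Int.floor_lt]
    push_cast
    linarith
  obtain ⟨N, hN⟩ := Int.eq_ofNat_of_zero_le (neg_nonneg.2 this)
  exact ⟨N, by omega⟩

/-- The reduced point has imaginary part at most `Re ω₁ / 2` in absolute value. -/
lemma abs_two_mul_sub_lt (h₁ : 0 < ω₁.re) (h₂ : 0 < ω₂.re) {y : ℝ} {n : ℤ}
    (hn : round (y / ω₁.re) = n) : |2 * (y - n * ω₁.re)| < ω₁.re + ω₂.re := by
  have h := abs_sub_round (y / ω₁.re)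
  rw [hn] at h
  have e : 2 * (y - n * ω₁.re) = 2 * ω₁.re * (y / ω₁.re - n) := by field_simp
  rw [e, abs_mul, abs_of_pos (by linarith)]
  nlinarith

/-- On a line above the poles, `hypGamma` is the strip function times an empty or upward product of
shift factors, the number of factors being the same at all points of the line. -/
lemma gaussianLine_hypGamma (h₁ : 0 < ω₁.re) (h₂ : 0 < ω₂.re) {a : ℂ}
    (ha : -(om ω₁ ω₂).re < a.im) :
    GaussianLine (gaussRate ω₁ ω₂) (gaussConst ω₁ ω₂) a (fun x => hypGamma ω₁ ω₂ (x + a)) := by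
  have him : ∀ x : ℝ, ((x : ℂ) + a).im = a.im := fun x => by simp
  by_cases h : |a.im| < (om ω₁ ω₂).re
  · have e : (fun x : ℝ => hypGamma ω₁ ω₂ (x + a)) = fun x : ℝ => hypGammaStrip ω₁ ω₂ (x + a) :=
      funext fun x => hypGamma_eq_strip (by rwa [him])
    rw [e]
    refine gaussianLine_hypGammaStrip h₁ h₂ ?_
    rw [om_re] at h
    rw [abs_mul, abs_two]; linarith
  · have ha0 : 0 ≤ a.im := by
      by_contra h0
      exact h (abs_lt.2 ⟨ha, by rw [om_re]; linarith⟩)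
    obtain ⟨N, hN⟩ := exists_round_eq_natCast (div_nonneg ha0 h₁.le)
    have e : (fun x : ℝ => hypGamma ω₁ ω₂ (x + a)) = fun x : ℝ =>
        hypGammaStrip ω₁ ω₂ (x + (a - N * (Complex.I * ω₁)))
      * ∏ k ∈ Finset.range N,
        shiftFactor ω₁ ω₂ (x + (a - N * (Complex.I * ω₁)) + k * (Complex.I * ω₁)) := by
      funext x
      rw [hypGamma_eq_mul_prod (by rwa [him]) (by rwa [him]), add_sub_assoc]
    rw [e]
    have hb : |2 * (a - N * (Complex.I * ω₁)).im| < ω₁.re + ω₂.re := by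
      have := abs_two_mul_sub_lt h₁ h₂ (n := N) hN
      simpa using this
    simpa using gaussianLine_strip_mul_prod h₁ h₂ hb N

/-- On a line below the zeros, a possible pole of `hypGamma` is a zero of the downward product,
where `hypGamma` and its inverse both have the value `0`. -/
lemma gaussianLine_inv_hypGamma (h₁ : 0 < ω₁.re) (h₂ : 0 < ω₂.re) {a : ℂ}
    (ha : a.im < (om ω₁ ω₂).re) :
    GaussianLine (-gaussRate ω₁ ω₂) (gaussConst ω₁ ω₂)⁻¹ a
      (fun x => (hypGamma ω₁ ω₂ (x + a))⁻¹) := by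
  have him : ∀ x : ℝ, ((x : ℂ) + a).im = a.im := fun x => by simp
  by_cases h : |a.im| < (om ω₁ ω₂).re
  · have e : (fun x : ℝ => (hypGamma ω₁ ω₂ (x + a))⁻¹)
        = fun x : ℝ => (hypGammaStrip ω₁ ω₂ (x + a))⁻¹ :=
      funext fun x => by rw [hypGamma_eq_strip (by rwa [him])]
    rw [e]
    refine (gaussianLine_hypGammaStrip h₁ h₂ ?_).inv (gaussConst_ne_zero _ _)
      fun x => hypGammaStrip_ne_zero _ _ _
    rw [om_re] at h
    rw [abs_mul, abs_two]; linarith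
  · have ha0 : a.im ≤ 0 := by
      by_contra h0
      exact h (abs_lt.2 ⟨by rw [om_re]; linarith, ha⟩)
    obtain ⟨N, hN⟩ := exists_round_eq_neg_natCast (div_nonpos_of_nonpos_of_nonneg ha0 h₁.le)
    have e : (fun x : ℝ => (hypGamma ω₁ ω₂ (x + a))⁻¹) = fun x : ℝ =>
        (hypGammaStrip ω₁ ω₂ (x + (a + N * (Complex.I * ω₁))))⁻¹
      * ∏ k ∈ Finset.range N,
        shiftFactor ω₁ ω₂ (x + (a + N * (Complex.I * ω₁)) - (k + 1) * (Complex.I * ω₁)) := by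
      funext x
      rw [hypGamma_eq_div_prod (by rwa [him]) (by rwa [him]), inv_div, div_eq_inv_mul,
        add_assoc (x : ℂ) a]
    rw [e]
    have hb : |2 * (a + N * (Complex.I * ω₁)).im| < ω₁.re + ω₂.re := by
      have := abs_two_mul_sub_lt h₁ h₂ (n := -N) hN
      simpa using this
    simpa using gaussianLine_inv_strip_mul_prod h₁ h₂ hb N

/-! ### Bounds on horizontal lines -/

lemma exists_bound_of_tendsto {h : ℝ → ℂ} (hc : Continuous h) {c : ℂ}
    (ht : Tendsto h atTop (𝓝 c)) : ∃ M : ℝ, ∀ x, 0 ≤ x → ‖h x‖ ≤ M := by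
  obtain ⟨R, hR⟩ := eventually_atTop.1 (ht.norm.eventually (ge_mem_nhds (lt_add_one ‖c‖)))
  obtain ⟨B, hB⟩ := (isCompact_Icc (a := (0 : ℝ)) (b := R)).exists_bound_of_continuousOn
    hc.continuousOn
  refine ⟨max B (‖c‖ + 1), fun x hx => ?_⟩
  rcases le_total x R with h | h
  · exact (hB x ⟨hx, h⟩).trans (le_max_left _ _)
  · exact (hR x h).trans (le_max_right _ _)

lemma norm_exp_mul_sq (κ a : ℂ) (x : ℝ) :
    ‖Complex.exp (κ * (x + a) ^ 2)‖
      = Real.exp (κ.re * x ^ 2 + 2 * (κ * a).re * x) * Real.exp (κ * a ^ 2).re := by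
  rw [Complex.norm_exp, ← Real.exp_add]
  congr 1
  rw [show κ * (x + a) ^ 2 = ((x ^ 2 : ℝ) : ℂ) * κ + ((2 * x : ℝ) : ℂ) * (κ * a) + κ * a ^ 2 by
    push_cast; ring, Complex.add_re, Complex.add_re, Complex.re_ofReal_mul, Complex.re_ofReal_mul]
  ring

/-- The constant term `κ a ^ 2` of the exponent is absorbed in `M`; `x |x|` and `|x|` cover both
ends of the line at once. -/
lemma GaussianLine.exists_bound {κ C a : ℂ} {f : ℝ → ℂ} (h : GaussianLine κ C a f) :
    ∃ M : ℝ, 0 ≤ M ∧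
      ∀ x : ℝ, ‖f x‖ ≤ M * Real.exp (-(κ.re * (x * |x|) + 2 * (κ * a).re * |x|)) := by
  have hc1 : Continuous fun x : ℝ => f x * Complex.exp (κ * (x + a) ^ 2) :=
    h.continuous.mul (by fun_prop)
  have hc2 : Continuous fun x : ℝ => f (-x) * Complex.exp (-κ * ((-x : ℝ) + a) ^ 2) :=
    (h.continuous.comp continuous_neg).mul (by fun_prop)
  obtain ⟨M₁, hM₁⟩ := exists_bound_of_tendsto hc1 h.tendsto_top
  obtain ⟨M₂, hM₂⟩ := exists_bound_of_tendsto hc2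
    (h.tendsto_bot.comp tendsto_neg_atTop_atBot)
  set E₁ := Real.exp (κ * a ^ 2).re
  set E₂ := Real.exp (-κ * a ^ 2).re
  have hM₁0 : 0 ≤ M₁ := (norm_nonneg _).trans (hM₁ 0 le_rfl)
  have hM₂0 : 0 ≤ M₂ := (norm_nonneg _).trans (hM₂ 0 le_rfl)
  have hE₁ : 0 < E₁ := Real.exp_pos _
  have hE₂ : 0 < E₂ := Real.exp_pos _
  refine ⟨M₁ / E₁ + M₂ / E₂, by positivity, fun x => ?_⟩
  rcases le_total 0 x with hx | hx
  · have h1 := hM₁ x hx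
    rw [norm_mul, norm_exp_mul_sq] at h1
    rw [abs_of_nonneg hx, Real.exp_neg, ← sq]
    have h2 : ‖f x‖ ≤ M₁ / E₁ * (Real.exp (κ.re * x ^ 2 + 2 * (κ * a).re * x))⁻¹ := by
      rw [← div_eq_mul_inv, div_div, le_div_iff₀ (by positivity), mul_comm E₁]
      exact h1
    refine h2.trans ?_
    gcongr
    exact le_add_of_nonneg_right (by positivity)
  · have h1 := hM₂ (-x) (by linarith)
    rw [neg_neg, norm_mul, norm_exp_mul_sq] at h1
    have e : Real.exp (-(κ.re * (x * |x|) + 2 * (κ * a).re * |x|))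
        = (Real.exp ((-κ).re * x ^ 2 + 2 * (-κ * a).re * x))⁻¹ := by
      rw [← Real.exp_neg, abs_of_nonpos hx, neg_mul, Complex.neg_re, Complex.neg_re]
      ring_nf
    rw [e]
    have h2 : ‖f x‖ ≤ M₂ / E₂ * (Real.exp ((-κ).re * x ^ 2 + 2 * (-κ * a).re * x))⁻¹ := by
      rw [← div_eq_mul_inv, div_div, le_div_iff₀ (by positivity), mul_comm E₂]
      exact h1
    refine h2.trans ?_
    gcongr
    exact le_add_of_nonneg_left (by positivity)

/-! ### The sine transform of `1 / sinh` -/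

lemma mem_integerComplement_of_im_ne_zero {z : ℂ} (hz : z.im ≠ 0) :
    z ∈ Complex.integerComplement := by
  rintro ⟨n, rfl⟩
  simp at hz

/-- The partial fraction expansion of the tangent, from the even and odd terms of that of the
cotangent. -/
lemma hasSum_tan {z : ℂ} (hz : z ∈ Complex.integerComplement)
    (hz2 : z / 2 ∈ Complex.integerComplement) :
    HasSum (fun k : ℕ => 1 / (z - (2 * k + 1)) + 1 / (z + (2 * k + 1)))
      (-(Real.pi / 2) * (Complex.sin (Real.pi * (z / 2)) / Complex.cos (Real.pi * (z / 2)))) := by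
  set f : ℕ → ℂ := fun n => 1 / (z - (n + 1)) + 1 / (z + (n + 1)) with hf
  have hs : Summable f := summable_cotTerm hz
  have hs1 : Summable fun k : ℕ => f (2 * k) :=
    hs.comp_injective (mul_right_injective₀ two_ne_zero)
  have hs2 : Summable fun k : ℕ => f (2 * k + 1) :=
    hs.comp_injective ((add_left_injective 1).comp (mul_right_injective₀ two_ne_zero))
  have h1 := tsum_even_add_odd hs1 hs2
  have h2 : ∑' k, f (2 * k + 1) =
      1 / 2 * (Real.pi * Complex.cot (Real.pi * (z / 2)) - 1 / (z / 2)) := by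
    rw [cot_series_rep' hz2, ← tsum_mul_left]
    congr 1; ext k
    simp only [hf]
    rw [mul_add]
    congr 1
    · rw [show z - (((2 * k + 1 : ℕ) : ℂ) + 1) = 2 * (z / 2 - (k + 1)) by push_cast; ring]
      rw [one_div, one_div, mul_inv, one_div]
    · rw [show z + (((2 * k + 1 : ℕ) : ℂ) + 1) = 2 * (z / 2 + (k + 1)) by push_cast; ring]
      rw [one_div, one_div, mul_inv, one_div]
  rw [h2, ← cot_series_rep' hz] at h1
  have h3 : HasSum (fun k : ℕ => f (2 * k)) (∑' k, f (2 * k)) := hs1.hasSum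
  have hsin := sin_pi_mul_ne_zero hz
  have hsin2 := sin_pi_mul_ne_zero hz2
  have e : Real.pi * z = 2 * (Real.pi * (z / 2)) := by ring
  have hcos2 : Complex.cos (Real.pi * (z / 2)) ≠ 0 := by
    intro h
    rw [e, Complex.sin_two_mul, h, mul_zero] at hsin
    exact hsin rfl
  have hz0 : z ≠ 0 := by
    rintro rfl
    simp at hsin
  have h4 : ∑' k, f (2 * k) = -(Real.pi / 2)
      * (Complex.sin (Real.pi * (z / 2)) / Complex.cos (Real.pi * (z / 2))) := by
    rw [← sub_eq_iff_eq_add.2 h1.symm]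
    rw [Complex.cot, Complex.cot, e, Complex.sin_two_mul, Complex.cos_two_mul']
    generalize Complex.sin (Real.pi * (z / 2)) = S at *
    generalize Complex.cos (Real.pi * (z / 2)) = T at *
    field_simp
    ring
  rw [h4] at h3
  refine h3.congr_fun fun k => ?_
  simp only [hf]
  push_cast
  rfl

lemma hasSum_inv_sinh {a : ℂ} (ha : 0 < a.re) {t : ℝ} (ht : 0 < t) :
    HasSum (fun k : ℕ => 2 * Complex.exp (-((2 * k + 1) * a) * t)) (Complex.sinh (a * t))⁻¹ := by
  have hq : ‖Complex.exp (-2 * a * t)‖ < 1 := by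
    rw [Complex.norm_exp, Real.exp_lt_one_iff]
    have : (-2 * a * t : ℂ).re = -2 * (a.re * t) := by
      rw [show (-2 * a * t : ℂ) = ((-2 * t : ℝ) : ℂ) * a by push_cast; ring,
        Complex.re_ofReal_mul]
      ring
    rw [this]
    nlinarith [mul_pos ha ht]
  have h := (hasSum_geometric_of_norm_lt_one hq).mul_left (2 * Complex.exp (-a * t))
  have hs := sinh_mul_ne_zero ha ht
  have e : 2 * Complex.exp (-a * t) * (1 - Complex.exp (-2 * a * t))⁻¹
      = (Complex.sinh (a * t))⁻¹ := by
    have h1 : Complex.sinh (a * t) =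
        (1 - Complex.exp (-2 * a * t)) / (2 * Complex.exp (-a * t)) := by
      rw [Complex.sinh, show -2 * a * (t : ℂ) = -(a * t) + -(a * t) by ring, Complex.exp_add,
        neg_mul, Complex.exp_neg]
      have := Complex.exp_ne_zero (a * t)
      field_simp
    rw [h1, inv_div, div_eq_mul_inv]
  rw [e] at h
  refine h.congr_fun fun k => ?_
  rw [← Complex.exp_nat_mul, mul_assoc, ← Complex.exp_add]
  ring_nf

/-- The sine transform `∫ 2 sin (2 x t) / sinh (a t) dt = (π / a) tanh (π x / a)`, by expanding
`1 / sinh` in exponentials. -/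
lemma integral_sin_div_sinh {a : ℂ} (ha : 0 < a.re) (x : ℝ) :
    (∫ t in Set.Ioi (0 : ℝ), 2 * Complex.sin (2 * x * t) / Complex.sinh (a * t))
      * Complex.cosh (Real.pi * x / a) = Real.pi / a * Complex.sinh (Real.pi * x / a) := by
  rcases eq_or_ne x 0 with rfl | hx
  · simp
  have ha0 : a ≠ 0 := by rintro rfl; simp at ha
  set F : ℕ → ℝ → ℂ := fun k t =>
    4 * (Complex.sin ((2 * x : ℝ) * t) * Complex.exp (-((2 * k + 1) * a) * t)) with hF
  have hre : ∀ k : ℕ, ((2 * k + 1) * a : ℂ).re = (2 * k + 1) * a.re := by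
    intro k
    rw [show ((2 * k + 1) * a : ℂ) = ((2 * k + 1 : ℝ) : ℂ) * a by push_cast; ring,
      Complex.re_ofReal_mul]
  have hpos : ∀ k : ℕ, 0 < ((2 * k + 1) * a : ℂ).re := by
    intro k; rw [hre]; positivity
  have hint : ∀ k, IntegrableOn (F k) (Set.Ioi 0) := fun k =>
    (integrableOn_sin_mul_exp (hpos k) (2 * x)).const_mul 4
  have hnorm : ∀ k, ∫ t in Set.Ioi (0 : ℝ), ‖F k t‖
      ≤ 8 * |x| / a.re ^ 2 * (1 / ((k : ℝ) + 1) ^ 2) := by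
    intro k
    have hk : 0 < (2 * (k : ℝ) + 1) * a.re := by rw [← hre]; exact hpos k
    obtain ⟨i1, i2⟩ := integral_mul_exp_neg_mul hk 1
    calc ∫ t in Set.Ioi (0 : ℝ), ‖F k t‖
        ≤ ∫ t in Set.Ioi (0 : ℝ), 8 * |x| * (t ^ 1 * Real.exp (-((2 * k + 1) * a.re) * t)) := by
          refine setIntegral_mono_on (hint k).norm (i1.const_mul _) measurableSet_Ioi
            fun t ht => ?_
          have ht : 0 < t := ht
          simp only [hF]
          rw [norm_mul, norm_mul, ← Complex.ofReal_mul, ← Complex.ofReal_sin, Complex.norm_real,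
            Complex.norm_exp, Complex.norm_ofNat, Complex.re_mul_ofReal, Complex.neg_re, hre,
            pow_one, Real.norm_eq_abs]
          have h1 : |Real.sin (2 * x * t)| ≤ 2 * |x| * t := by
            refine Real.abs_sin_le_abs.trans_eq ?_
            rw [abs_mul, abs_mul, abs_two, abs_of_pos ht]
          have := mul_le_mul_of_nonneg_right h1
            (Real.exp_pos (-((2 * (k : ℝ) + 1) * a.re) * t)).le
          linarith
      _ = 8 * |x| * (1 / ((2 * k + 1) * a.re) ^ 2) := by
          rw [integral_const_mul, i2]; simp
      _ ≤ 8 * |x| / a.re ^ 2 * (1 / ((k : ℝ) + 1) ^ 2) := by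
          rw [mul_pow, show 8 * |x| * (1 / ((2 * (k : ℝ) + 1) ^ 2 * a.re ^ 2))
            = 8 * |x| / a.re ^ 2 * (1 / (2 * (k : ℝ) + 1) ^ 2) by field_simp]
          have : (0 : ℝ) ≤ k := k.cast_nonneg
          gcongr
          linarith
  have hsum : Summable fun k => ∫ t in Set.Ioi (0 : ℝ), ‖F k t‖ := by
    refine Summable.of_nonneg_of_le (fun k => integral_nonneg fun t => norm_nonneg _) hnorm ?_
    refine Summable.mul_left _ ?_
    exact_mod_cast (summable_nat_add_iff 1).2 (Real.summable_one_div_nat_pow.2 one_lt_two)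
  have h := hasSum_integral_of_summable_integral_norm hint hsum
  have e1 : ∫ t in Set.Ioi (0 : ℝ), ∑' k, F k t
      = ∫ t in Set.Ioi (0 : ℝ), 2 * Complex.sin (2 * x * t) / Complex.sinh (a * t) := by
    refine setIntegral_congr_fun measurableSet_Ioi fun t ht => ?_
    have := ((hasSum_inv_sinh ha ht).mul_left (2 * Complex.sin (2 * x * t))).tsum_eq
    rw [div_eq_mul_inv, ← this]
    congr 1; ext k
    simp only [hF]
    push_cast
    ring
  rw [e1] at h
  -- The Laplace transforms `8 x / ((2 k + 1) ^ 2 a ^ 2 + 4 x ^ 2)` are terms of `hasSum_tan`.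
  set z : ℂ := 2 * x / a * Complex.I with hz
  have hzim : z.im ≠ 0 := by
    have : z.im = 2 * x * (a⁻¹).re := by
      rw [hz, Complex.mul_I_im, div_eq_mul_inv,
        show (2 * (x : ℂ)) = ((2 * x : ℝ) : ℂ) by push_cast; ring, Complex.re_ofReal_mul]
    rw [this]
    exact mul_ne_zero (mul_ne_zero two_ne_zero hx) (inv_re_pos ha).ne'
  have hzc := mem_integerComplement_of_im_ne_zero hzim
  have hzc2 : z / 2 ∈ Complex.integerComplement := by
    refine mem_integerComplement_of_im_ne_zero ?_
    rw [show z / 2 = ((1 / 2 : ℝ) : ℂ) * z by push_cast; ring, Complex.im_ofReal_mul]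
    exact mul_ne_zero (by norm_num) hzim
  have h2 := (hasSum_tan hzc hzc2).mul_left (2 * Complex.I / a)
  have e2 : ∀ k : ℕ, ∫ t in Set.Ioi (0 : ℝ), F k t
      = 2 * Complex.I / a * (1 / (z - (2 * k + 1)) + 1 / (z + (2 * k + 1))) := by
    intro k
    simp only [hF]
    rw [integral_const_mul, integral_sin_mul_exp (hpos k)]
    have hn1 : z - (2 * k + 1) ≠ 0 := by
      intro h0
      apply hzim
      rw [sub_eq_zero.1 h0]
      simp
    have hn2 : z + (2 * k + 1) ≠ 0 := by
      intro h0
      apply hzim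
      rw [eq_neg_of_add_eq_zero_left h0]
      simp
    have hn3 := sq_add_sq_ne_zero (hpos k) (2 * x)
    have hp : ((2 * k + 1) * a) ^ 2 + ((2 * x : ℝ) : ℂ) ^ 2
        = -a ^ 2 * ((z - (2 * k + 1)) * (z + (2 * k + 1))) := by
      rw [hz]
      push_cast
      field_simp
      linear_combination (4 * (x : ℂ) ^ 2) * Complex.I_sq
    rw [hp]
    have hzx : ((2 * x : ℝ) : ℂ) = -z * a * Complex.I := by
      rw [hz]
      push_cast
      field_simp
      linear_combination (x : ℂ) * Complex.I_sq
    rw [hzx]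
    field_simp
    ring
  simp_rw [e2] at h
  have h5 := h.unique h2
  have hs : Real.pi * (z / 2) = Real.pi * x / a * Complex.I := by rw [hz]; ring
  have hcos : Complex.cosh (Real.pi * x / a) ≠ 0 := by
    intro h0
    have h6 := sin_pi_mul_ne_zero hzc
    rw [show Real.pi * z = 2 * (Real.pi * (z / 2)) by ring, Complex.sin_two_mul, hs,
      Complex.cos_mul_I, h0, mul_zero] at h6
    exact h6 rfl
  rw [h5, hs, Complex.sin_mul_I, Complex.cos_mul_I]
  field_simp
  linear_combination (-Complex.sinh (Real.pi * x / a)) * Complex.I_sq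

/-! ### The difference equation on the line `Im z = -Re ω₁ / 2` and the reflection equation -/

/-- `∫ (1 / (a t) - cos (2 x t) / sinh (a t)) dt / t`, which equals `log (2 cosh (π x / a))`. -/
def logCoshIntegral (a : ℂ) (x : ℝ) : ℂ :=
  ∫ t in Set.Ioi (0 : ℝ), (1 / (a * t) - Complex.cos (2 * x * t) / Complex.sinh (a * t)) / t

lemma integrableOn_stripIntegrand (h₁ : 0 < ω₁.re) (h₂ : 0 < ω₂.re) {z : ℂ}
    (hz : |2 * z.im| < ω₁.re + ω₂.re) :
    IntegrableOn (fun t : ℝ =>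
      (Complex.sin (2 * z * t) / (2 * Complex.sinh (ω₁ * t) * Complex.sinh (ω₂ * t))
        - z / (ω₁ * ω₂ * t)) / t) (Set.Ioi 0) := by
  have a1' := Integrable.const_mul (Integrable.ofReal (𝕜 := ℂ)
    (integral_mul_sub_sin_mul_div_cube (2 * z.re)).1) (-(1 / (ω₁ * ω₂)) / 2)
  have b1' := Integrable.const_mul (Integrable.ofReal (𝕜 := ℂ)
    (integral_one_sub_cos_mul_div_sq (2 * z.re)).1) (-(Complex.I * z.im / (ω₁ * ω₂)))
  have c1' := Integrable.const_mul (Integrable.ofReal (𝕜 := ℂ)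
    (integral_sin_mul_sin_div_sq (2 * z.re)).1)
    (1 / (ω₁ * ω₂) * (2 * z.im ^ 2 + kernelCoeff ω₁ ω₂) / 2)
  have d1 := integrableOn_bounded_mul (f := fun t => Real.sin (2 * z.re * t)) (by fun_prop)
    (fun t => Real.abs_sin_le_one _) (integrableOn_sinRemainder h₁ h₂ hz)
  have e1 := integrableOn_bounded_mul (f := fun t => Real.cos (2 * z.re * t)) (by fun_prop)
    (fun t => Real.abs_cos_le_one _) (integrableOn_cosRemainder h₁ h₂ hz)
  have e1' := Integrable.const_mul e1 Complex.I
  refine IntegrableOn.congr_fun ((((a1'.add b1').add c1').add d1).add e1') (fun t ht => ?_)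
    measurableSet_Ioi
  have := stripIntegrand_eq ω₁ ω₂ z.re z.im ht
  rw [Complex.re_add_im] at this
  rw [this]
  rfl

lemma stripIntegrand_shift (h₁ : 0 < ω₁.re) (h₂ : 0 < ω₂.re) (v : ℂ) {t : ℝ} (ht : 0 < t) :
    (1 / (ω₂ * t) - Complex.cos (2 * v * t) / Complex.sinh (ω₂ * t)) / t
    = Complex.I * ((Complex.sin (2 * (v + Complex.I * ω₁ / 2) * t)
        / (2 * Complex.sinh (ω₁ * t) * Complex.sinh (ω₂ * t))
        - (v + Complex.I * ω₁ / 2) / (ω₁ * ω₂ * t)) / t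
      - (Complex.sin (2 * (v - Complex.I * ω₁ / 2) * t)
        / (2 * Complex.sinh (ω₁ * t) * Complex.sinh (ω₂ * t))
        - (v - Complex.I * ω₁ / 2) / (ω₁ * ω₂ * t)) / t) := by
  have h10 : ω₁ ≠ 0 := by rintro rfl; simp at h₁
  have h20 : ω₂ ≠ 0 := by rintro rfl; simp at h₂
  have s1 := sinh_mul_ne_zero h₁ ht
  have s2 := sinh_mul_ne_zero h₂ ht
  have ht0 : (t : ℂ) ≠ 0 := by exact_mod_cast ht.ne'
  have e1 : 2 * (v + Complex.I * ω₁ / 2) * t = 2 * v * t + ω₁ * t * Complex.I := by ring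
  have e2 : 2 * (v - Complex.I * ω₁ / 2) * t = 2 * v * t - ω₁ * t * Complex.I := by ring
  rw [e1, e2, Complex.sin_add, Complex.sin_sub, Complex.sin_mul_I]
  generalize Complex.sinh (ω₁ * t) = S₁ at *
  generalize Complex.sinh (ω₂ * t) = S₂ at *
  generalize Complex.cos (2 * v * t) = T
  field_simp
  linear_combination (2 * ω₁ * S₁ * (S₂ - ω₂ * t * T)) * Complex.I_sq

lemma abs_two_mul_im_half (h₁ : 0 < ω₁.re) (h₂ : 0 < ω₂.re) (x : ℝ) :
    |2 * ((x : ℂ) + Complex.I * ω₁ / 2).im| < ω₁.re + ω₂.re ∧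
    |2 * ((x : ℂ) - Complex.I * ω₁ / 2).im| < ω₁.re + ω₂.re := by
  have e : (Complex.I * ω₁ / 2).im = ω₁.re / 2 := by
    rw [show ((2 : ℂ)) = ((2 : ℝ) : ℂ) by norm_num, Complex.div_ofReal_im]; simp
  rw [Complex.add_im, Complex.sub_im, e, Complex.ofReal_im]
  constructor <;> rw [abs_lt] <;> constructor <;> linarith

lemma integrableOn_logCoshIntegrand (h₁ : 0 < ω₁.re) (h₂ : 0 < ω₂.re) (x : ℝ) :
    IntegrableOn (fun t : ℝ =>
      (1 / (ω₂ * t) - Complex.cos (2 * x * t) / Complex.sinh (ω₂ * t)) / t) (Set.Ioi 0) := by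
  obtain ⟨y1, y2⟩ := abs_two_mul_im_half h₁ h₂ x
  refine IntegrableOn.congr_fun (((integrableOn_stripIntegrand h₁ h₂ y1).sub
    (integrableOn_stripIntegrand h₁ h₂ y2)).const_mul Complex.I) (fun t ht => ?_) measurableSet_Ioi
  exact (stripIntegrand_shift h₁ h₂ x ht).symm

lemma logCoshIntegral_eq (h₁ : 0 < ω₁.re) (h₂ : 0 < ω₂.re) (x : ℝ) :
    logCoshIntegral ω₂ x = Complex.I * (stripIntegral ω₁ ω₂ (x + Complex.I * ω₁ / 2)
      - stripIntegral ω₁ ω₂ (x - Complex.I * ω₁ / 2)) := by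
  obtain ⟨y1, y2⟩ := abs_two_mul_im_half h₁ h₂ x
  rw [logCoshIntegral, setIntegral_congr_fun measurableSet_Ioi
    (fun t ht => stripIntegrand_shift h₁ h₂ x ht), integral_const_mul,
    integral_sub (integrableOn_stripIntegrand h₁ h₂ y1) (integrableOn_stripIntegrand h₁ h₂ y2)]
  rfl

lemma integrableOn_div_sinh {a : ℂ} (ha : 0 < a.re) :
    IntegrableOn (fun t : ℝ => (t : ℂ) / Complex.sinh (a * t)) (Set.Ioi 0) := by
  have ha0 : a ≠ 0 := by rintro rfl; simp at ha
  refine integrableOn_Ioi_of_isBigO ?_ ?_ ?_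
  · exact ContinuousOn.div (by fun_prop) (by fun_prop) fun t ht => sinh_mul_ne_zero ha ht
  · have := ((tendsto_div_sinh.comp (tendsto_const_mul_ofReal_ne ha0)).isBigO_one ℝ).const_mul_left
      a⁻¹
    refine this.congr_left fun t => ?_
    simp only [Function.comp]
    field_simp
  · have h1 : (fun t : ℝ => (t : ℂ)) =O[atTop] fun t => t ^ (1 : ℝ) := by
      refine IsBigO.of_bound 1 (Eventually.of_forall fun t => ?_)
      simp
    have h2 := h1.mul ((isBigO_inv_sinh ha).trans
      (isLittleO_exp_neg_mul_rpow_atTop ha (-3)).isBigO)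
    refine h2.congr' (Eventually.of_forall fun t => by simp only [div_eq_mul_inv]) ?_
    filter_upwards [eventually_gt_atTop 0] with t ht
    rw [← Real.rpow_add ht]
    norm_num

lemma hasDerivAt_logCoshIntegral (h₁ : 0 < ω₁.re) (h₂ : 0 < ω₂.re) (x : ℝ) :
    HasDerivAt (logCoshIntegral ω₂)
      (∫ t in Set.Ioi (0 : ℝ), 2 * Complex.sin (2 * x * t) / Complex.sinh (ω₂ * t)) x := by
  have hb := (integrableOn_div_sinh h₂).norm.const_mul (4 * (|x| + 1))
  refine (hasDerivAt_integral_of_dominated_loc_of_deriv_le (𝕜 := ℝ)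
    (F := fun (x t : ℝ) => (1 / (ω₂ * t) - Complex.cos (2 * x * t) / Complex.sinh (ω₂ * t)) / t)
    (F' := fun (x t : ℝ) => 2 * Complex.sin (2 * x * t) / Complex.sinh (ω₂ * t))
    (Metric.ball_mem_nhds x one_pos)
    (Eventually.of_forall fun x => (integrableOn_logCoshIntegrand h₁ h₂ x).aestronglyMeasurable)
    (integrableOn_logCoshIntegrand h₁ h₂ x) ?_ ?_ hb ?_).2
  · refine ContinuousOn.aestronglyMeasurable ?_ measurableSet_Ioi
    exact ContinuousOn.div (by fun_prop) (by fun_prop) fun t ht => sinh_mul_ne_zero h₂ ht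
  · filter_upwards [ae_restrict_mem measurableSet_Ioi] with t ht y hy
    have ht : 0 < t := ht
    have hy1 : |y| ≤ |x| + 1 := by
      have h := abs_sub_abs_le_abs_sub y x
      have h' : |y - x| < 1 := by simpa [Real.dist_eq] using hy
      linarith
    rw [norm_div, norm_mul, norm_div, Complex.norm_ofNat, Complex.norm_real,
      Real.norm_of_nonneg ht.le,
      ← mul_div_assoc]
    refine div_le_div_of_nonneg_right ?_ (norm_nonneg _)
    have : Complex.sin (2 * y * t) = ((Real.sin (2 * y * t) : ℝ) : ℂ) := by push_cast; rfl
    rw [this, Complex.norm_real, Real.norm_eq_abs]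
    have h2 : |Real.sin (2 * y * t)| ≤ 2 * |y| * t := by
      refine Real.abs_sin_le_abs.trans_eq ?_
      rw [abs_mul, abs_mul, abs_two, abs_of_pos ht]
    nlinarith
  · filter_upwards [ae_restrict_mem measurableSet_Ioi] with t ht y _
    have ht0 : (t : ℂ) ≠ 0 := by exact_mod_cast (ne_of_gt ht)
    have hs := sinh_mul_ne_zero h₂ ht
    have h1 : HasDerivAt (fun y : ℝ => 2 * (y : ℂ) * t) (2 * 1 * t) y :=
      (((hasDerivAt_id y).ofReal_comp).const_mul 2).mul_const _
    have h2 := ((((Complex.hasDerivAt_cos _).comp y h1).div_const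
      (Complex.sinh (ω₂ * t))).const_sub (1 / (ω₂ * t))).div_const (t : ℂ)
    refine h2.congr_deriv ?_
    field_simp

lemma shiftFactor_sub_half (h₂ : ω₂ ≠ 0) (v : ℂ) :
    shiftFactor ω₁ ω₂ (v - Complex.I * ω₁ / 2) = 2 * Complex.cosh (Real.pi * v / ω₂) := by
  have e : Real.pi * ((v - Complex.I * ω₁ / 2 + Complex.I * om ω₁ ω₂) / ω₂)
      = Real.pi * v / ω₂ + Real.pi / 2 * Complex.I := by
    simp only [om]; field_simp; ring
  rw [shiftFactor, e, Complex.sinh_add, Complex.cosh_mul_I, Complex.sinh_mul_I,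
    Complex.cos_pi_div_two, Complex.sin_pi_div_two]
  linear_combination (-2 * Complex.cosh (Real.pi * v / ω₂)) * Complex.I_sq

lemma tendsto_exp_neg_logCoshIntegral (h₁ : 0 < ω₁.re) (h₂ : 0 < ω₂.re) :
    Tendsto (fun x : ℝ => Complex.exp (-logCoshIntegral ω₂ x)
      * (2 * Complex.cosh (Real.pi * x / ω₂))) atTop (𝓝 1) := by
  have h20 : ω₂ ≠ 0 := by rintro rfl; simp at h₂
  obtain ⟨y1, y2⟩ := abs_two_mul_im_half h₁ h₂ 0
  rw [Complex.ofReal_zero, zero_add] at y1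
  rw [Complex.ofReal_zero, zero_sub] at y2
  have g1 := gaussianLine_hypGammaStrip h₁ h₂ y1
  have g2 := (gaussianLine_hypGammaStrip h₁ h₂ y2).mul_shiftFactor h₁ h₂
    (b := Complex.I * ω₁ / 2) (by ring)
  have h := g2.tendsto_top.div g1.tendsto_top (gaussConst_ne_zero _ _)
  rw [div_self (gaussConst_ne_zero _ _)] at h
  refine h.congr fun x => ?_
  simp only [Pi.div_apply]
  rw [mul_div_mul_right _ _ (Complex.exp_ne_zero _), ← sub_eq_add_neg, shiftFactor_sub_half h20,
    logCoshIntegral_eq h₁ h₂, hypGammaStrip_eq, hypGammaStrip_eq, mul_div_right_comm,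
    ← Complex.exp_sub]
  ring_nf

/-- Both sides have the same logarithmic derivative, and their ratio tends to `1` by the Gaussian
asymptotics. -/
lemma exp_logCoshIntegral (h₁ : 0 < ω₁.re) (h₂ : 0 < ω₂.re) (x : ℝ) :
    Complex.exp (logCoshIntegral ω₂ x) = 2 * Complex.cosh (Real.pi * x / ω₂) := by
  set D : ℝ → ℂ := fun x => Complex.exp (-logCoshIntegral ω₂ x)
      * (2 * Complex.cosh (Real.pi * x / ω₂)) with hD
  have hd : ∀ x, HasDerivAt D 0 x := by
    intro x
    have k1 := (hasDerivAt_logCoshIntegral h₁ h₂ x).neg.cexp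
    have k2 : HasDerivAt (fun x : ℝ => Real.pi * (x : ℂ) / ω₂) (Real.pi * 1 / ω₂) x :=
      (((hasDerivAt_id x).ofReal_comp).const_mul _).div_const _
    have k3 := k1.mul (((Complex.hasDerivAt_cosh _).comp x k2).const_mul 2)
    refine k3.congr_deriv ?_
    have := integral_sin_div_sinh h₂ x
    simp only [Pi.neg_apply, Function.comp]
    linear_combination -2 * Complex.exp (-logCoshIntegral ω₂ x) * this
  have hconst : ∀ y, D y = D x := fun y =>
    is_const_of_deriv_eq_zero (fun x => (hd x).differentiableAt) (fun x => (hd x).deriv) y x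
  have hlim := tendsto_exp_neg_logCoshIntegral h₁ h₂
  have h1 : D x = 1 := by
    refine tendsto_nhds_unique ?_ hlim
    exact tendsto_const_nhds.congr fun y => (hconst y).symm
  rw [hD] at h1
  simp only [] at h1
  rw [Complex.exp_neg, inv_mul_eq_one₀ (Complex.exp_ne_zero _)] at h1
  exact h1

/-- The difference equation on the line where `z` and `z + i ω₁` lie symmetrically in the strip. -/
lemma hypGammaStrip_add_of_im (h₁ : 0 < ω₁.re) (h₂ : 0 < ω₂.re) {w : ℂ} (hw : w.im = -(ω₁.re / 2)) :
    hypGammaStrip ω₁ ω₂ (w + Complex.I * ω₁) = shiftFactor ω₁ ω₂ w * hypGammaStrip ω₁ ω₂ w := by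
  have h20 : ω₂ ≠ 0 := by rintro rfl; simp at h₂
  have e : (Complex.I * ω₁ / 2).im = ω₁.re / 2 := by
    rw [show ((2 : ℂ)) = ((2 : ℝ) : ℂ) by norm_num, Complex.div_ofReal_im]; simp
  obtain ⟨x, hx⟩ : ∃ x : ℝ, w = x - Complex.I * ω₁ / 2 := by
    refine ⟨(w + Complex.I * ω₁ / 2).re, ?_⟩
    rw [eq_sub_iff_add_eq]
    refine Complex.ext (by simp) ?_
    rw [Complex.add_im, hw, e, Complex.ofReal_im]; ring
  rw [hx, shiftFactor_sub_half h20, ← exp_logCoshIntegral h₁ h₂, logCoshIntegral_eq h₁ h₂,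
    hypGammaStrip_eq, hypGammaStrip_eq, ← Complex.exp_add]
  ring_nf

lemma shiftFactor_neg (h₂ : ω₂ ≠ 0) (z : ℂ) :
    shiftFactor ω₁ ω₂ (-z - Complex.I * ω₁) = shiftFactor ω₁ ω₂ z := by
  have e : Real.pi * ((-z - Complex.I * ω₁ + Complex.I * om ω₁ ω₂) / ω₂)
      = -(Real.pi * ((z + Complex.I * om ω₁ ω₂) / ω₂)) + Real.pi * Complex.I := by
    simp only [om]; field_simp; ring
  rw [shiftFactor, e, Complex.sinh_add, Complex.cosh_mul_I, Complex.sinh_mul_I, Complex.cos_pi,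
    Complex.sin_pi, Complex.sinh_neg, shiftFactor]
  ring

/-- The reflection equation.  The reductions of `z` and `-z` used by `hypGamma` are opposite to
each other except when `Im z / Re ω₁` is half an odd integer, where they differ by one step. -/
lemma inv_hypGamma (h₁ : 0 < ω₁.re) (h₂ : 0 < ω₂.re) {z : ℂ} (hz : z.im < (om ω₁ ω₂).re) :
    (hypGamma ω₁ ω₂ z)⁻¹ = hypGamma ω₁ ω₂ (-z) := by
  have h20 : ω₂ ≠ 0 := by rintro rfl; simp at h₂
  by_cases h : |z.im| < (om ω₁ ω₂).re
  · rw [hypGamma_eq_strip h, hypGamma_eq_strip (by simpa using h), hypGammaStrip_neg]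
  have hn : ¬ |(-z).im| < (om ω₁ ω₂).re := by simpa using h
  have hz0 : z.im ≤ 0 := by
    by_contra h0
    exact h (abs_lt.2 ⟨by rw [om_re]; linarith, hz⟩)
  obtain ⟨N, hN⟩ := exists_round_eq_neg_natCast (div_nonpos_of_nonpos_of_nonneg hz0 h₁.le)
  obtain ⟨M, hM⟩ := exists_round_eq_natCast (s := (-z).im / ω₁.re)
    (div_nonneg (by simpa using hz0) h₁.le)
  rw [hypGamma_eq_div_prod h hN, hypGamma_eq_mul_prod hn hM, inv_div, div_eq_inv_mul,
    ← hypGammaStrip_neg]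
  have hk : ∀ k : ℕ, shiftFactor ω₁ ω₂ (z + N * (Complex.I * ω₁) - (k + 1) * (Complex.I * ω₁))
      = shiftFactor ω₁ ω₂ (-z - N * (Complex.I * ω₁) + k * (Complex.I * ω₁)) := by
    intro k
    rw [← shiftFactor_neg h20]
    ring_nf
  simp_rw [hk]
  have hM' := hM
  have hN' := hN
  have es : (-z).im / ω₁.re = -(z.im / ω₁.re) := by simp [neg_div]
  rw [es, round_eq, Int.floor_eq_iff] at hM'
  rw [round_eq, Int.floor_eq_iff] at hN'
  push_cast at hM' hN'
  obtain ⟨m1, m2⟩ := hM'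
  obtain ⟨n1, n2⟩ := hN'
  -- Ties are rounded upwards, so `round (-s) = -round s + 1` at half-integers `s`.
  have hNM : (M : ℤ) = N ∨ (M : ℤ) = N + 1 := by
    have c1 : (M : ℝ) < N + 2 := by linarith
    have c2 : (N : ℝ) < M + 1 := by linarith
    have c1' : M < N + 2 := by exact_mod_cast c1
    have c2' : N < M + 1 := by exact_mod_cast c2
    omega
  rcases hNM with hNM | hNM
  · have : M = N := by exact_mod_cast hNM
    subst this
    rw [neg_add, ← sub_eq_add_neg]
  · have : M = N + 1 := by exact_mod_cast hNM
    subst this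
    push_cast at m1 m2
    have hhalf : z.im / ω₁.re = -N - 1 / 2 := by linarith
    have hzim : z.im = (-N - 1 / 2) * ω₁.re := by rw [← hhalf]; field_simp
    have hw : (-z - (N + 1 : ℕ) * (Complex.I * ω₁)).im = -(ω₁.re / 2) := by
      simp [hzim]; ring
    have key := hypGammaStrip_add_of_im h₁ h₂ hw
    have hprod : ∏ k ∈ Finset.range N,
          shiftFactor ω₁ ω₂ (-z - N * (Complex.I * ω₁) + k * (Complex.I * ω₁))
        = ∏ k ∈ Finset.range N, shiftFactor ω₁ ω₂
          (-z - (N + 1 : ℕ) * (Complex.I * ω₁) + (k + 1 : ℕ) * (Complex.I * ω₁)) := by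
      refine Finset.prod_congr rfl fun k _ => ?_
      congr 1; push_cast; ring
    rw [Finset.prod_range_succ', hprod, show -(z + N * (Complex.I * ω₁))
      = -z - (N + 1 : ℕ) * (Complex.I * ω₁) + Complex.I * ω₁ by push_cast; ring, key,
      Nat.cast_zero, zero_mul, add_zero]
    ring

/-! ### Bounds and limits of the factors of the integrands -/

/-- The number `κ i ω = -π ω / (2 ω₁ ω₂)`, where `κ` is `gaussRate`; its real part is the
basic decay rate. -/
def decayRate (ω₁ ω₂ : ℂ) : ℂ := gaussRate ω₁ ω₂ * (Complex.I * om ω₁ ω₂)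

lemma decayRate_eq (h₁ : 0 < ω₁.re) (h₂ : 0 < ω₂.re) :
    decayRate ω₁ ω₂ = ((-(Real.pi / 4) : ℝ) : ℂ) * (ω₁⁻¹ + ω₂⁻¹) := by
  have h10 : ω₁ ≠ 0 := by rintro rfl; simp at h₁
  have h20 : ω₂ ≠ 0 := by rintro rfl; simp at h₂
  rw [decayRate, gaussRate, om]
  push_cast
  field_simp
  linear_combination (4 * (ω₁ + ω₂)) * Complex.I_sq

lemma decayRate_re_neg (h₁ : 0 < ω₁.re) (h₂ : 0 < ω₂.re) : (decayRate ω₁ ω₂).re < 0 := by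
  rw [decayRate_eq h₁ h₂, Complex.re_ofReal_mul, Complex.add_re]
  have := mul_pos Real.pi_pos (add_pos (inv_re_pos h₁) (inv_re_pos h₂))
  linarith

lemma gaussRate_mul_re (w : ℂ) :
    (gaussRate ω₁ ω₂ * w).re = -(Real.pi / 2) * (w / (ω₁ * ω₂)).im := by
  have : gaussRate ω₁ ω₂ * w = ((Real.pi / 2 : ℝ) : ℂ) * (w / (ω₁ * ω₂) * Complex.I) := by
    rw [gaussRate]
    push_cast
    rw [div_mul_eq_mul_div, mul_comm (2 : ℂ), ← div_div]
    ring
  rw [this, Complex.re_ofReal_mul, Complex.mul_I_re]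
  ring

lemma exists_bound_hypGamma (h₁ : 0 < ω₁.re) (h₂ : 0 < ω₂.re) {a : ℂ}
    (ha : -(om ω₁ ω₂).re < a.im) : ∃ M : ℝ, 0 ≤ M ∧ ∀ x : ℝ, ‖hypGamma ω₁ ω₂ (a + x)‖
      ≤ M * Real.exp (-((gaussRate ω₁ ω₂).re * (x * |x|)
        + 2 * (gaussRate ω₁ ω₂ * a).re * |x|)) := by
  obtain ⟨M, hM, h⟩ := (gaussianLine_hypGamma h₁ h₂ ha).exists_bound
  exact ⟨M, hM, fun x => by rw [add_comm]; exact h x⟩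

lemma exists_bound_inv_hypGamma (h₁ : 0 < ω₁.re) (h₂ : 0 < ω₂.re) {a : ℂ}
    (ha : a.im < (om ω₁ ω₂).re) : ∃ M : ℝ, 0 ≤ M ∧ ∀ x : ℝ, ‖(hypGamma ω₁ ω₂ (a + x))⁻¹‖
      ≤ M * Real.exp ((gaussRate ω₁ ω₂).re * (x * |x|)
        + 2 * (gaussRate ω₁ ω₂ * a).re * |x|) := by
  obtain ⟨M, hM, h⟩ := (gaussianLine_inv_hypGamma h₁ h₂ ha).exists_bound
  refine ⟨M, hM, fun x => ?_⟩
  have := h x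
  rw [add_comm (x : ℂ)] at this
  refine this.trans_eq ?_
  rw [neg_mul, Complex.neg_re, Complex.neg_re]
  ring_nf

lemma I_mul_om_im : (Complex.I * om ω₁ ω₂).im = (om ω₁ ω₂).re := by simp

lemma om_re_pos (h₁ : 0 < ω₁.re) (h₂ : 0 < ω₂.re) : 0 < (om ω₁ ω₂).re := by
  rw [om_re]; linarith

lemma neg_om_re_lt (h₁ : 0 < ω₁.re) (h₂ : 0 < ω₂.re) :
    -(om ω₁ ω₂).re < (Complex.I * om ω₁ ω₂).im := by
  rw [I_mul_om_im]; linarith [om_re_pos h₁ h₂]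

lemma exists_bound_numerator (h₁ : 0 < ω₁.re) (h₂ : 0 < ω₂.re) :
    ∃ M : ℝ, 0 ≤ M ∧ ∀ x : ℝ, ‖hypGamma ω₁ ω₂ (Complex.I * om ω₁ ω₂ + x)
        * hypGamma ω₁ ω₂ (Complex.I * om ω₁ ω₂ - x)‖
      ≤ M * Real.exp (-4 * (decayRate ω₁ ω₂).re * |x|) := by
  obtain ⟨M, hM, h⟩ := exists_bound_hypGamma h₁ h₂ (neg_om_re_lt h₁ h₂)
  refine ⟨M * M, by positivity, fun x => ?_⟩
  have h' := h (-x)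
  rw [Complex.ofReal_neg, ← sub_eq_add_neg] at h'
  rw [norm_mul]
  refine (mul_le_mul (h x) h' (norm_nonneg _) (by positivity)).trans_eq ?_
  rw [mul_mul_mul_comm, ← Real.exp_add, abs_neg, decayRate]
  ring_nf

lemma norm_prod_le_exp_sum {ι : Type*} (s : Finset ι) {f : ι → ℂ} {M e : ι → ℝ}
    (h : ∀ j ∈ s, ‖f j‖ ≤ M j * Real.exp (e j)) :
    ‖∏ j ∈ s, f j‖ ≤ (∏ j ∈ s, M j) * Real.exp (∑ j ∈ s, e j) := by
  rw [norm_prod, Real.exp_sum, ← Finset.prod_mul_distrib]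
  exact Finset.prod_le_prod (fun _ _ => norm_nonneg _) h

lemma continuous_hypGamma_line (h₁ : 0 < ω₁.re) (h₂ : 0 < ω₂.re) {a : ℂ}
    (ha : -(om ω₁ ω₂).re < a.im) {f : ℝ → ℝ} (hf : Continuous f) :
    Continuous fun x : ℝ => hypGamma ω₁ ω₂ (a + (f x : ℝ)) := by
  simp_rw [add_comm a]
  exact (gaussianLine_hypGamma h₁ h₂ ha).continuous.comp hf

lemma continuous_inv_hypGamma_line (h₁ : 0 < ω₁.re) (h₂ : 0 < ω₂.re) {a : ℂ}
    (ha : a.im < (om ω₁ ω₂).re) {f : ℝ → ℝ} (hf : Continuous f) :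
    Continuous fun x : ℝ => (hypGamma ω₁ ω₂ (a + (f x : ℝ)))⁻¹ := by
  simp_rw [add_comm a]
  exact (gaussianLine_inv_hypGamma h₁ h₂ ha).continuous.comp hf

lemma tendsto_hypGamma_atTop (h₁ : 0 < ω₁.re) (h₂ : 0 < ω₂.re) {a : ℂ}
    (ha : -(om ω₁ ω₂).re < a.im) {l : Filter ℝ} {f : ℝ → ℝ} (hf : Tendsto f l atTop) :
    Tendsto (fun r => hypGamma ω₁ ω₂ (a + f r) * Complex.exp (gaussRate ω₁ ω₂ * (a + f r) ^ 2))
      l (𝓝 (gaussConst ω₁ ω₂)) := by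
  simp_rw [add_comm a]
  exact (gaussianLine_hypGamma h₁ h₂ ha).tendsto_top.comp hf

lemma tendsto_hypGamma_atBot (h₁ : 0 < ω₁.re) (h₂ : 0 < ω₂.re) {a : ℂ}
    (ha : -(om ω₁ ω₂).re < a.im) {l : Filter ℝ} {f : ℝ → ℝ} (hf : Tendsto f l atTop) :
    Tendsto (fun r => hypGamma ω₁ ω₂ (a - f r) * Complex.exp (-gaussRate ω₁ ω₂ * (a - f r) ^ 2))
      l (𝓝 (gaussConst ω₁ ω₂)⁻¹) := by
  refine ((gaussianLine_hypGamma h₁ h₂ ha).tendsto_bot.comp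
    (tendsto_neg_atTop_atBot.comp hf)).congr fun r => ?_
  simp only [Function.comp, Complex.ofReal_neg]
  rw [neg_add_eq_sub]

lemma tendsto_inv_hypGamma_atTop (h₁ : 0 < ω₁.re) (h₂ : 0 < ω₂.re) {a : ℂ}
    (ha : a.im < (om ω₁ ω₂).re) {l : Filter ℝ} {f : ℝ → ℝ} (hf : Tendsto f l atTop) :
    Tendsto (fun r => (hypGamma ω₁ ω₂ (a + f r))⁻¹
      * Complex.exp (-gaussRate ω₁ ω₂ * (a + f r) ^ 2)) l (𝓝 (gaussConst ω₁ ω₂)⁻¹) := by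
  simp_rw [add_comm a]
  exact (gaussianLine_inv_hypGamma h₁ h₂ ha).tendsto_top.comp hf

lemma tendsto_inv_hypGamma_atBot (h₁ : 0 < ω₁.re) (h₂ : 0 < ω₂.re) {a : ℂ}
    (ha : a.im < (om ω₁ ω₂).re) {l : Filter ℝ} {f : ℝ → ℝ} (hf : Tendsto f l atTop) :
    Tendsto (fun r => (hypGamma ω₁ ω₂ (a - f r))⁻¹
      * Complex.exp (gaussRate ω₁ ω₂ * (a - f r) ^ 2)) l (𝓝 (gaussConst ω₁ ω₂)) := by
  have := (gaussianLine_inv_hypGamma h₁ h₂ ha).tendsto_bot.comp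
    (tendsto_neg_atTop_atBot.comp hf)
  rw [inv_inv] at this
  refine this.congr fun r => ?_
  simp only [Function.comp, Complex.ofReal_neg]
  rw [neg_add_eq_sub, neg_neg]

/-! ### Integrability -/

lemma integrable_exp_neg_mul_abs {c : ℝ} (hc : c < 0) :
    Integrable fun x : ℝ => Real.exp (c * |x|) := by
  rw [← integrableOn_univ, ← Set.Iic_union_Ioi (a := (0 : ℝ))]
  refine IntegrableOn.union ?_ ?_
  · refine (integrableOn_exp_mul_Iic (neg_pos.2 hc) 0).congr_fun (fun x hx => ?_) measurableSet_Iic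
    have hx : x ≤ 0 := hx
    simp only []
    rw [abs_of_nonpos hx]; ring_nf
  · refine (integrableOn_exp_mul_Ioi hc 0).congr_fun (fun x hx => ?_) measurableSet_Ioi
    have hx : 0 < x := hx
    simp only []
    rw [abs_of_pos hx]

/-- The integrand `G(iω ± 2z) / ∏ G(v_j ± z)` with any finite family of parameters. -/
def symmIntegrand {ι : Type*} [Fintype ι] (ω₁ ω₂ : ℂ) (v : ι → ℂ) (z : ℝ) : ℂ :=
  hypGamma ω₁ ω₂ (Complex.I * om ω₁ ω₂ + (2 * z : ℝ))
    * hypGamma ω₁ ω₂ (Complex.I * om ω₁ ω₂ - (2 * z : ℝ))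
    * ∏ j, ((hypGamma ω₁ ω₂ (v j + z))⁻¹ * (hypGamma ω₁ ω₂ (v j - z))⁻¹)

lemma Ih_eq (u : Fin 8 → ℂ) (z : ℝ) : Ih ω₁ ω₂ u z = symmIntegrand ω₁ ω₂ u z := by
  simp only [Ih, symmIntegrand, div_eq_mul_inv, ← Finset.prod_inv_distrib, mul_inv]
  push_cast; rfl

lemma eulerIntegrand_eq (u : Fin 6 → ℂ) (z : ℝ) :
    eulerIntegrand ω₁ ω₂ u z = symmIntegrand ω₁ ω₂ u z := by
  simp only [eulerIntegrand, symmIntegrand, div_eq_mul_inv, ← Finset.prod_inv_distrib, mul_inv]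
  push_cast; rfl

lemma symmIntegrand_neg {ι : Type*} [Fintype ι] (v : ι → ℂ) (z : ℝ) :
    symmIntegrand ω₁ ω₂ v (-z) = symmIntegrand ω₁ ω₂ v z := by
  simp only [symmIntegrand]
  push_cast
  simp only [mul_neg, sub_neg_eq_add, ← sub_eq_add_neg]
  congr 1
  · rw [mul_comm]
  · exact Finset.prod_congr rfl fun j _ => mul_comm _ _

lemma continuous_symmIntegrand (h₁ : 0 < ω₁.re) (h₂ : 0 < ω₂.re) {ι : Type*} [Fintype ι]
    {v : ι → ℂ} (hv : ∀ j, (v j).im < (om ω₁ ω₂).re) : Continuous (symmIntegrand ω₁ ω₂ v) := by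
  have hneg := neg_om_re_lt h₁ h₂
  unfold symmIntegrand
  refine Continuous.mul (Continuous.mul ?_ ?_) (continuous_finsetProd _ fun j _ =>
    Continuous.mul ?_ ?_)
  · exact continuous_hypGamma_line h₁ h₂ hneg (by fun_prop)
  · refine (continuous_hypGamma_line h₁ h₂ hneg (f := fun z => -(2 * z)) (by fun_prop)).congr
      fun z => ?_
    push_cast; rw [← sub_eq_add_neg]
  · exact continuous_inv_hypGamma_line h₁ h₂ (hv j) continuous_id
  · refine (continuous_inv_hypGamma_line h₁ h₂ (hv j) continuous_neg).congr fun z => ?_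
    push_cast; rw [← sub_eq_add_neg]

/-- The numerator contributes `-8 Re (κ i ω) |z|` to the exponent and each `v j` contributes
`4 Re (κ v_j) |z|`; the quadratic terms at `z` and `-z` cancel. -/
lemma integrable_symmIntegrand (h₁ : 0 < ω₁.re) (h₂ : 0 < ω₂.re) {ι : Type*} [Fintype ι]
    {v : ι → ℂ} (hv : ∀ j, (v j).im < (om ω₁ ω₂).re)
    (hs : (gaussRate ω₁ ω₂ * ∑ j, v j).re < 2 * (decayRate ω₁ ω₂).re) :
    Integrable (symmIntegrand ω₁ ω₂ v) := by
  choose M hM hb using fun j => exists_bound_inv_hypGamma h₁ h₂ (hv j)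
  obtain ⟨N, hN, hnum⟩ := exists_bound_numerator h₁ h₂
  set c := -8 * (decayRate ω₁ ω₂).re + 4 * (gaussRate ω₁ ω₂ * ∑ j, v j).re with hc
  refine Integrable.mono' ((integrable_exp_neg_mul_abs (c := c) (by linarith)).const_mul
    (N * ∏ j, (M j * M j))) (continuous_symmIntegrand h₁ h₂ hv).aestronglyMeasurable
    (Eventually.of_forall fun z => ?_)
  have hj : ∀ j ∈ (Finset.univ : Finset ι),
      ‖(hypGamma ω₁ ω₂ (v j + z))⁻¹ * (hypGamma ω₁ ω₂ (v j - z))⁻¹‖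
        ≤ M j * M j * Real.exp (4 * |z| * (gaussRate ω₁ ω₂ * v j).re) := by
    intro j _
    have h' := hb j (-z)
    rw [Complex.ofReal_neg, ← sub_eq_add_neg] at h'
    rw [norm_mul]
    refine (mul_le_mul (hb j z) h' (norm_nonneg _)
      (mul_nonneg (hM j) (Real.exp_pos _).le)).trans_eq ?_
    rw [mul_mul_mul_comm, ← Real.exp_add, abs_neg]
    ring_nf
  have h3 := norm_prod_le_exp_sum Finset.univ hj
  rw [← Finset.mul_sum, ← Complex.re_sum, ← Finset.mul_sum] at h3
  rw [symmIntegrand, norm_mul]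
  refine (mul_le_mul (hnum (2 * z)) h3 (norm_nonneg _) (by positivity)).trans_eq ?_
  rw [mul_mul_mul_comm, ← Real.exp_add, hc, abs_mul, abs_two]
  ring_nf

lemma integral_eq_two_mul_of_even {f : ℝ → ℂ} (hf : Integrable f) (he : ∀ x, f (-x) = f x) :
    ∫ x, f x = 2 * ∫ x in Set.Ioi (0 : ℝ), f x := by
  have h := integral_comp_neg_Iic (0 : ℝ) f
  simp only [he, neg_zero] at h
  rw [← intervalIntegral.integral_Iic_add_Ioi (b := (0 : ℝ)) hf.integrableOn hf.integrableOn, h]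
  ring

/-! ### Degeneration to the hyperbolic Barnes integral -/

lemma prod_eq_prod_mul_prod (f : Fin 8 → ℂ) :
    ∏ j, f j = (∏ j ∈ {0, 1, 6, 7}, f j) * ∏ j ∈ {2, 3, 4, 5}, f j := by
  rw [← Finset.prod_union (by decide)]
  exact Finset.prod_congr (by decide) fun _ _ => rfl

lemma sum_eq_sum_add_sum (f : Fin 8 → ℂ) :
    ∑ j, f j = (∑ j ∈ {0, 1, 6, 7}, f j) + ∑ j ∈ {2, 3, 4, 5}, f j := by
  rw [← Finset.sum_union (by decide)]
  exact Finset.sum_congr (by decide) fun _ _ => rfl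

lemma beta1278_of_mem {j : Fin 8} (hj : j ∈ ({0, 1, 6, 7} : Finset (Fin 8))) :
    beta1278 j = 1 / 2 := by
  fin_cases j <;> simp_all [beta1278]

lemma beta1278_of_mem' {j : Fin 8} (hj : j ∈ ({2, 3, 4, 5} : Finset (Fin 8))) :
    beta1278 j = -1 / 2 := by
  fin_cases j <;> simp_all [beta1278, neg_div]

lemma beta1278_im (j : Fin 8) : (beta1278 j).im = 0 := by
  fin_cases j <;> norm_num [beta1278]

lemma sum_beta1278 : ∑ j, beta1278 j = 0 := by
  simp [Fin.sum_univ_eight, beta1278]; norm_num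

lemma alpha78_im (j : Fin 8) : (alpha78 j).im = 0 := by
  fin_cases j <;> norm_num [alpha78]

lemma sum_alpha78 : ∑ j, alpha78 j = 0 := by
  simp [Fin.sum_univ_eight, alpha78]

/-- The balancing condition in the form used for decay estimates. -/
lemma gaussRate_mul_sum {u : Fin 8 → ℂ} (hu : u ∈ paramSpace (2 * Complex.I * om ω₁ ω₂)) :
    gaussRate ω₁ ω₂ * ∑ j, u j = 4 * decayRate ω₁ ω₂ := by
  rw [show ∑ j, u j = 2 * (2 * Complex.I * om ω₁ ω₂) from hu, decayRate]
  ring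

/-- Moving the parameters along a real direction with coordinate sum `0` keeps all conditions for
the absolute convergence of `S_h`. -/
lemma integrable_Ih_sub (h₁ : 0 < ω₁.re) (h₂ : 0 < ω₂.re) {u : Fin 8 → ℂ}
    (hu : u ∈ paramSpace (2 * Complex.I * om ω₁ ω₂)) (hv : ∀ j, (u j).im < (om ω₁ ω₂).re)
    {β : Fin 8 → ℂ} (hβ : ∀ j, (β j).im = 0) (hβs : ∑ j, β j = 0) (r : ℝ) :
    Integrable fun z : ℝ => Ih ω₁ ω₂ (u - (r : ℂ) • β) z := by
  simp_rw [Ih_eq]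
  refine integrable_symmIntegrand h₁ h₂ (fun j => ?_) ?_
  · simpa [hβ j] using hv j
  · have : ∑ j, (u - (r : ℂ) • β) j = ∑ j, u j := by
      simp [Finset.sum_sub_distrib, ← Finset.mul_sum, hβs]
    rw [this, gaussRate_mul_sum hu, show (4 : ℂ) = ((4 : ℝ) : ℂ) by norm_num,
      Complex.re_ofReal_mul]
    linarith [decayRate_re_neg h₁ h₂]

lemma barnesIntegrand_eq (h₁ : 0 < ω₁.re) (h₂ : 0 < ω₂.re) {u : Fin 8 → ℂ}
    (hv : ∀ j, (u j).im < (om ω₁ ω₂).re) (z : ℝ) :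
    barnesIntegrand ω₁ ω₂ u z = (∏ j ∈ {0, 1, 6, 7}, (hypGamma ω₁ ω₂ (u j + z))⁻¹)
      * ∏ j ∈ {2, 3, 4, 5}, (hypGamma ω₁ ω₂ (u j - z))⁻¹ := by
  rw [barnesIntegrand, div_eq_mul_inv, ← Finset.prod_inv_distrib, mul_comm]
  congr 1
  · exact Finset.prod_congr rfl fun j _ => by rw [add_comm]
  · refine Finset.prod_congr rfl fun j _ => ?_
    rw [inv_hypGamma h₁ h₂ (by simpa using hv j), neg_sub]

lemma integrable_barnesIntegrand (h₁ : 0 < ω₁.re) (h₂ : 0 < ω₂.re) {u : Fin 8 → ℂ}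
    (hu : u ∈ paramSpace (2 * Complex.I * om ω₁ ω₂)) (hv : ∀ j, (u j).im < (om ω₁ ω₂).re) :
    Integrable fun z : ℝ => barnesIntegrand ω₁ ω₂ u z := by
  simp_rw [barnesIntegrand_eq h₁ h₂ hv]
  choose M hM hb using fun j => exists_bound_inv_hypGamma h₁ h₂ (hv j)
  have hd := decayRate_re_neg h₁ h₂
  refine Integrable.mono' ((integrable_exp_neg_mul_abs
    (c := 8 * (decayRate ω₁ ω₂).re) (by linarith)).const_mul
    ((∏ j ∈ {0, 1, 6, 7}, M j) * ∏ j ∈ {2, 3, 4, 5}, M j))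
    (Continuous.aestronglyMeasurable ?_) (Eventually.of_forall fun z => ?_)
  · refine Continuous.mul (continuous_finsetProd _ fun j _ => ?_)
      (continuous_finsetProd _ fun j _ => ?_)
    · exact continuous_inv_hypGamma_line h₁ h₂ (hv j) continuous_id
    · refine (continuous_inv_hypGamma_line h₁ h₂ (hv j) continuous_neg).congr fun z => ?_
      push_cast; rw [← sub_eq_add_neg]
  · have b1 := norm_prod_le_exp_sum {0, 1, 6, 7} fun j _ => hb j z
    have b2 := norm_prod_le_exp_sum {2, 3, 4, 5} fun j _ => hb j (-z)
    simp only [Complex.ofReal_neg, ← sub_eq_add_neg] at b2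
    rw [norm_mul]
    refine (mul_le_mul b1 b2 (norm_nonneg _) (mul_nonneg
      (Finset.prod_nonneg fun j _ => hM j) (Real.exp_pos _).le)).trans_eq ?_
    rw [mul_mul_mul_comm, ← Real.exp_add]
    congr 2
    have hs := congrArg Complex.re (gaussRate_mul_sum hu)
    rw [sum_eq_sum_add_sum, mul_add, Finset.mul_sum, Finset.mul_sum, Complex.add_re,
      Complex.re_sum, Complex.re_sum, show (4 : ℂ) = ((4 : ℝ) : ℂ) by norm_num,
      Complex.re_ofReal_mul] at hs
    simp only [Finset.sum_add_distrib, ← Finset.sum_mul, ← Finset.mul_sum, abs_neg,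
      Finset.sum_const]
    simp only [show ({0, 1, 6, 7} : Finset (Fin 8)).card = 4 by decide,
      show ({2, 3, 4, 5} : Finset (Fin 8)).card = 4 by decide]
    linear_combination 2 * |z| * hs

/-- The quotient by the Barnes integrand at `z` of the integrand of `S_h(u - r β)` at `z + r / 2`,
multiplied by the two exponential factors of the limit formula. -/
def barnesRatio (ω₁ ω₂ : ℂ) (u : Fin 8 → ℂ) (r z : ℝ) : ℂ :=
  hypGamma ω₁ ω₂ (Complex.I * om ω₁ ω₂ + (2 * z + r : ℝ))
    * hypGamma ω₁ ω₂ (Complex.I * om ω₁ ω₂ - (2 * z + r : ℝ))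
    * ((∏ j ∈ {0, 1, 6, 7}, (hypGamma ω₁ ω₂ (u j - (z + r : ℝ)))⁻¹)
      * ∏ j ∈ {2, 3, 4, 5}, (hypGamma ω₁ ω₂ (u j + (z + r : ℝ)))⁻¹)
    * Complex.exp (-4 * r * decayRate ω₁ ω₂)
    * Complex.exp (gaussRate ω₁ ω₂ * (∑ j ∈ {0, 1, 6, 7}, u j ^ 2 - ∑ j ∈ {2, 3, 4, 5}, u j ^ 2))

lemma Ih_sub_beta_eq (h₁ : 0 < ω₁.re) (h₂ : 0 < ω₂.re) {u : Fin 8 → ℂ}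
    (hv : ∀ j, (u j).im < (om ω₁ ω₂).re) (r z : ℝ) :
    Ih ω₁ ω₂ (u - (r : ℂ) • beta1278) ((z + r / 2 : ℝ) : ℂ)
        * Complex.exp (-4 * r * decayRate ω₁ ω₂)
        * Complex.exp (gaussRate ω₁ ω₂
          * (∑ j ∈ {0, 1, 6, 7}, u j ^ 2 - ∑ j ∈ {2, 3, 4, 5}, u j ^ 2))
      = barnesIntegrand ω₁ ω₂ u z * barnesRatio ω₁ ω₂ u r z := by
  have e1 : ∏ j ∈ {0, 1, 6, 7}, ((hypGamma ω₁ ω₂ ((u - (r : ℂ) • beta1278) j + (z + r / 2 : ℝ)))⁻¹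
        * (hypGamma ω₁ ω₂ ((u - (r : ℂ) • beta1278) j - (z + r / 2 : ℝ)))⁻¹)
      = (∏ j ∈ {0, 1, 6, 7}, (hypGamma ω₁ ω₂ (u j + z))⁻¹)
        * ∏ j ∈ {0, 1, 6, 7}, (hypGamma ω₁ ω₂ (u j - (z + r : ℝ)))⁻¹ := by
    rw [← Finset.prod_mul_distrib]
    refine Finset.prod_congr rfl fun j hj => ?_
    simp only [Pi.sub_apply, Pi.smul_apply, beta1278_of_mem hj, smul_eq_mul]
    congr 3 <;> push_cast <;> ring
  have e2 : ∏ j ∈ {2, 3, 4, 5}, ((hypGamma ω₁ ω₂ ((u - (r : ℂ) • beta1278) j + (z + r / 2 : ℝ)))⁻¹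
        * (hypGamma ω₁ ω₂ ((u - (r : ℂ) • beta1278) j - (z + r / 2 : ℝ)))⁻¹)
      = (∏ j ∈ {2, 3, 4, 5}, (hypGamma ω₁ ω₂ (u j + (z + r : ℝ)))⁻¹)
        * ∏ j ∈ {2, 3, 4, 5}, (hypGamma ω₁ ω₂ (u j - z))⁻¹ := by
    rw [← Finset.prod_mul_distrib]
    refine Finset.prod_congr rfl fun j hj => ?_
    simp only [Pi.sub_apply, Pi.smul_apply, beta1278_of_mem' hj, smul_eq_mul]
    congr 3 <;> push_cast <;> ring
  rw [Ih_eq, symmIntegrand, prod_eq_prod_mul_prod, e1, e2, barnesIntegrand_eq h₁ h₂ hv, barnesRatio,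
    show (2 * (z + r / 2 : ℝ) : ℝ) = 2 * z + r by ring]
  ring

/-- The eight denominators contribute `8 Re (κ i ω) (z + r)` to the exponent by the balancing
condition, the numerator `-4 Re (κ i ω) (2 z + r)`, and the normalization `-4 r Re (κ i ω)`. -/
lemma exists_bound_barnesRatio (h₁ : 0 < ω₁.re) (h₂ : 0 < ω₂.re) {u : Fin 8 → ℂ}
    (hu : u ∈ paramSpace (2 * Complex.I * om ω₁ ω₂)) (hv : ∀ j, (u j).im < (om ω₁ ω₂).re) :
    ∃ M : ℝ, ∀ r z : ℝ, 0 ≤ 2 * z + r → 0 ≤ r → ‖barnesRatio ω₁ ω₂ u r z‖ ≤ M := by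
  choose M hM hb using fun j => exists_bound_inv_hypGamma h₁ h₂ (hv j)
  obtain ⟨N, hN, hnum⟩ := exists_bound_numerator h₁ h₂
  refine ⟨N * ((∏ j ∈ {0, 1, 6, 7}, M j) * ∏ j ∈ {2, 3, 4, 5}, M j) * ‖Complex.exp
    (gaussRate ω₁ ω₂ * (∑ j ∈ {0, 1, 6, 7}, u j ^ 2 - ∑ j ∈ {2, 3, 4, 5}, u j ^ 2))‖,
    fun r z hz hr => ?_⟩
  have hx : 0 ≤ z + r := by linarith
  have b1 := norm_prod_le_exp_sum {0, 1, 6, 7} fun j _ => hb j (-(z + r))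
  have b2 := norm_prod_le_exp_sum {2, 3, 4, 5} fun j _ => hb j (z + r)
  have b3 := hnum (2 * z + r)
  rw [abs_of_nonneg hz] at b3
  simp only [Complex.ofReal_neg, ← sub_eq_add_neg, abs_neg, abs_of_nonneg hx,
    Finset.sum_add_distrib, ← Finset.sum_mul, ← Finset.mul_sum, Finset.sum_const,
    show ({0, 1, 6, 7} : Finset (Fin 8)).card = 4 by decide,
    show ({2, 3, 4, 5} : Finset (Fin 8)).card = 4 by decide] at b1 b2
  have hs := congrArg Complex.re (gaussRate_mul_sum hu)
  rw [sum_eq_sum_add_sum, mul_add, Finset.mul_sum, Finset.mul_sum, Complex.add_re,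
    Complex.re_sum, Complex.re_sum, show (4 : ℂ) = ((4 : ℝ) : ℂ) by norm_num,
    Complex.re_ofReal_mul] at hs
  have hP1 : 0 ≤ ∏ j ∈ ({0, 1, 6, 7} : Finset (Fin 8)), M j := Finset.prod_nonneg fun j _ => hM j
  have hP2 : 0 ≤ ∏ j ∈ ({2, 3, 4, 5} : Finset (Fin 8)), M j := Finset.prod_nonneg fun j _ => hM j
  rw [barnesRatio, norm_mul, norm_mul, norm_mul _ (_ * _), norm_mul (∏ j ∈ _, _)]
  refine mul_le_mul_of_nonneg_right ?_ (norm_nonneg _)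
  have h3 := mul_le_mul b3 (mul_le_mul b1 b2 (norm_nonneg _)
    (mul_nonneg hP1 (Real.exp_pos _).le)) (mul_nonneg (norm_nonneg _) (norm_nonneg _))
    (mul_nonneg hN (Real.exp_pos _).le)
  refine (mul_le_mul_of_nonneg_right h3 (norm_nonneg _)).trans_eq ?_
  rw [Complex.norm_exp, show (-4 * (r : ℂ) * decayRate ω₁ ω₂)
    = ((-4 * r : ℝ) : ℂ) * decayRate ω₁ ω₂ by push_cast; ring, Complex.re_ofReal_mul,
    mul_mul_mul_comm (∏ j ∈ _, M j), mul_mul_mul_comm N, mul_assoc, ← Real.exp_add, ← Real.exp_add,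
    ← Real.exp_add]
  convert mul_one _
  rw [Real.exp_eq_one_iff]
  linear_combination 2 * (z + r) * hs

lemma tendsto_barnesRatio (h₁ : 0 < ω₁.re) (h₂ : 0 < ω₂.re) {u : Fin 8 → ℂ}
    (hu : u ∈ paramSpace (2 * Complex.I * om ω₁ ω₂)) (hv : ∀ j, (u j).im < (om ω₁ ω₂).re) (z : ℝ) :
    Tendsto (fun r => barnesRatio ω₁ ω₂ u r z) atTop (𝓝 1) := by
  have hC := gaussConst_ne_zero ω₁ ω₂
  have hs : Tendsto (fun r : ℝ => 2 * z + r) atTop atTop :=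
    tendsto_atTop_add_const_left _ _ tendsto_id
  have hx : Tendsto (fun r : ℝ => z + r) atTop atTop :=
    tendsto_atTop_add_const_left _ _ tendsto_id
  have hneg := neg_om_re_lt h₁ h₂
  have t1 := tendsto_hypGamma_atTop h₁ h₂ hneg hs
  have t2 := tendsto_hypGamma_atBot h₁ h₂ hneg hs
  have t3 := tendsto_finsetProd ({0, 1, 6, 7} : Finset (Fin 8))
    fun j _ => tendsto_inv_hypGamma_atBot h₁ h₂ (hv j) hx
  have t4 := tendsto_finsetProd ({2, 3, 4, 5} : Finset (Fin 8))
    fun j _ => tendsto_inv_hypGamma_atTop h₁ h₂ (hv j) hx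
  have t := (t1.mul t2).mul (t3.mul t4)
  simp only [Finset.prod_const, Finset.prod_mul_distrib, ← Complex.exp_sum,
    show ({0, 1, 6, 7} : Finset (Fin 8)).card = 4 by decide,
    show ({2, 3, 4, 5} : Finset (Fin 8)).card = 4 by decide] at t
  rw [show gaussConst ω₁ ω₂ * (gaussConst ω₁ ω₂)⁻¹
    * (gaussConst ω₁ ω₂ ^ 4 * (gaussConst ω₁ ω₂)⁻¹ ^ 4) = 1 by field_simp] at t
  refine t.congr fun r => ?_
  set s : ℂ := ((2 * z + r : ℝ) : ℂ) with hs_def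
  set x : ℂ := ((z + r : ℝ) : ℂ) with hx_def
  have key : Complex.exp (gaussRate ω₁ ω₂ * (Complex.I * om ω₁ ω₂ + s) ^ 2)
      * Complex.exp (-gaussRate ω₁ ω₂ * (Complex.I * om ω₁ ω₂ - s) ^ 2)
      * (Complex.exp (∑ j ∈ {0, 1, 6, 7}, gaussRate ω₁ ω₂ * (u j - x) ^ 2)
        * Complex.exp (∑ j ∈ {2, 3, 4, 5}, -gaussRate ω₁ ω₂ * (u j + x) ^ 2))
      = Complex.exp (-4 * r * decayRate ω₁ ω₂) * Complex.exp (gaussRate ω₁ ω₂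
        * (∑ j ∈ {0, 1, 6, 7}, u j ^ 2 - ∑ j ∈ {2, 3, 4, 5}, u j ^ 2)) := by
    simp only [← Complex.exp_add, ← Finset.mul_sum]
    congr 1
    have hsum := gaussRate_mul_sum hu
    rw [sum_eq_sum_add_sum] at hsum
    have q1 : ∑ j ∈ ({0, 1, 6, 7} : Finset (Fin 8)), (u j - x) ^ 2
        = ∑ j ∈ {0, 1, 6, 7}, u j ^ 2 - 2 * x * ∑ j ∈ {0, 1, 6, 7}, u j + 4 * x ^ 2 := by
      simp only [sub_sq, Finset.sum_add_distrib, Finset.sum_sub_distrib, Finset.sum_const,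
        Finset.mul_sum, show ({0, 1, 6, 7} : Finset (Fin 8)).card = 4 by decide]
      simp only [nsmul_eq_mul]
      push_cast
      congr 2
      exact Finset.sum_congr rfl fun j _ => by ring
    have q2 : ∑ j ∈ ({2, 3, 4, 5} : Finset (Fin 8)), (u j + x) ^ 2
        = ∑ j ∈ {2, 3, 4, 5}, u j ^ 2 + 2 * x * ∑ j ∈ {2, 3, 4, 5}, u j + 4 * x ^ 2 := by
      simp only [add_sq, Finset.sum_add_distrib, Finset.sum_const,
        Finset.mul_sum, show ({2, 3, 4, 5} : Finset (Fin 8)).card = 4 by decide]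
      simp only [nsmul_eq_mul]
      push_cast
      congr 2
      exact Finset.sum_congr rfl fun j _ => by ring
    rw [q1, q2]
    have hsx : s = 2 * x - r := by rw [hs_def, hx_def]; push_cast; ring
    rw [hsx]
    rw [decayRate] at hsum ⊢
    linear_combination (-2 * x) * hsum
  rw [barnesRatio, ← hs_def, ← hx_def]
  linear_combination (hypGamma ω₁ ω₂ (Complex.I * om ω₁ ω₂ + s)
    * hypGamma ω₁ ω₂ (Complex.I * om ω₁ ω₂ - s)
    * ((∏ j ∈ {0, 1, 6, 7}, (hypGamma ω₁ ω₂ (u j - x))⁻¹)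
      * ∏ j ∈ {2, 3, 4, 5}, (hypGamma ω₁ ω₂ (u j + x))⁻¹)) * key

lemma tendsto_Sh_beta (h₁ : 0 < ω₁.re) (h₂ : 0 < ω₂.re) {u : Fin 8 → ℂ}
    (hu : u ∈ paramSpace (2 * Complex.I * om ω₁ ω₂)) (hv : ∀ j, (u j).im < (om ω₁ ω₂).re) :
    Tendsto (fun r : ℝ => Sh ω₁ ω₂ (u - (r : ℂ) • beta1278)
      * Complex.exp (-4 * r * decayRate ω₁ ω₂)
      * Complex.exp (gaussRate ω₁ ω₂
          * (∑ j ∈ {0, 1, 6, 7}, u j ^ 2 - ∑ j ∈ {2, 3, 4, 5}, u j ^ 2)))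
      atTop (𝓝 (Bh ω₁ ω₂ u)) := by
  set E : ℝ → ℂ := fun r => Complex.exp (-4 * r * decayRate ω₁ ω₂)
      * Complex.exp (gaussRate ω₁ ω₂
          * (∑ j ∈ {0, 1, 6, 7}, u j ^ 2 - ∑ j ∈ {2, 3, 4, 5}, u j ^ 2)) with hE
  -- The substitution moves the half-line `(0, ∞)` to `(-r / 2, ∞)`, which exhausts the real line.
  set F : ℝ → ℝ → ℂ := fun r => (Set.Ioi (-(r / 2))).indicator
    fun z => barnesIntegrand ω₁ ω₂ u z * barnesRatio ω₁ ω₂ u r z with hF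
  have hFmem : ∀ r z : ℝ, -(r / 2) < z →
      F r z = barnesIntegrand ω₁ ω₂ u z * barnesRatio ω₁ ω₂ u r z :=
    fun r z hz => Set.indicator_of_mem (show z ∈ Set.Ioi (-(r / 2)) from hz) _
  have hFnot : ∀ r z : ℝ, ¬ -(r / 2) < z → F r z = 0 :=
    fun r z hz => Set.indicator_of_notMem (show z ∉ Set.Ioi (-(r / 2)) from hz) _
  have hIh : ∀ r : ℝ, Integrable fun z : ℝ => Ih ω₁ ω₂ (u - (r : ℂ) • beta1278) z :=
    integrable_Ih_sub h₁ h₂ hu hv beta1278_im sum_beta1278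
  have hFeq : ∀ r z, F r z = (Set.Ioi (0 : ℝ)).indicator
      (fun z : ℝ => Ih ω₁ ω₂ (u - (r : ℂ) • beta1278) z * E r) (z + r / 2) := by
    intro r z
    by_cases hz : -(r / 2) < z
    · rw [hFmem r z hz, Set.indicator_of_mem (show z + r / 2 ∈ Set.Ioi 0 from by
          simp only [Set.mem_Ioi]; linarith), ← Ih_sub_beta_eq h₁ h₂ hv, hE, mul_assoc]
    · rw [hFnot r z hz, Set.indicator_of_notMem (show z + r / 2 ∉ Set.Ioi 0 from by
          simp only [Set.mem_Ioi]; linarith)]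
  have hFint : ∀ r, ∫ z, F r z = (∫ z in Set.Ioi (0 : ℝ), Ih ω₁ ω₂ (u - (r : ℂ) • beta1278) z)
      * E r := by
    intro r
    simp_rw [hFeq]
    rw [integral_add_right_eq_self (fun z => (Set.Ioi (0 : ℝ)).indicator
      (fun z : ℝ => Ih ω₁ ω₂ (u - (r : ℂ) • beta1278) z * E r) z),
      integral_indicator measurableSet_Ioi, integral_mul_const]
  have hSh : ∀ r : ℝ, Sh ω₁ ω₂ (u - (r : ℂ) • beta1278) * Complex.exp (-4 * r * decayRate ω₁ ω₂)
      * Complex.exp (gaussRate ω₁ ω₂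
          * (∑ j ∈ {0, 1, 6, 7}, u j ^ 2 - ∑ j ∈ {2, 3, 4, 5}, u j ^ 2))
      = 2 * ∫ z, F r z := by
    intro r
    rw [hFint, Sh, integral_eq_two_mul_of_even (hIh r) fun z => by
      rw [Ih_eq, Ih_eq, symmIntegrand_neg]]
    simp only [hE]
    ring
  simp_rw [hSh, Bh]
  obtain ⟨M, hM⟩ := exists_bound_barnesRatio h₁ h₂ hu hv
  have hB := integrable_barnesIntegrand h₁ h₂ hu hv
  refine Tendsto.const_mul 2 (tendsto_integral_filter_of_dominated_convergence
    (fun z => M * ‖barnesIntegrand ω₁ ω₂ u z‖) ?_ ?_ (hB.norm.const_mul M) ?_)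
  · refine Eventually.of_forall fun r => ?_
    have h : Integrable (F r) := by
      rw [funext (hFeq r)]
      exact (((hIh r).mul_const (E r)).indicator measurableSet_Ioi).comp_add_right (r / 2)
    exact h.aestronglyMeasurable
  · filter_upwards [eventually_ge_atTop 0] with r hr
    refine Eventually.of_forall fun z => ?_
    have hM0 : 0 ≤ M := (norm_nonneg _).trans (hM 0 0 (by norm_num) le_rfl)
    by_cases hz : -(r / 2) < z
    · rw [hFmem r z hz, norm_mul, mul_comm]
      exact mul_le_mul_of_nonneg_right (hM r z (by linarith) hr) (norm_nonneg _)
    · rw [hFnot r z hz, norm_zero]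
      positivity
  · refine Eventually.of_forall fun z => ?_
    have := (tendsto_barnesRatio h₁ h₂ hu hv z).const_mul (barnesIntegrand ω₁ ω₂ u z)
    rw [mul_one] at this
    refine this.congr' ?_
    filter_upwards [eventually_gt_atTop (-(2 * z))] with r hr
    exact (hFmem r z (by linarith)).symm

/-! ### Degeneration to the hyperbolic Euler integral -/

/-- The quotient by the Euler integrand of the integrand of `S_h(u - r α)`, multiplied by the
exponential factor of the limit formula; `p = u₇` and `q = u₈` are the parameters that move. -/
def eulerRatio (ω₁ ω₂ p q : ℂ) (r z : ℝ) : ℂ :=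
  (hypGamma ω₁ ω₂ (p + (z - r : ℝ)))⁻¹ * (hypGamma ω₁ ω₂ (q + (-(z - r) : ℝ)))⁻¹
    * ((hypGamma ω₁ ω₂ (p + (-(z + r) : ℝ)))⁻¹ * (hypGamma ω₁ ω₂ (q + (z + r : ℝ)))⁻¹)
    * Complex.exp (-2 * gaussRate ω₁ ω₂ * (p + q) * (2 * r - p + q))

lemma Ih_sub_alpha_eq (u : Fin 8 → ℂ) (r z : ℝ) :
    Ih ω₁ ω₂ (u - (r : ℂ) • alpha78) z
        * Complex.exp (-2 * gaussRate ω₁ ω₂ * (u 6 + u 7) * (2 * r - u 6 + u 7))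
      = eulerIntegrand ω₁ ω₂ ![u 0, u 1, u 2, u 3, u 4, u 5] z
        * eulerRatio ω₁ ω₂ (u 6) (u 7) r z := by
  rw [Ih_eq, eulerIntegrand_eq, symmIntegrand, symmIntegrand, Fin.prod_univ_eight,
    Fin.prod_univ_six, eulerRatio]
  have a1 : u 6 - r * 1 + z = u 6 + (z - r : ℝ) := by push_cast; ring
  have a2 : u 6 - r * 1 - z = u 6 + (-(z + r) : ℝ) := by push_cast; ring
  have a3 : u 7 - r * (-1) + z = u 7 + (z + r : ℝ) := by push_cast; ring
  have a4 : u 7 - r * (-1) - z = u 7 + (-(z - r) : ℝ) := by push_cast; ring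
  have b : alpha78 = ![0, 0, 0, 0, 0, 0, 1, -1] := rfl
  have c0 : (u - (r : ℂ) • alpha78) 0 = u 0 := by simp [b]
  have c1 : (u - (r : ℂ) • alpha78) 1 = u 1 := by simp [b]
  have c2 : (u - (r : ℂ) • alpha78) 2 = u 2 := by simp [b]
  have c3 : (u - (r : ℂ) • alpha78) 3 = u 3 := by simp [b]
  have c4 : (u - (r : ℂ) • alpha78) 4 = u 4 := by simp [b]
  have c5 : (u - (r : ℂ) • alpha78) 5 = u 5 := by simp [b]
  have c6 : (u - (r : ℂ) • alpha78) 6 = u 6 - r * 1 := by simp [b]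
  have c7 : (u - (r : ℂ) • alpha78) 7 = u 7 - r * (-1) := by simp [b]
  rw [c0, c1, c2, c3, c4, c5, c6, c7, a1, a2, a3, a4]
  have d0 : ![u 0, u 1, u 2, u 3, u 4, u 5] 0 = u 0 := rfl
  have d1 : ![u 0, u 1, u 2, u 3, u 4, u 5] 1 = u 1 := rfl
  have d2 : ![u 0, u 1, u 2, u 3, u 4, u 5] 2 = u 2 := rfl
  have d3 : ![u 0, u 1, u 2, u 3, u 4, u 5] 3 = u 3 := rfl
  have d4 : ![u 0, u 1, u 2, u 3, u 4, u 5] 4 = u 4 := rfl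
  have d5 : ![u 0, u 1, u 2, u 3, u 4, u 5] 5 = u 5 := rfl
  rw [d0, d1, d2, d3, d4, d5]
  ring

/-- The factors are bounded by multiples of `exp (2 c |z - r|)`, `exp (2 c |z + r|)` and
`exp (-4 c r)` with `c = Re (κ (p + q)) ≤ 0`, and `|z - r| + |z + r| ≥ 2 r`. -/
lemma exists_bound_eulerRatio (h₁ : 0 < ω₁.re) (h₂ : 0 < ω₂.re) {p q : ℂ}
    (hp : p.im < (om ω₁ ω₂).re) (hq : q.im < (om ω₁ ω₂).re)
    (hpq : (gaussRate ω₁ ω₂ * (p + q)).re ≤ 0) :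
    ∃ M : ℝ, ∀ r z : ℝ, ‖eulerRatio ω₁ ω₂ p q r z‖ ≤ M := by
  obtain ⟨P, hP, bp⟩ := exists_bound_inv_hypGamma h₁ h₂ hp
  obtain ⟨Q, hQ, bq⟩ := exists_bound_inv_hypGamma h₁ h₂ hq
  set E := Real.exp (-2 * gaussRate ω₁ ω₂ * (p + q) * (q - p)).re with hE
  refine ⟨P * Q * (P * Q) * E, fun r z => ?_⟩
  set k := (gaussRate ω₁ ω₂).re with hk
  set c := (gaussRate ω₁ ω₂ * (p + q)).re with hc
  have hc' : c = (gaussRate ω₁ ω₂ * p).re + (gaussRate ω₁ ω₂ * q).re := by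
    rw [hc, mul_add, Complex.add_re]
  have pair : ∀ x : ℝ, ‖(hypGamma ω₁ ω₂ (p + (x : ℝ)))⁻¹ * (hypGamma ω₁ ω₂ (q + (-x : ℝ)))⁻¹‖
      ≤ P * Q * Real.exp (2 * c * |x|) := by
    intro x
    rw [norm_mul]
    refine (mul_le_mul (bp x) (bq (-x)) (norm_nonneg _) (by positivity)).trans_eq ?_
    rw [mul_mul_mul_comm, ← Real.exp_add, abs_neg, hc']
    ring_nf
  have n1 := pair (z - r)
  have n2 := pair (-(z + r))
  rw [neg_neg, abs_neg] at n2
  have n3 : ‖Complex.exp (-2 * gaussRate ω₁ ω₂ * (p + q) * (2 * r - p + q))‖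
      = Real.exp (-4 * r * c) * E := by
    rw [Complex.norm_exp, hE, ← Real.exp_add, hc,
      show -2 * gaussRate ω₁ ω₂ * (p + q) * (2 * r - p + q)
        = ((-4 * r : ℝ) : ℂ) * (gaussRate ω₁ ω₂ * (p + q))
          + -2 * gaussRate ω₁ ω₂ * (p + q) * (q - p) by push_cast; ring,
      Complex.add_re, Complex.re_ofReal_mul]
  rw [eulerRatio, norm_mul, norm_mul, n3]
  have hexp : Real.exp (2 * c * |z - r|) * Real.exp (2 * c * |z + r|) * Real.exp (-4 * r * c)
      ≤ 1 := by
    rw [← Real.exp_add, ← Real.exp_add, Real.exp_le_one_iff]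
    have h3 : 2 * r ≤ |z - r| + |z + r| := by
      have h4 := neg_abs_le (z - r)
      have h5 := le_abs_self (z + r)
      linarith
    nlinarith
  calc _ ≤ (P * Q * Real.exp (2 * c * |z - r|)) * (P * Q * Real.exp (2 * c * |z + r|))
        * (Real.exp (-4 * r * c) * E) := by
        refine mul_le_mul_of_nonneg_right ?_ (by positivity)
        exact mul_le_mul n1 n2 (norm_nonneg _) (by positivity)
    _ = P * Q * (P * Q) * E * (Real.exp (2 * c * |z - r|) * Real.exp (2 * c * |z + r|)
        * Real.exp (-4 * r * c)) := by ring
    _ ≤ P * Q * (P * Q) * E := mul_le_of_le_one_right (by positivity) hexp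

lemma tendsto_eulerRatio (h₁ : 0 < ω₁.re) (h₂ : 0 < ω₂.re) {p q : ℂ}
    (hp : p.im < (om ω₁ ω₂).re) (hq : q.im < (om ω₁ ω₂).re) (z : ℝ) :
    Tendsto (fun r => eulerRatio ω₁ ω₂ p q r z) atTop (𝓝 1) := by
  have hC := gaussConst_ne_zero ω₁ ω₂
  have hm : Tendsto (fun r : ℝ => -z + r) atTop atTop :=
    tendsto_atTop_add_const_left _ _ tendsto_id
  have hx : Tendsto (fun r : ℝ => z + r) atTop atTop :=
    tendsto_atTop_add_const_left _ _ tendsto_id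
  have t1 := tendsto_inv_hypGamma_atBot h₁ h₂ hp hm
  have t2 := tendsto_inv_hypGamma_atTop h₁ h₂ hq hm
  have t3 := tendsto_inv_hypGamma_atBot h₁ h₂ hp hx
  have t4 := tendsto_inv_hypGamma_atTop h₁ h₂ hq hx
  have t := (t1.mul t2).mul (t3.mul t4)
  rw [mul_inv_cancel₀ hC, one_mul] at t
  refine t.congr fun r => ?_
  have key : Complex.exp (gaussRate ω₁ ω₂ * (p - (-z + r : ℝ)) ^ 2)
      * Complex.exp (-gaussRate ω₁ ω₂ * (q + (-z + r : ℝ)) ^ 2)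
      * (Complex.exp (gaussRate ω₁ ω₂ * (p - (z + r : ℝ)) ^ 2)
        * Complex.exp (-gaussRate ω₁ ω₂ * (q + (z + r : ℝ)) ^ 2))
      = Complex.exp (-2 * gaussRate ω₁ ω₂ * (p + q) * (2 * r - p + q)) := by
    simp only [← Complex.exp_add]
    congr 1
    push_cast
    ring
  rw [eulerRatio, ← key, show p + ((z - r : ℝ) : ℂ) = p - (-z + r : ℝ) by push_cast; ring,
    show q + ((-(z - r) : ℝ) : ℂ) = q + (-z + r : ℝ) by push_cast; ring,
    show p + ((-(z + r) : ℝ) : ℂ) = p - (z + r : ℝ) by push_cast; ring]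
  ring

lemma tendsto_Sh_alpha (h₁ : 0 < ω₁.re) (h₂ : 0 < ω₂.re) {u : Fin 8 → ℂ}
    (hu : u ∈ paramSpace (2 * Complex.I * om ω₁ ω₂)) (hv : ∀ j, (u j).im < (om ω₁ ω₂).re)
    (hσ : (gaussRate ω₁ ω₂ * (u 6 + u 7)).re ≤ 0)
    (hE : Integrable fun z : ℝ => eulerIntegrand ω₁ ω₂ ![u 0, u 1, u 2, u 3, u 4, u 5] z) :
    Tendsto (fun r : ℝ => Sh ω₁ ω₂ (u - (r : ℂ) • alpha78)
      * Complex.exp (-2 * gaussRate ω₁ ω₂ * (u 6 + u 7) * (2 * r - u 6 + u 7)))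
      atTop (𝓝 (Eh ω₁ ω₂ ![u 0, u 1, u 2, u 3, u 4, u 5])) := by
  have hSh : ∀ r : ℝ, Sh ω₁ ω₂ (u - (r : ℂ) • alpha78)
      * Complex.exp (-2 * gaussRate ω₁ ω₂ * (u 6 + u 7) * (2 * r - u 6 + u 7))
      = ∫ z : ℝ, eulerIntegrand ω₁ ω₂ ![u 0, u 1, u 2, u 3, u 4, u 5] z
        * eulerRatio ω₁ ω₂ (u 6) (u 7) r z := by
    intro r
    rw [Sh, ← integral_mul_const]
    exact integral_congr_ae (Eventually.of_forall fun z => Ih_sub_alpha_eq u r z)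
  simp_rw [hSh, Eh]
  obtain ⟨M, hM⟩ := exists_bound_eulerRatio h₁ h₂ (hv 6) (hv 7) hσ
  refine tendsto_integral_filter_of_dominated_convergence
    (fun z => M * ‖eulerIntegrand ω₁ ω₂ ![u 0, u 1, u 2, u 3, u 4, u 5] z‖) ?_ ?_
    (hE.norm.const_mul M) ?_
  · refine Eventually.of_forall fun r => ?_
    simp_rw [← Ih_sub_alpha_eq]
    exact ((integrable_Ih_sub h₁ h₂ hu hv alpha78_im sum_alpha78 r).mul_const
      _).aestronglyMeasurable
  · refine Eventually.of_forall fun r => Eventually.of_forall fun z => ?_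
    rw [norm_mul, mul_comm]
    exact mul_le_mul_of_nonneg_right (hM r z) (norm_nonneg _)
  · refine Eventually.of_forall fun z => ?_
    have := (tendsto_eulerRatio h₁ h₂ (hv 6) (hv 7) z).const_mul
      (eulerIntegrand ω₁ ω₂ ![u 0, u 1, u 2, u 3, u 4, u 5] z)
    rwa [mul_one] at this

lemma integrable_eulerIntegrand (h₁ : 0 < ω₁.re) (h₂ : 0 < ω₂.re) {u : Fin 8 → ℂ}
    (hv : ∀ j, (u j).im < (om ω₁ ω₂).re)
    (hc : (2 * om ω₁ ω₂ / (ω₁ * ω₂)).re <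
      (1 / (ω₁ * ω₂) * (u 0 + u 1 + u 2 + u 3 + u 4 + u 5)).im) :
    Integrable fun z : ℝ => eulerIntegrand ω₁ ω₂ ![u 0, u 1, u 2, u 3, u 4, u 5] z := by
  simp_rw [eulerIntegrand_eq]
  refine integrable_symmIntegrand h₁ h₂ (fun j => ?_) ?_
  · fin_cases j
    exacts [hv 0, hv 1, hv 2, hv 3, hv 4, hv 5]
  · have hsum : ∑ j, ![u 0, u 1, u 2, u 3, u 4, u 5] j = u 0 + u 1 + u 2 + u 3 + u 4 + u 5 := by
      rw [Fin.sum_univ_six]; rfl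
    rw [hsum, decayRate, gaussRate_mul_re, gaussRate_mul_re,
      show Complex.I * om ω₁ ω₂ / (ω₁ * ω₂) = om ω₁ ω₂ / (ω₁ * ω₂) * Complex.I by ring,
      Complex.mul_I_im]
    rw [one_div_mul_eq_div, show 2 * om ω₁ ω₂ / (ω₁ * ω₂)
      = ((2 : ℝ) : ℂ) * (om ω₁ ω₂ / (ω₁ * ω₂)) by push_cast; ring, Complex.re_ofReal_mul] at hc
    have := mul_lt_mul_of_pos_left hc (half_pos Real.pi_pos)
    linarith

end HypHyp

end

theorem proposition4p5 (ω₁ ω₂ : ℂ) (hω₁ : 0 < ω₁.re) (hω₂ : 0 < ω₂.re) (u : Fin 8 → ℂ)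
    (hu : u ∈ HypHyp.paramSpace (2 * Complex.I * HypHyp.om ω₁ ω₂))
    (him : ∀ j, (u j - Complex.I * HypHyp.om ω₁ ω₂).im < 0) :
    -- degeneration to the hyperbolic Barnes integral (all integrals converge absolutely)
    ((∀ r : ℝ, Integrable (fun z : ℝ => HypHyp.Ih ω₁ ω₂ (u - (r : ℂ) • HypHyp.beta1278) z)) ∧
      Integrable (fun z : ℝ => HypHyp.barnesIntegrand ω₁ ω₂ u z) ∧
      Tendsto (fun r : ℝ =>
          HypHyp.Sh ω₁ ω₂ (u - (r : ℂ) • HypHyp.beta1278)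
            * Complex.exp (2 * Real.pi * r * HypHyp.om ω₁ ω₂ / (ω₁ * ω₂))
            * Complex.exp (Real.pi * Complex.I / (2 * ω₁ * ω₂)
                * (∑ j ∈ {0, 1, 6, 7}, u j ^ 2 - ∑ j ∈ {2, 3, 4, 5}, u j ^ 2)))
        atTop (𝓝 (HypHyp.Bh ω₁ ω₂ u))) ∧
    -- degeneration to the hyperbolic Euler integral
    (0 ≤ ((u 6 + u 7) / (ω₁ * ω₂)).im →
      (2 * HypHyp.om ω₁ ω₂ / (ω₁ * ω₂)).re <
        (1 / (ω₁ * ω₂) * (u 0 + u 1 + u 2 + u 3 + u 4 + u 5)).im →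
      (∀ r : ℝ, Integrable (fun z : ℝ => HypHyp.Ih ω₁ ω₂ (u - (r : ℂ) • HypHyp.alpha78) z)) ∧
      Integrable (fun z : ℝ => HypHyp.eulerIntegrand ω₁ ω₂ ![u 0, u 1, u 2, u 3, u 4, u 5] z) ∧
      Tendsto (fun r : ℝ =>
          HypHyp.Sh ω₁ ω₂ (u - (r : ℂ) • HypHyp.alpha78)
            * Complex.exp (-(Real.pi * Complex.I / (ω₁ * ω₂))
                * (u 6 + u 7) * (2 * r - u 6 + u 7)))
        atTop (𝓝 (HypHyp.Eh ω₁ ω₂ ![u 0, u 1, u 2, u 3, u 4, u 5]))) := by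
  have hv : ∀ j, (u j).im < (HypHyp.om ω₁ ω₂).re := by
    intro j
    have := him j
    rw [Complex.sub_im, HypHyp.I_mul_om_im] at this
    linarith
  refine ⟨⟨HypHyp.integrable_Ih_sub hω₁ hω₂ hu hv HypHyp.beta1278_im HypHyp.sum_beta1278,
    HypHyp.integrable_barnesIntegrand hω₁ hω₂ hu hv, ?_⟩, fun hσ hc => ?_⟩
  · refine (HypHyp.tendsto_Sh_beta hω₁ hω₂ hu hv).congr fun r => ?_
    congr 3
    · rw [HypHyp.decayRate, HypHyp.gaussRate]
      linear_combination (-2 * Real.pi * r * HypHyp.om ω₁ ω₂ / (ω₁ * ω₂)) * Complex.I_sq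
    · rw [HypHyp.gaussRate, mul_assoc]
  · have hE := HypHyp.integrable_eulerIntegrand hω₁ hω₂ hv hc
    have hσ' : (HypHyp.gaussRate ω₁ ω₂ * (u 6 + u 7)).re ≤ 0 := by
      rw [HypHyp.gaussRate_mul_re]
      nlinarith [Real.pi_pos]
    refine ⟨HypHyp.integrable_Ih_sub hω₁ hω₂ hu hv HypHyp.alpha78_im HypHyp.sum_alpha78, hE,
      (HypHyp.tendsto_Sh_alpha hω₁ hω₂ hu hv hσ' hE).congr fun r => ?_⟩
    congr 4
    rw [HypHyp.gaussRate]
    ring
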